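/- Let $q$ be a power of an odd prime, $A=\mathbb F_q[T]$, $k=\mathbb F_q(T)$, $k_\infty=\mathbb F_q((1/T))$ with valuation ring $\mathcal O_\infty$ and absolute value normalized by $|T|=q$, $\mathbb C_\infty$ the completion of an algebraic closure of $k_\infty$, $\Omega=\mathbb C_\infty\smallsetminus k_\infty$ the Drinfeld upper half-plane, and $\Gamma=\mathrm{PGL}_2(A)$. The orbit $\Gamma z\in\Gamma\backslash\Omega$ of $z$ is identified with the isomorphism class of the rank $2$ Drinfeld $A$-module $\varphi_z$ over $\mathbb C_\infty$ uniformized by the lattice $A+zA$. For a non-square $D\in A$ let $\mathcal O_D=A[\sqrt D]\subseteq\mathbb C_\infty$, let $h(D)=\#\mathrm{Cl}(\mathcal O_D)$, and let $\mathrm{CM}(D)\subseteq\Gamma\backslash\Omega$ be the set of classes with $\mathrm{End}(\varphi_z)=\mathcal O_D$. Let $\mathcal V(\mathcal T)$ be the set of vertices of the Bruhat–Tits tree of $\mathrm{PGL}_2(k_\infty)$, that is, of homothety classes of rank $2$ $\mathcal O_\infty$-lattices in $k_\infty^2$. The elements of $\Gamma\backslash\mathcal V(\mathcal T)$ are $v_n$,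 $n\ge 0$, where $v_n$ is the class of $\mathrm{diag}(T^n,1)\,\mathcal O_\infty^2$. Let $\mu$ be the probability measure on $\Gamma\backslash\mathcal V(\mathcal T)$ that gives the orbit of a vertex $v$ a mass proportional to $1/\#\Gamma_v$, where $\Gamma_v$ is the stabilizer of $v$ in $\Gamma$; explicitly $\mu(v_0)=\frac{q-1}{2q}$ and $\mu(v_n)=\frac{q^2-1}{2q^{n+1}}$ for $n\ge 1$. Let $\bar\lambda$ be the map from $\Gamma\backslash\Omega$ to the quotient by $\Gamma$ of the realization of $\mathcal T$ that is induced by the building map. Let $f\in L^2(\Gamma\backslash\mathcal V(\mathcal T),\mu)$ be a complex-valued function supported on vertices $v_n$ with $n$ even (resp. odd). Then for every $\varepsilon>0$ there is a constant $c$, depending only on $q$, $f$ and $\varepsilon$, such that for all $D=D_K\mathfrak f^2$ with $D_K\in\mathbb F_q^\times$ a non-square (so that $K=k(\sqrt D)=\mathbb F_{q^2}(T)$) and $\mathfrak f\in A$ monic with $\deg\mathfrak f$ even (resp. odd), the set $\mathrm{CM}(D)$ is finite, $\bar\lambda$ maps $\mathrm{CM}(D)$ to vertices, and $$\left|\frac1{h(D)}\sum_{\Gamma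 z\in\mathrm{CM}(D)}f(\bar\lambda(z))-2\int_{\Gamma\backslash\mathcal V(\mathcal T)}f\,d\mu\right|\le c\,|D|^{-1/4+\varepsilon},\qquad |D|=q^{\deg D}.$$ -/

import Mathlib

open Polynomial MeasureTheory
open scoped NNReal ENNReal WithZero MatrixGroups

noncomputable section

namespace DrinfeldCM

/-! ### The fields `k_∞ = 𝔽_q((1/T))` and `ℂ_∞` -/

section Fields

variable (F : Type*) [Field F]

open scoped Classical in
/-- `k_∞ = 𝔽_q((1/T))`, the completion of `𝔽_q(T)` at the place `∞ = 1/T`. -/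
abbrev KInf : Type _ := RatFunc.CompletionAtInfty F

/-- The embedding `A = 𝔽_q[T] → k_∞`. -/
def toK : F[X] →+* KInf F :=
  (algebraMap (RatFunc F) (KInf F)).comp (algebraMap F[X] (RatFunc F))

theorem toK_injective : Function.Injective (toK F) :=
  (algebraMap (RatFunc F) (KInf F)).injective.comp (IsFractionRing.injective F[X] (RatFunc F))

/-- The valuation ring `𝒪_∞ = 𝔽_q[[1/T]]` of `k_∞`. -/
abbrev OInf : Subring (KInf F) := (Valued.v : Valuation (KInf F) ℤᵐ⁰).integer

variable [Fintype F]

/-- The cardinality `q` of the constant field. -/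
abbrev q : ℕ := Fintype.card F

theorem one_lt_q : (1 : ℝ≥0) < (q F : ℝ≥0) := by
  exact_mod_cast Fintype.one_lt_card

open scoped Classical in
/-- The absolute value of `k_∞` is normalized by `|T| = q`. -/
instance : Valuation.RankOne (Valued.v : Valuation (KInf F) ℤᵐ⁰) where
  hom' := (WithZeroMulInt.toNNReal (one_lt_q F).ne_zero).comp
    MonoidWithZeroHom.ValueGroup₀.embedding
  strictMono' := (WithZeroMulInt.toNNReal_strictMono (one_lt_q F)).comp
    MonoidWithZeroHom.ValueGroup₀.embedding_strictMono
  exists_val_nontrivial := by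
    refine ⟨((RatFunc.X : RatFunc F) : KInf F), ?_⟩
    have h : (Valued.v : Valuation (KInf F) ℤᵐ⁰) ((RatFunc.X : RatFunc F) : KInf F)
        = WithZero.exp 1 := by
      let _ := RatFunc.inftyValued F
      rw [RatFunc.valuedCompletionAtInfty.def]
      refine (Valued.extensionValuation_apply_coe (K := RatFunc F) (RatFunc.X : RatFunc F)).trans ?_
      exact RatFunc.inftyValuation.X F
    rw [h]
    exact ⟨WithZero.coe_ne_zero, by decide⟩

open scoped Classical in
instance : NontriviallyNormedField (KInf F) :=
  Valued.toNontriviallyNormedField (KInf F) ℤᵐ⁰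

open scoped Classical in
instance : CompleteSpace (KInf F) := by
  let _ := RatFunc.inftyValued F
  exact inferInstanceAs (CompleteSpace (UniformSpace.Completion (RatFunc F)))

instance : IsUltrametricDist (KInf F) := inferInstance

/-- An algebraic closure of `k_∞`. -/
abbrev KInfAlgCl : Type _ := AlgebraicClosure (KInf F)

/-- The absolute value of `k_∞` extended to its algebraic closure. -/
instance : NormedField (KInfAlgCl F) := spectralNorm.normedField (KInf F) (KInfAlgCl F)

instance : NormedAlgebra (KInf F) (KInfAlgCl F) := spectralNorm.normedAlgebra _ _

instance : UniformContinuousConstSMul (KInf F) (KInfAlgCl F) :=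
  uniformContinuousConstSMul_of_continuousConstSMul (KInf F) (KInfAlgCl F)

/-- `ℂ_∞`, the completion of an algebraic closure of `k_∞`. -/
abbrev CInf : Type _ := UniformSpace.Completion (KInfAlgCl F)

/-- The embedding `A = 𝔽_q[T] → ℂ_∞`. -/
def toC : F[X] →+* CInf F := (algebraMap (KInf F) (CInf F)).comp (toK F)

theorem toC_injective : Function.Injective (toC F) :=
  (algebraMap (KInf F) (CInf F)).injective.comp (toK_injective F)

end Fields

/-! ### The Drinfeld upper half-plane and its quotient by `Γ = PGL₂(A)` -/

section HalfPlane

variable (F : Type*) [Field F] [Fintype F]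

/-- The Drinfeld upper half-plane `Ω = ℂ_∞ ∖ k_∞`. -/
def Omega : Type _ := {z : CInf F // z ∉ Set.range (algebraMap (KInf F) (CInf F))}

variable {F}

/-- `γ z = (a z + b) / (c z + d)`. -/
def moebius (γ : GL (Fin 2) F[X]) (z : CInf F) : CInf F :=
  (toC F (γ 0 0) * z + toC F (γ 0 1)) / (toC F (γ 1 0) * z + toC F (γ 1 1))

theorem denom_ne_zero (γ : GL (Fin 2) F[X]) (z : Omega F) :
    toC F (γ 1 0) * z.1 + toC F (γ 1 1) ≠ 0 := by
  intro h
  have hdet : γ.1.det ≠ 0 := ((Matrix.isUnit_iff_isUnit_det _).1 γ.isUnit).ne_zero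
  rw [Matrix.det_fin_two] at hdet
  by_cases hc : γ 1 0 = 0
  · have hd : γ 1 1 = 0 := by
      rw [hc, map_zero, zero_mul, zero_add] at h
      exact (map_eq_zero_iff _ (toC_injective F)).1 h
    exact hdet (by rw [hc, hd]; ring)
  · have hc' : toC F (γ 1 0) ≠ 0 := (map_ne_zero_iff _ (toC_injective F)).2 hc
    refine z.2 ⟨-(toK F (γ 1 1)) / toK F (γ 1 0), ?_⟩
    rw [map_div₀, map_neg]
    change -(toC F (γ 1 1)) / toC F (γ 1 0) = z.1
    rw [div_eq_iff hc']
    linear_combination -h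

theorem moebius_one (z : CInf F) : moebius (1 : GL (Fin 2) F[X]) z = z := by
  simp [moebius]

theorem moebius_mul (γ δ : GL (Fin 2) F[X]) (z w : Omega F) (h : w.1 = moebius δ z.1) :
    moebius (γ * δ) z.1 = moebius γ w.1 := by
  have h1 := denom_ne_zero δ z
  have h2 := denom_ne_zero γ w
  have h3 := denom_ne_zero (γ * δ) z
  have e : w.1 * (toC F (δ 1 0) * z.1 + toC F (δ 1 1))
      = toC F (δ 0 0) * z.1 + toC F (δ 0 1) := by
    rw [h, moebius, div_mul_cancel₀ _ h1]
  rw [moebius, moebius, div_eq_div_iff h3 h2]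
  apply mul_right_cancel₀ h1
  simp only [Units.val_mul, Matrix.mul_apply, Fin.sum_univ_two, map_add, map_mul]
  linear_combination
    (toC F (γ 1 0) * (toC F (γ 0 0) * (toC F (δ 0 0) * z.1 + toC F (δ 0 1)) +
        toC F (γ 0 1) * (toC F (δ 1 0) * z.1 + toC F (δ 1 1))) -
      toC F (γ 0 0) * (toC F (γ 1 0) * (toC F (δ 0 0) * z.1 + toC F (δ 0 1)) +
        toC F (γ 1 1) * (toC F (δ 1 0) * z.1 + toC F (δ 1 1)))) * e

variable (F)

/-- Two points of `Ω` are equivalent if they lie in the same `Γ`-orbit. -/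
def omegaSetoid : Setoid (Omega F) where
  r z z' := ∃ γ : GL (Fin 2) F[X], z'.1 = moebius γ z.1
  iseqv := by
    refine ⟨fun z => ⟨1, (moebius_one z.1).symm⟩, ?_, ?_⟩
    · rintro z z' ⟨γ, h⟩
      refine ⟨γ⁻¹, ?_⟩
      rw [← moebius_mul γ⁻¹ γ z z' h, inv_mul_cancel, moebius_one]
    · rintro z z' z'' ⟨γ, h⟩ ⟨δ, h'⟩
      exact ⟨δ * γ, by rw [moebius_mul δ γ z z' h, h']⟩

/-- The points of the Drinfeld modular curve, `Y(ℂ_∞) = Γ \ Ω`: the orbit of `z` is the isomorphism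
class of the rank 2 Drinfeld module `φ_z` uniformized by the lattice `A + zA`. -/
def Y : Type _ := Quotient (omegaSetoid F)

variable {F}

/-- The class in `Γ \ Ω` of a point of `Ω`. -/
def Omega.toY (z : Omega F) : Y F := Quotient.mk (omegaSetoid F) z

end HalfPlane

/-! ### Drinfeld modules of rank 2, lattices, and complex multiplication -/

section Drinfeld

variable {F : Type*} [Field F] [Fintype F]

variable (F) in
/-- A rank 2 Drinfeld `A`-module `φ = T + g τ + Δ τ²` over `ℂ_∞`. -/
structure DrinfeldModule where
  /-- the coefficient of `τ` -/
  g : CInf F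
  /-- the coefficient of `τ²` -/
  Δ : CInf F
  Δ_ne_zero : Δ ≠ 0

/-- The ring of twisted polynomials `ℂ_∞{τ}`, realized as the `𝔽_q`-linear polynomials
`∑ a_i x^(q^i)`; the product of `ℂ_∞{τ}` is the composition of polynomials. -/
def IsTwisted (u : (CInf F)[X]) : Prop := ∀ n ∈ u.support, ∃ i : ℕ, n = q F ^ i

/-- The twisted polynomial `T + g τ + Δ τ²`, that is, the polynomial
`T x + g x^q + Δ x^(q²)`. -/
def DrinfeldModule.poly (φ : DrinfeldModule F) : (CInf F)[X] :=
  C (toC F X) * X + C φ.g * X ^ q F + C φ.Δ * X ^ (q F ^ 2)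

/-- `End(φ) = {u ∈ ℂ_∞{τ} | u φ = φ u}`. -/
def DrinfeldModule.endos (φ : DrinfeldModule F) : Set (CInf F)[X] :=
  {u | IsTwisted u ∧ u.comp φ.poly = φ.poly.comp u}

/-- The order `𝒪_D = A[√D]`, as a subring of `ℂ_∞`. -/
def order (D : F[X]) : Subring (CInf F) :=
  Subring.closure (Set.range (toC F) ∪ {x | x ^ 2 = toC F D})

/-- `φ` has complex multiplication by `𝒪_D`. Here `End(φ)` is viewed inside `ℂ_∞` through the
injective ring homomorphism `∑ a_i τ^i ↦ a_0`. -/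
def DrinfeldModule.HasCM (φ : DrinfeldModule F) (D : F[X]) : Prop :=
  (fun u : (CInf F)[X] => u.coeff 1) '' φ.endos = (order D : Set (CInf F))

/-- The lattice `Λ_z = A + zA`. -/
def lattice (z : CInf F) : Set (CInf F) := {l | ∃ a b : F[X], l = toC F a + z * toC F b}

/-- The exponential function `e_Λ(w) = w ∏_{0 ≠ l ∈ Λ} (1 - w / l)` of `Λ = Λ_z`. -/
def latticeExp (z w : CInf F) : CInf F :=
  w * ∏' l : {l : CInf F // l ∈ lattice z ∧ l ≠ 0}, (1 - w / l.1)

/-- `φ` is the Drinfeld module `φ_Λ` of the lattice `Λ = Λ_z`: `e_Λ(T w) = φ(e_Λ(w))`. -/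
def DrinfeldModule.IsUniformizedBy (φ : DrinfeldModule F) (z : Omega F) : Prop :=
  ∀ w : CInf F, latticeExp z.1 (toC F X * w) = φ.poly.eval (latticeExp z.1 w)

/-- `CM(D) ⊆ Y(ℂ_∞)`: the classes of the `z` such that `φ_z` has complex multiplication by
`𝒪_D`. -/
def CM (D : F[X]) : Set (Y F) :=
  {x | ∃ z : Omega F, z.toY = x ∧ ∃ φ : DrinfeldModule F, φ.IsUniformizedBy z ∧ φ.HasCM D}

/-- The class number `h(D) = # Cl(𝒪_D)`. -/
def classNumber (D : F[X]) : ℕ := Nat.card (ClassGroup (order D))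

end Drinfeld

/-! ### The vertices of the Bruhat–Tits tree modulo `Γ` -/

section Tree

variable (F : Type*) [Field F]

/-- The rank 2 `𝒪_∞`-lattices in `k_∞²`. Their homothety classes are the vertices of the
Bruhat–Tits tree of `PGL₂(k_∞)`. -/
def OLattice : Type _ :=
  {L : Submodule (OInf F) (Fin 2 → KInf F) //
    ∃ b : Module.Basis (Fin 2) (KInf F) (Fin 2 → KInf F),
      L = Submodule.span (OInf F) (Set.range b)}

variable {F}

/-- `γ [L] = [L']`: some multiple `c γ L` with `c ∈ k_∞^×` is equal to `L'`. -/
def MapsClass (γ : GL (Fin 2) F[X]) (L L' : OLattice F) : Prop :=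
  ∃ c : KInf F, c ≠ 0 ∧
    (L'.1 : Set (Fin 2 → KInf F)) =
      (fun x => c • (γ.1.map (toK F)).mulVec x) '' (L.1 : Set (Fin 2 → KInf F))

theorem mapsClass_one (L : OLattice F) : MapsClass 1 L L :=
  ⟨1, one_ne_zero, by simp⟩

theorem mapsClass_mul {γ δ : GL (Fin 2) F[X]} {L L' L'' : OLattice F}
    (h : MapsClass γ L L') (h' : MapsClass δ L' L'') : MapsClass (δ * γ) L L'' := by
  obtain ⟨c, hc, h⟩ := h
  obtain ⟨c', hc', h'⟩ := h'
  refine ⟨c' * c, mul_ne_zero hc' hc, ?_⟩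
  rw [h', h, Set.image_image]
  refine Set.image_congr fun x _ => ?_
  rw [Units.val_mul, Matrix.map_mul, ← Matrix.mulVec_mulVec, Matrix.mulVec_smul, mul_smul]

theorem mapsClass_inv {γ : GL (Fin 2) F[X]} {L L' : OLattice F}
    (h : MapsClass γ L L') : MapsClass γ⁻¹ L' L := by
  obtain ⟨c, hc, h⟩ := h
  refine ⟨c⁻¹, inv_ne_zero hc, ?_⟩
  rw [h, Set.image_image]
  have : ∀ x : Fin 2 → KInf F, c⁻¹ • ((γ⁻¹).1.map (toK F)).mulVec
      (c • (γ.1.map (toK F)).mulVec x) = x := by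
    intro x
    rw [Matrix.mulVec_smul, smul_smul, inv_mul_cancel₀ hc, one_smul, Matrix.mulVec_mulVec,
      ← Matrix.map_mul, ← Units.val_mul, inv_mul_cancel]
    simp
  simp only [this, Set.image_id']

variable (F)

/-- Two lattices are equivalent if their homothety classes lie in the same `Γ`-orbit. -/
def vertexSetoid : Setoid (OLattice F) where
  r L L' := ∃ γ : GL (Fin 2) F[X], MapsClass γ L L'
  iseqv := ⟨fun L => ⟨1, mapsClass_one L⟩, fun ⟨γ, h⟩ => ⟨γ⁻¹, mapsClass_inv h⟩,
    fun ⟨γ, h⟩ ⟨δ, h'⟩ => ⟨δ * γ, mapsClass_mul h h'⟩⟩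

/-- The set `Γ \ 𝒱(𝒯)` of vertices of the quotient of the Bruhat–Tits tree by `Γ`. -/
def QVertex : Type _ := Quotient (vertexSetoid F)

variable {F}

/-- The class in `Γ \ 𝒱(𝒯)` of a lattice. -/
def OLattice.toQ (L : OLattice F) : QVertex F := Quotient.mk (vertexSetoid F) L

variable (F)

theorem toK_X_ne_zero : toK F X ≠ 0 := (map_ne_zero_iff _ (toK_injective F)).2 X_ne_zero

/-- The basis `(Tⁿ, 0), (0, 1)` of `k_∞²`. -/
def gBasis (n : ℕ) : Module.Basis (Fin 2) (KInf F) (Fin 2 → KInf F) :=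
  (Pi.basisFun (KInf F) (Fin 2)).unitsSMul ![Units.mk0 _ (pow_ne_zero n (toK_X_ne_zero F)), 1]

/-- The lattice `g_n 𝒪_∞²` with `g_n = diag(Tⁿ, 1)`. -/
def gLattice (n : ℕ) : OLattice F :=
  ⟨Submodule.span (OInf F) (Set.range (gBasis F n)), gBasis F n, rfl⟩

/-- The vertex `v_n` of `Γ \ 𝒯`. -/
def vtx (n : ℕ) : QVertex F := (gLattice F n).toQ

variable {F}

/-- The stabilizer of the vertex `[L]` in `Γ = PGL₂(A)`. -/
def stab (L : OLattice F) : Set PGL(2, F[X]) :=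
  {g | ∃ γ : GL (Fin 2) F[X], Matrix.ProjGenLinGroup.mk γ = g ∧ MapsClass γ L L}

instance : MeasurableSpace (QVertex F) := ⊤

variable (F)

/-- The measure on `Γ \ 𝒱(𝒯)` that gives the mass `1 / #Γ_v` to the orbit of a vertex `v`, where
`Γ_v` is the (finite) stabilizer of `v` in `Γ`; its order only depends on the orbit. -/
def stabMeasure : Measure (QVertex F) :=
  Measure.count.withDensity fun v => ((Nat.card (stab (Quotient.out v)) : ℕ) : ℝ≥0∞)⁻¹

/-- The probability measure `μ` on `Γ \ 𝒱(𝒯)` proportional to `1 / #Γ_v`. -/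
def mu : Measure (QVertex F) := (stabMeasure F Set.univ)⁻¹ • stabMeasure F

end Tree

/-! ### The building map -/

section Building

variable {F : Type*} [Field F] [Fintype F]

/-- The building map `λ` sends `z ∈ Ω` to the vertex `[L]`. The points of the realization of the
tree are the homothety classes of norms on the space of row vectors `k_∞²`; the class of the lattice
`L ⊆ k_∞²` (column vectors) is the vertex of the norm `w ↦ sup_{x ∈ L} |w x|`, whose unit ball is
the dual of `L`, and `λ(z)` is the class of the norm `w ↦ |w₀ z + w₁|`. -/
def IsBuildingVertex (z : Omega F) (L : OLattice F) : Prop :=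
  ∃ r : ℝ, 0 < r ∧ ∀ w : Fin 2 → KInf F,
    IsLUB ((fun x : Fin 2 → KInf F => ‖w ⬝ᵥ x‖) '' (L.1 : Set (Fin 2 → KInf F)))
      (r * ‖algebraMap (KInf F) (CInf F) (w 0) * z.1 + algebraMap (KInf F) (CInf F) (w 1)‖)

open scoped Classical in
/-- The map `λ̄ : Γ \ Ω → Γ \ 𝒯` induced by the building map, on the classes that are sent to a
vertex (and `v_0` elsewhere). -/
def lambdaBar (x : Y F) : QVertex F :=
  if h : ∃ L : OLattice F, ∃ z : Omega F, z.toY = x ∧ IsBuildingVertex z L then h.choose.toQ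
  else vtx F 0

end Building

end DrinfeldCM

end

/-!
# Equidistribution of CM points on the quotient of the Bruhat–Tits tree

Write `D = a 𝔣 ^ 2`, `d = deg 𝔣`, `q` for the order of `F`, `j = √a`, `B = 𝔽_{q²}[T]` for the
maximal order, so that `𝒪_D = A + 𝔣 j A = A + 𝔣 B`.

*From Drinfeld modules to lattices.* The exponential function of `Λ_z = A + zA` identifies
`End(φ_z)` with the ring of multipliers of `Λ_z` (`endos_image_eq_multipliers`), so `CM(D)` consists
of the homothety classes of lattices with multiplier ring `𝒪_D` (`mem_CM_iff`). Such a lattice is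
homothetic to `u A + 𝔣 B` with `u` a unit of `B / 𝔣 B` (`exists_hasLine`), two of these being
homothetic if and only if they differ by a constant of `𝔽_{q²}` (`toY_eq_iff_lineSim`). The same
lines, up to the same relation, are the ideal classes of `𝒪_D` (`lineClass_eq_iff`,
`lineClass_surjective`). Multiplication by units of `B / 𝔣 B` permutes the classes transitively, so
the average over `CM(D)` is the average over all `u` (`exists_average_CM`).

*The building map.* On `ℂ_∞ ⊇ B` the absolute value is `q ^ deg`, so a reduced basis of
`u A + 𝔣 B` is orthogonal with norms `q ^ m` and `q ^ (d - m)`, where `m` is the least degree of a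
non-zero element. Hence the class is mapped to `v_n` with `n = d - 2 m`, and `u A + 𝔣 B` has
`q ^ (L - m)` elements of degree `< L` as long as `2 L ≤ d + 1` (`exists_omega_of_line`).

*Counting.* The distribution of `m` follows from the average over `u` of the number of elements
of degree `< L`. An element in the residue class of `c u`, `c ∈ A`, is an element of `B` in the unit
orbit of `c`. With `g = gcd(c, 𝔣)` these are the `g y` with `y` prime to `𝔣 / g`, which a sieve
counts with an error bounded in terms of the number `W` of divisors of `𝔣` in `B`. Summing over `c`,
the average is `1 + q ^ (2 L - d)` up to `2 W ^ 3 q ^ (L - d)` (`abs_average_sub_le`).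

*Conclusion.* The proportion of `u` with `n = d - 2 m` is therefore `2 μ(v_n)` up to
`16 W ^ 3 q ^ (m - d)` (`abs_card_firstMin_eq_sub`). Square integrability gives
`f(v_n) = O(q ^ (n / 2))`, so each of the at most `d + 1` values of `n` contributes an error
`O(W ^ 3 q ^ (- d / 2)) = O(W ^ 3 |D| ^ (-1/4))`, as does the part of the integral with `n > d`
(`norm_average_sub_le`). The divisor bound `exists_numDiv_le` turns `(d + 1) W ^ 3` into
`O(|D| ^ ε)`.
-/

open Polynomial MeasureTheory
open scoped NNReal ENNReal WithZero MatrixGroups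

noncomputable section

namespace DrinfeldCM

/-! ### Absolute values on `k_∞` and `ℂ_∞` -/

section AbsoluteValues

variable (F : Type*) [Field F] [Fintype F]

theorem one_lt_q_real : (1 : ℝ) < q F := by exact_mod_cast Fintype.one_lt_card

theorem q_pos : (0 : ℝ) < q F := zero_lt_one.trans (one_lt_q_real F)

instance : IsUltrametricDist (KInfAlgCl F) :=
  IsUltrametricDist.isUltrametricDist_of_isNonarchimedean_norm isNonarchimedean_spectralNorm

instance : IsUltrametricDist (CInf F) := by
  refine ⟨fun x y z => ?_⟩
  induction x, y, z using UniformSpace.Completion.induction_on₃ with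
  | hp => exact isClosed_le (by fun_prop) (by fun_prop)
  | ih x y z =>
    simp only [UniformSpace.Completion.dist_eq]
    exact dist_triangle_max x y z

variable {F}

theorem norm_eq_toNNReal (x : KInf F) :
    ‖x‖ = WithZeroMulInt.toNNReal (one_lt_q F).ne_zero (Valued.v x) := by
  have h : MonoidWithZeroHom.ValueGroup₀.embedding ((Valued.v : Valuation (KInf F) ℤᵐ⁰).restrict x)
    = Valued.v x := MonoidWithZeroHom.ValueGroup₀.embedding_restrict₀ _
  rw [← h]
  rfl

theorem norm_KInf_eq_zpow {x : KInf F} (hx : x ≠ 0) : ∃ n : ℤ, ‖x‖ = (q F : ℝ) ^ n := by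
  have h : (Valued.v : Valuation (KInf F) ℤᵐ⁰) x ≠ 0 := (Valuation.ne_zero_iff _).2 hx
  refine ⟨Multiplicative.toAdd (WithZero.unzero h), ?_⟩
  rw [norm_eq_toNNReal, WithZeroMulInt.toNNReal_neg_apply _ h]
  simp

open scoped Classical in
theorem valued_coe_ratFunc (x : RatFunc F) :
    (Valued.v : Valuation (KInf F) ℤᵐ⁰) (algebraMap (RatFunc F) (KInf F) x)
      = RatFunc.inftyValuation F x := by
  let _ := RatFunc.inftyValued F
  rw [RatFunc.valuedCompletionAtInfty.def]
  exact Valued.extensionValuation_apply_coe (K := RatFunc F) x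

open scoped Classical in
theorem norm_coe_ratFunc {x : RatFunc F} (hx : x ≠ 0) :
    ‖algebraMap (RatFunc F) (KInf F) x‖ = (q F : ℝ) ^ x.intDegree := by
  rw [norm_eq_toNNReal, valued_coe_ratFunc, RatFunc.inftyValuation_apply,
    RatFunc.inftyValuation_of_nonzero F hx,
    WithZeroMulInt.toNNReal_neg_apply _ WithZero.exp_ne_zero]
  simp [WithZero.exp]

theorem norm_toK {p : F[X]} (hp : p ≠ 0) : ‖toK F p‖ = (q F : ℝ) ^ p.natDegree := by
  have h : algebraMap F[X] (RatFunc F) p ≠ 0 := by simpa using hp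
  rw [toK, RingHom.comp_apply, norm_coe_ratFunc h, RatFunc.intDegree_polynomial, zpow_natCast]

theorem norm_toK_X : ‖toK F X‖ = q F := by simpa using norm_toK (F := F) X_ne_zero

theorem one_le_norm_toK {p : F[X]} (hp : p ≠ 0) : 1 ≤ ‖toK F p‖ := by
  rw [norm_toK hp]
  exact one_le_pow₀ (one_lt_q_real F).le

/-- `k_∞ = A + {|x| < 1}`: division with remainder in `A`, extended to `k_∞` by density. -/
theorem exists_norm_sub_toK_lt_one (y : KInf F) : ∃ s : F[X], ‖y - toK F s‖ < 1 := by
  classical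
  have hd : DenseRange (algebraMap (RatFunc F) (KInf F)) := by
    let _ := RatFunc.inftyValued F
    exact UniformSpace.Completion.denseRange_coe (α := RatFunc F)
  obtain ⟨x, hx⟩ := hd.exists_dist_lt y (ε := 1) one_pos
  refine ⟨x.num / x.denom, ?_⟩
  have h : ‖algebraMap (RatFunc F) (KInf F) x - toK F (x.num / x.denom)‖ < 1 := by
    have hden := x.denom_ne_zero
    have hdK : toK F x.denom ≠ 0 := (map_ne_zero_iff _ (toK_injective F)).2 hden
    have e : algebraMap (RatFunc F) (KInf F) x - toK F (x.num / x.denom)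
        = toK F (x.num % x.denom) / toK F x.denom := by
      rw [eq_div_iff hdK]
      have h1 : algebraMap (RatFunc F) (KInf F) x * toK F x.denom = toK F x.num := by
        have h0 := congrArg (algebraMap (RatFunc F) (KInf F)) x.num_div_denom
        rw [map_div₀] at h0
        rw [← h0]
        exact div_mul_cancel₀ _ hdK
      have h2 : toK F x.num = toK F (x.denom * (x.num / x.denom) + x.num % x.denom) := by
        rw [EuclideanDomain.div_add_mod]
      rw [sub_mul, h1, h2, map_add, map_mul]
      ring
    rw [e, norm_div]
    by_cases hr : x.num % x.denom = 0
    · simp [hr]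
    · rw [div_lt_one (norm_pos_iff.2 hdK), norm_toK hr, norm_toK hden]
      exact pow_lt_pow_right₀ (one_lt_q_real F)
        (natDegree_lt_natDegree hr (EuclideanDomain.mod_lt x.num hden))
  rw [dist_eq_norm] at hx
  have := IsUltrametricDist.norm_add_le_max (y - algebraMap (RatFunc F) (KInf F) x)
    (algebraMap (RatFunc F) (KInf F) x - toK F (x.num / x.denom))
  rw [sub_add_sub_cancel] at this
  exact this.trans_lt (max_lt hx h)

theorem norm_algebraMap_CInf (x : KInf F) : ‖algebraMap (KInf F) (CInf F) x‖ = ‖x‖ :=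
  norm_algebraMap' _ x

theorem norm_toC {p : F[X]} (hp : p ≠ 0) : ‖toC F p‖ = (q F : ℝ) ^ p.natDegree := by
  rw [toC, RingHom.comp_apply, norm_algebraMap_CInf, norm_toK hp]

theorem toC_ne_zero {p : F[X]} (hp : p ≠ 0) : toC F p ≠ 0 :=
  (map_ne_zero_iff _ (toC_injective F)).2 hp

theorem algebraMap_toK (p : F[X]) : algebraMap (KInf F) (CInf F) (toK F p) = toC F p := rfl

theorem mem_OInf {x : KInf F} : x ∈ OInf F ↔ ‖x‖ ≤ 1 := by
  rw [Valuation.mem_integer_iff]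
  exact Valued.toNormedField.norm_le_one_iff.symm

end AbsoluteValues

/-! ### Infinite products and the exponential function of a discrete subgroup -/

section NonarchimedeanProducts

open Filter Topology

variable {𝕜 : Type*} [NormedField 𝕜] [IsUltrametricDist 𝕜]

theorem norm_prod_one_add_sub_one_le {ι : Type*} (s : Finset ι) (f : ι → 𝕜) {ε : ℝ}
    (h0 : 0 ≤ ε) (h1 : ε ≤ 1) (hf : ∀ i ∈ s, ‖f i‖ ≤ ε) : ‖∏ i ∈ s, (1 + f i) - 1‖ ≤ ε := by
  classical
  induction s using Finset.induction_on with
  | empty => simpa using h0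
  | insert i s hi ih =>
    have h2 := hf i (Finset.mem_insert_self i s)
    have h3 := ih fun j hj => hf j (Finset.mem_insert_of_mem hj)
    have h4 : ‖1 + f i‖ ≤ 1 :=
      (IsUltrametricDist.norm_add_le_max _ _).trans (max_le (by simp) (h2.trans h1))
    rw [Finset.prod_insert hi, show (1 + f i) * ∏ j ∈ s, (1 + f j) - 1
      = (1 + f i) * (∏ j ∈ s, (1 + f j) - 1) + f i by ring]
    refine (IsUltrametricDist.norm_add_le_max _ _).trans (max_le ?_ h2)
    rw [norm_mul]
    calc _ ≤ 1 * ε := by gcongr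
      _ = ε := one_mul ε

theorem norm_one_add_of_norm_lt_one {x : 𝕜} (hx : ‖x‖ < 1) : ‖1 + x‖ = 1 := by
  rw [IsUltrametricDist.norm_add_eq_max_of_norm_ne_norm (by simp [hx.ne'])]
  simpa using hx.le

theorem norm_prod_eq_of_subset {ι : Type*} {s t : Finset ι} (f : ι → 𝕜) (hst : s ⊆ t)
    (hf : ∀ i ∉ s, ‖f i‖ < 1) : ‖∏ i ∈ t, (1 + f i)‖ = ‖∏ i ∈ s, (1 + f i)‖ := by
  classical
  rw [← Finset.prod_sdiff hst, norm_mul, norm_prod, Finset.prod_eq_one, one_mul]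
  intro i hi
  exact norm_one_add_of_norm_lt_one (hf i (Finset.mem_sdiff.1 hi).2)

theorem finite_le_norm_of_tendsto {ι : Type*} {f : ι → 𝕜} (hf : Tendsto f cofinite (𝓝 0))
    {ε : ℝ} (hε : 0 < ε) : {i | ε ≤ ‖f i‖}.Finite := by
  have h := (Metric.nhds_basis_ball.tendsto_right_iff.1 hf) ε hε
  simpa [Filter.eventually_cofinite] using h

/-- Over a complete ultrametric field a product converges unconditionally as soon as its factors
tend to `1`. -/
theorem multipliable_one_add_of_tendsto_zero [CompleteSpace 𝕜] {ι : Type*} {f : ι → 𝕜}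
    (hf : Tendsto f cofinite (𝓝 0)) : Multipliable fun i => 1 + f i := by
  classical
  rw [multipliable_iff_cauchySeq_finset, Metric.cauchySeq_iff']
  intro ε hε
  set s₁ := (finite_le_norm_of_tendsto hf one_pos).toFinset with hs₁
  have hs₁' : ∀ i ∉ s₁, ‖f i‖ < 1 := fun i hi => by simpa [hs₁] using hi
  set M := ‖∏ i ∈ s₁, (1 + f i)‖ with hM
  have hM0 : 0 ≤ M := norm_nonneg _
  have hδ : 0 < min 1 (ε / (M + 1) / 2) := by positivity
  set s₂ := (finite_le_norm_of_tendsto hf hδ).toFinset with hs₂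
  have hs₂' : ∀ i ∉ s₂, ‖f i‖ < min 1 (ε / (M + 1) / 2) := fun i hi => by
    simp only [hs₂, Set.Finite.mem_toFinset, Set.mem_ofPred_eq, not_le] at hi
    exact hi
  refine ⟨s₁ ∪ s₂, fun n hn => ?_⟩
  rw [dist_eq_norm, ← Finset.prod_sdiff hn, ← sub_one_mul, norm_mul,
    norm_prod_eq_of_subset f Finset.subset_union_left hs₁', ← hM]
  have h1 := norm_prod_one_add_sub_one_le (n \ (s₁ ∪ s₂)) f hδ.le (min_le_left _ _) fun i hi =>
    (hs₂' i fun h => (Finset.mem_sdiff.1 hi).2 (Finset.mem_union_right _ h)).le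
  calc _ ≤ (ε / (M + 1) / 2) * M := by gcongr; exact h1.trans (min_le_right _ _)
    _ < ε := by
      rw [div_div, div_mul_eq_mul_div, div_lt_iff₀ (by positivity)]
      nlinarith

theorem tprod_one_add_ne_zero [CompleteSpace 𝕜] {ι : Type*} {f : ι → 𝕜}
    (hf : Tendsto f cofinite (𝓝 0)) (h0 : ∀ i, 1 + f i ≠ 0) : ∏' i, (1 + f i) ≠ 0 := by
  classical
  set s₁ := (finite_le_norm_of_tendsto hf one_pos).toFinset with hs₁
  have hs₁' : ∀ i ∉ s₁, ‖f i‖ < 1 := fun i hi => by simpa [hs₁] using hi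
  have h := (multipliable_one_add_of_tendsto_zero hf).hasProd.norm
  have h' : Tendsto (fun s : Finset ι => ‖∏ i ∈ s, (1 + f i)‖) atTop
      (𝓝 ‖∏ i ∈ s₁, (1 + f i)‖) := by
    refine tendsto_const_nhds.congr' ?_
    filter_upwards [eventually_ge_atTop s₁] with s hs
    exact (norm_prod_eq_of_subset f hs hs₁').symm
  have h2 : Tendsto (fun s : Finset ι => ‖∏ i ∈ s, (1 + f i)‖) atTop
      (𝓝 ‖∏' i, (1 + f i)‖) := by simpa [HasProd, norm_prod] using h
  rw [← norm_ne_zero_iff, tendsto_nhds_unique h2 h', norm_ne_zero_iff]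
  exact Finset.prod_ne_zero_iff.2 fun i _ => h0 i

theorem norm_tprod_one_add_sub_one_le [CompleteSpace 𝕜] {ι : Type*} {f : ι → 𝕜}
    (hf : Tendsto f cofinite (𝓝 0)) {ε : ℝ} (h0 : 0 ≤ ε) (h1 : ε ≤ 1) (hε : ∀ i, ‖f i‖ ≤ ε) :
    ‖∏' i, (1 + f i) - 1‖ ≤ ε := by
  have h : Tendsto (fun s : Finset ι => ‖∏ i ∈ s, (1 + f i) - 1‖) atTop
      (𝓝 ‖∏' i, (1 + f i) - 1‖) :=
    ((multipliable_one_add_of_tendsto_zero hf).hasProd.sub_const 1).norm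
  exact le_of_tendsto h (Eventually.of_forall fun s =>
    norm_prod_one_add_sub_one_le s f h0 h1 fun i _ => hε i)

end NonarchimedeanProducts

section SubgroupExp

open Filter Topology

variable {𝕜 : Type*} [NormedField 𝕜]

/-- A subgroup `Λ` of a normed field is strongly discrete if every ball contains only finitely many
of its elements. -/
def StronglyDiscrete (Λ : AddSubgroup 𝕜) : Prop := ∀ R : ℝ, {l : 𝕜 | l ∈ Λ ∧ ‖l‖ ≤ R}.Finite

open scoped Classical in
/-- The factor of the exponential function that belongs to `l`: `1 - w / l` for `l ≠ 0`, and `w`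
for `l = 0`. -/
def expFactor (w l : 𝕜) : 𝕜 := if l = 0 then w else 1 - w / l

/-- The exponential function `e_Λ(w) = w ∏_{0 ≠ l ∈ Λ} (1 - w / l)` of a subgroup `Λ`, as a product
over all of `Λ`. -/
def expSub (Λ : AddSubgroup 𝕜) (w : 𝕜) : 𝕜 := ∏' l : Λ, expFactor w l.1

theorem expFactor_eq_zero_iff {w l : 𝕜} : expFactor w l = 0 ↔ w = l := by
  unfold expFactor
  split_ifs with h
  · rw [h]
  · rw [sub_eq_zero, eq_div_iff h, one_mul, eq_comm]

variable {Λ : AddSubgroup 𝕜}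

theorem StronglyDiscrete.tendsto (hΛ : StronglyDiscrete Λ) (w : 𝕜) :
    Tendsto (fun l : Λ => expFactor w l.1 - 1) cofinite (𝓝 0) := by
  rw [Metric.nhds_basis_ball.tendsto_right_iff]
  intro ε hε
  rw [Filter.eventually_cofinite]
  refine Set.Finite.of_finite_image (f := Subtype.val)
    ((hΛ (‖w‖ / ε)).subset ?_) Subtype.val_injective.injOn
  rintro _ ⟨l, hl, rfl⟩
  refine ⟨l.2, ?_⟩
  by_cases h0 : l.1 = 0
  · rw [h0, norm_zero]; positivity
  · simp only [mem_ball_zero_iff, not_lt, Set.mem_ofPred_eq, expFactor, if_neg h0] at hl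
    rw [sub_sub_cancel_left, norm_neg, norm_div, le_div_iff₀ (norm_pos_iff.2 h0)] at hl
    rw [le_div_iff₀ hε, mul_comm]
    exact hl

variable [IsUltrametricDist 𝕜] [CompleteSpace 𝕜]

theorem StronglyDiscrete.multipliable (hΛ : StronglyDiscrete Λ) (w : 𝕜) :
    Multipliable fun l : Λ => expFactor w l.1 := by
  simpa using multipliable_one_add_of_tendsto_zero (hΛ.tendsto w)

theorem StronglyDiscrete.hasProd (hΛ : StronglyDiscrete Λ) (w : 𝕜) :
    HasProd (fun l : Λ => expFactor w l.1) (expSub Λ w) := (hΛ.multipliable w).hasProd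

theorem expSub_eq_zero_iff (hΛ : StronglyDiscrete Λ) {w : 𝕜} : expSub Λ w = 0 ↔ w ∈ Λ := by
  constructor
  · intro h
    by_contra hw
    have := tprod_one_add_ne_zero (hΛ.tendsto w) (fun l => by
      rw [add_sub_cancel, Ne, expFactor_eq_zero_iff]
      rintro rfl
      exact hw l.2)
    simp only [add_sub_cancel] at this
    exact this h
  · intro h
    exact tprod_of_exists_eq_zero ⟨⟨w, h⟩, expFactor_eq_zero_iff.2 rfl⟩

theorem expSub_zero (hΛ : StronglyDiscrete Λ) : expSub Λ 0 = 0 :=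
  (expSub_eq_zero_iff hΛ).2 Λ.zero_mem

/-- The product over all of `Λ` splits into the factor at `0` and the product over `Λ ∖ {0}`. -/
theorem expSub_eq_mul_tprod (hΛ : StronglyDiscrete Λ) (w : 𝕜) :
    expSub Λ w = w * ∏' l : {l : 𝕜 // l ∈ Λ ∧ l ≠ 0}, (1 - w / l.1) := by
  classical
  let i : {l : 𝕜 // l ∈ Λ ∧ l ≠ 0} → Λ := fun l => ⟨l.1, l.2.1⟩
  have hi : Function.Injective i := fun a b h => Subtype.ext (congrArg (fun x : Λ => x.1) h)
  have ht : Tendsto (fun l : {l : 𝕜 // l ∈ Λ ∧ l ≠ 0} => -(w / l.1)) cofinite (𝓝 0) := by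
    refine ((hΛ.tendsto w).comp hi.tendsto_cofinite).congr fun l => ?_
    simp [i, expFactor, l.2.2]
  have h1 : HasProd (fun l : {l : 𝕜 // l ∈ Λ ∧ l ≠ 0} => 1 - w / l.1)
      (∏' l : {l : 𝕜 // l ∈ Λ ∧ l ≠ 0}, (1 - w / l.1)) := by
    simpa [sub_eq_add_neg] using (multipliable_one_add_of_tendsto_zero ht).hasProd
  let g : Λ → 𝕜 := fun l => if l.1 = 0 then 1 else expFactor w l.1
  have h2 : HasProd g (∏' l : {l : 𝕜 // l ∈ Λ ∧ l ≠ 0}, (1 - w / l.1)) := by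
    rw [← hi.hasProd_iff]
    · convert h1 using 2 with l
      simp [g, i, expFactor, l.2.2]
    · intro l hl
      by_contra h
      have h0 : l.1 ≠ 0 := fun h0 => h (if_pos h0)
      exact hl ⟨⟨l.1, l.2, h0⟩, rfl⟩
  have h3 : HasProd (fun l : Λ => if l = 0 then w else 1) w := by
    simpa using hasProd_ite_eq (0 : Λ) w
  have h4 := h3.mul h2
  refine (HasProd.unique ?_ h4 : _)
  convert hΛ.hasProd w using 2 with l
  by_cases h : l = 0
  · subst h; simp [g, expFactor]
  · have h' : l.1 ≠ 0 := fun h' => h (Subtype.ext h')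
    simp [g, h]

theorem norm_expSub_sub_le (hΛ : StronglyDiscrete Λ) :
    ∃ δ C : ℝ, 0 < δ ∧ 0 ≤ C ∧ ∀ w : 𝕜, ‖w‖ ≤ δ → ‖expSub Λ w - w‖ ≤ C * ‖w‖ ^ 2 := by
  obtain ⟨δ, hδ, hl⟩ : ∃ δ : ℝ, 0 < δ ∧ ∀ l ∈ Λ, l ≠ 0 → δ ≤ ‖l‖ := by
    have hfin : {l : 𝕜 | (l ∈ Λ ∧ l ≠ 0) ∧ ‖l‖ ≤ 1}.Finite :=
      (hΛ 1).subset fun l hl => ⟨hl.1.1, hl.2⟩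
    rcases Set.eq_empty_or_nonempty {l : 𝕜 | (l ∈ Λ ∧ l ≠ 0) ∧ ‖l‖ ≤ 1} with he | hne
    · refine ⟨1, one_pos, fun l hl h0 => ?_⟩
      by_contra h
      exact (he ▸ Set.notMem_empty l : l ∉ {l : 𝕜 | (l ∈ Λ ∧ l ≠ 0) ∧ ‖l‖ ≤ 1})
        ⟨⟨hl, h0⟩, (not_le.1 h).le⟩
    · obtain ⟨m, hm, hmin⟩ := hfin.exists_minimalFor (fun l => ‖l‖) _ hne
      refine ⟨‖m‖, norm_pos_iff.2 hm.1.2, fun l hl h0 => ?_⟩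
      by_cases h : ‖l‖ ≤ 1
      · by_contra hc
        exact hc (hmin ⟨⟨hl, h0⟩, h⟩ (not_le.1 hc).le)
      · exact hm.2.trans (not_le.1 h).le
  refine ⟨δ, δ⁻¹, hδ, by positivity, fun w hw => ?_⟩
  have ht : Tendsto (fun l : {l : 𝕜 // l ∈ Λ ∧ l ≠ 0} => -(w / l.1)) cofinite (𝓝 0) := by
    let i : {l : 𝕜 // l ∈ Λ ∧ l ≠ 0} → Λ := fun l => ⟨l.1, l.2.1⟩
    have hi : Function.Injective i := fun a b h => Subtype.ext (congrArg (fun x : Λ => x.1) h)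
    refine ((hΛ.tendsto w).comp hi.tendsto_cofinite).congr fun l => ?_
    simp [i, expFactor, l.2.2]
  have h := norm_tprod_one_add_sub_one_le ht (ε := ‖w‖ / δ) (by positivity)
    ((div_le_one hδ).2 hw) fun l => by
      rw [norm_neg, norm_div]
      exact div_le_div_of_nonneg_left (norm_nonneg _) hδ (hl l.1 l.2.1 l.2.2)
  rw [expSub_eq_mul_tprod hΛ, ← mul_sub_one, norm_mul]
  simp only [← sub_eq_add_neg] at h
  calc _ ≤ ‖w‖ * (‖w‖ / δ) := by gcongr
    _ = δ⁻¹ * ‖w‖ ^ 2 := by field_simp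

omit [IsUltrametricDist 𝕜] [CompleteSpace 𝕜] in
/-- For a finite subgroup `V` the polynomial `∏_{v ∈ V} (x - v)` is additive: the difference of both
sides has degree less than `#V` and vanishes on `V`. -/
theorem prod_sub_add (V : Finset 𝕜) (h0 : (0 : 𝕜) ∈ V) (hsub : ∀ x ∈ V, ∀ y ∈ V, x - y ∈ V)
    (x y : 𝕜) : ∏ v ∈ V, (x + y - v) = ∏ v ∈ V, (x - v) + ∏ v ∈ V, (y - v) := by
  classical
  let P : 𝕜[X] := ∏ v ∈ V, (X - C v)
  have hP : P.Monic := monic_prod_of_monic _ _ fun v _ => monic_X_sub_C v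
  have hdeg : P.natDegree = V.card := by
    rw [natDegree_prod_of_monic _ _ fun v _ => monic_X_sub_C v]; simp
  have heval : ∀ t, P.eval t = ∏ v ∈ V, (t - v) := fun t => by simp [P, eval_prod]
  let R : 𝕜[X] := P.comp (X + C y) - P - C (P.eval y)
  have hcm : (P.comp (X + C y)).Monic := hP.comp_X_add_C y
  have hcd : (P.comp (X + C y)).natDegree = V.card := by
    rw [natDegree_comp, natDegree_X_add_C, mul_one, hdeg]
  have hVpos : 0 < V.card := Finset.card_pos.2 ⟨0, h0⟩
  have hRdeg : R.degree < V.card := by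
    refine (degree_sub_le _ _).trans_lt (max_lt ?_ ?_)
    · have h := degree_sub_lt_left (p := P.comp (X + C y)) (q := P)
        (by rw [degree_eq_natDegree hcm.ne_zero, degree_eq_natDegree hP.ne_zero, hcd, hdeg])
        hcm.ne_zero (by rw [hcm.leadingCoeff, hP.leadingCoeff])
      rwa [degree_eq_natDegree hcm.ne_zero, hcd] at h
    · exact degree_C_le.trans_lt (by exact_mod_cast hVpos)
  have hR : R = 0 := by
    refine eq_zero_of_degree_lt_of_eval_finset_eq_zero V hRdeg fun v hv => ?_
    have h1 : P.eval v = 0 := by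
      rw [heval]; exact Finset.prod_eq_zero hv (sub_self v)
    have h2 : P.eval (v + y) = P.eval y := by
      rw [heval, heval]
      refine Finset.prod_bij (fun u _ => u - v) (fun u hu => hsub u hu v hv)
        (fun a _ b _ h => by simpa using h) (fun u hu => ⟨u + v, ?_, by ring⟩) fun u _ => by ring
      have := hsub u hu (0 - v) (hsub 0 h0 v hv)
      simpa using this
    simp [R, h1, h2]
  have := congrArg (eval x) hR
  simp only [R, eval_sub, eval_comp, eval_add, eval_X, eval_C, eval_zero] at this
  rw [← heval, ← heval, ← heval]
  linear_combination this

theorem expSub_add (hΛ : StronglyDiscrete Λ) (x y : 𝕜) :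
    expSub Λ (x + y) = expSub Λ x + expSub Λ y := by
  classical
  -- `e_Λ` is the limit of the exponential functions of the finite subgroups `{l ∈ Λ : ‖l‖ ≤ n}`.
  let s : ℕ → Finset Λ := fun n =>
    ((hΛ n).preimage Subtype.val_injective.injOn : (Subtype.val ⁻¹' _ : Set Λ).Finite).toFinset
  have hs : ∀ n l, l ∈ s n ↔ ‖l.1‖ ≤ n := fun n l => by
    simp only [s, Set.Finite.mem_toFinset, Set.mem_preimage, Set.mem_ofPred_eq]
    exact ⟨fun h => h.2, fun h => ⟨l.2, h⟩⟩
  have hst : Tendsto s atTop atTop := tendsto_atTop_finset_of_monotone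
    (fun m n hmn l hl => (hs n l).2 (((hs m l).1 hl).trans (by exact_mod_cast hmn)))
    (fun l => (exists_nat_ge ‖l.1‖).imp fun n hn => (hs n l).2 hn)
  have hlim : ∀ w, Tendsto (fun n => ∏ l ∈ s n, expFactor w l.1) atTop (𝓝 (expSub Λ w)) :=
    fun w => (hΛ.hasProd w).comp hst
  have hfac : ∀ n w, ∏ l ∈ s n, expFactor w l.1
      = (∏ l ∈ s n, if l.1 = 0 then 1 else -(l.1)⁻¹)
        * ∏ v ∈ (s n).map (Function.Embedding.subtype _), (w - v) := by
    intro n w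
    rw [Finset.prod_map, ← Finset.prod_mul_distrib]
    refine Finset.prod_congr rfl fun l _ => ?_
    unfold expFactor
    split_ifs with h
    · simp [h]
    · simp only [Function.Embedding.subtype_apply]
      field_simp
      ring
  refine tendsto_nhds_unique (hlim (x + y)) ?_
  refine ((hlim x).add (hlim y)).congr fun n => ?_
  rw [hfac, hfac, hfac, ← mul_add, prod_sub_add]
  · simp only [Finset.mem_map, Function.Embedding.subtype_apply]
    exact ⟨0, (hs n 0).2 (by simp), rfl⟩
  · simp only [Finset.mem_map, Function.Embedding.subtype_apply]
    rintro _ ⟨a, ha, rfl⟩ _ ⟨b, hb, rfl⟩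
    refine ⟨a - b, (hs n _).2 ?_, rfl⟩
    rw [AddSubgroup.coe_sub, sub_eq_add_neg]
    exact (IsUltrametricDist.norm_add_le_max _ _).trans
      (max_le ((hs n a).1 ha) (by rw [norm_neg]; exact (hs n b).1 hb))

theorem expSub_sub (hΛ : StronglyDiscrete Λ) (x y : 𝕜) :
    expSub Λ (x - y) = expSub Λ x - expSub Λ y := by
  rw [eq_sub_iff_add_eq, ← expSub_add hΛ, sub_add_cancel]

/-- The product over the coset `r + Λ`. -/
theorem hasProd_coset (hΛ : StronglyDiscrete Λ) {r : 𝕜} (hr : r ∉ Λ) (w : 𝕜) :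
    HasProd (fun l : Λ => expFactor w (r + l.1)) (1 - expSub Λ w / expSub Λ r) := by
  have hne : expSub Λ r ≠ 0 := fun h => hr ((expSub_eq_zero_iff hΛ).1 h)
  have hrl : ∀ l : Λ, r + l.1 ≠ 0 := fun l h => hr (by
    rw [eq_neg_of_add_eq_zero_left h]; exact Λ.neg_mem l.2)
  have ht : Tendsto (fun l : Λ => expFactor w (r + l.1) - 1) cofinite (𝓝 0) := by
    rw [Metric.nhds_basis_ball.tendsto_right_iff]
    intro ε hε
    rw [Filter.eventually_cofinite]
    refine Set.Finite.of_finite_image (f := Subtype.val)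
      ((hΛ (max ‖r‖ (‖w‖ / ε))).subset ?_) Subtype.val_injective.injOn
    rintro _ ⟨l, hl, rfl⟩
    refine ⟨l.2, ?_⟩
    simp only [mem_ball_zero_iff, not_lt, Set.mem_ofPred_eq, expFactor, if_neg (hrl l)] at hl
    rw [sub_sub_cancel_left, norm_neg, norm_div, le_div_iff₀ (norm_pos_iff.2 (hrl l))] at hl
    have h1 : ‖r + l.1‖ ≤ ‖w‖ / ε := by rwa [le_div_iff₀ hε, mul_comm]
    calc ‖l.1‖ = ‖-r + (r + l.1)‖ := by rw [neg_add_cancel_left]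
      _ ≤ max ‖-r‖ ‖r + l.1‖ := IsUltrametricDist.norm_add_le_max _ _
      _ ≤ _ := by rw [norm_neg]; exact max_le_max le_rfl h1
  have hm : Multipliable (fun l : Λ => expFactor w (r + l.1)) := by
    simpa using multipliable_one_add_of_tendsto_zero ht
  have hneg : ∀ t, HasProd (fun l : Λ => expFactor t (-l.1)) (expSub Λ t) := fun t => by
    have h1 := (Equiv.neg Λ).hasProd_iff.2 (hΛ.hasProd t)
    have h2 : (fun l : Λ => expFactor t l.1) ∘ (Equiv.neg Λ) = fun l : Λ => expFactor t (-l.1) := by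
      funext l
      simp
    rwa [h2] at h1
  have hfac : ∀ l : Λ, expFactor w (r + l.1) * expFactor r (-l.1) = expFactor (r - w) (-l.1) := by
    intro l
    have h1 := hrl l
    unfold expFactor
    rw [if_neg h1]
    by_cases h0 : l.1 = 0
    · simp only [h0, add_zero, neg_zero, if_true] at h1 ⊢
      field_simp
    · have h2 : -l.1 ≠ 0 := neg_ne_zero.2 h0
      rw [if_neg h2, if_neg h2]
      rw [div_neg, div_neg, sub_neg_eq_add, sub_neg_eq_add]
      have h3 : 1 - w / (r + l.1) = (r + l.1 - w) / (r + l.1) := by rw [sub_div, div_self h1]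
      have h4 : ∀ t : 𝕜, 1 + t / l.1 = (t + l.1) / l.1 := fun t => by
        rw [add_div, div_self h0, add_comm]
      rw [h3, h4, h4, div_mul_div_cancel₀ h1]
      ring
  have h := (hm.hasProd.mul (hneg r)).unique (by simpa only [hfac] using hneg (r - w))
  have e : ∏' l : Λ, expFactor w (r + l.1) = 1 - expSub Λ w / expSub Λ r := by
    rw [expSub_sub hΛ] at h
    rw [eq_sub_iff_add_eq, ← mul_left_inj' hne, add_mul, h, div_mul_cancel₀ _ hne, one_mul,
      sub_add_cancel]
  rw [← e]
  exact hm.hasProd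

/-- If `Λ'` is the disjoint union of the cosets `r i + Λ`, `i ∈ ι`, then `e_Λ'` is a polynomial
in `e_Λ`. -/
theorem expSub_eq_mul_prod {Λ' : AddSubgroup 𝕜} (hΛ : StronglyDiscrete Λ)
    (hΛ' : StronglyDiscrete Λ') {ι : Type*} [Fintype ι] [DecidableEq ι] (r : ι → 𝕜) (i₀ : ι)
    (hi₀ : r i₀ = 0) (e : ι × Λ ≃ Λ') (he : ∀ i l, (e (i, l)).1 = r i + l.1) (w : 𝕜) :
    expSub Λ' w = expSub Λ w * ∏ i ∈ Finset.univ.erase i₀, (1 - expSub Λ w / expSub Λ (r i)) := by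
  have h1 : HasProd (fun p : ι × Λ => expFactor w (r p.1 + p.2.1)) (expSub Λ' w) := by
    have := e.hasProd_iff.2 (hΛ'.hasProd w)
    convert this using 2 with p
    simp [← he]
  have hr : ∀ i ≠ i₀, r i ∉ Λ := by
    intro i hi h
    have : e (i, 0) = e (i₀, ⟨r i, h⟩) := Subtype.ext (by rw [he, he, hi₀]; simp)
    exact hi (congrArg Prod.fst (e.injective this))
  have h2 : HasProd (fun i : ι => if i = i₀ then expSub Λ w else 1 - expSub Λ w / expSub Λ (r i))
      (expSub Λ' w) := by
    refine h1.prod_fiberwise fun i => ?_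
    by_cases hi : i = i₀
    · subst hi
      simpa [hi₀] using hΛ.hasProd w
    · simpa [hi] using hasProd_coset hΛ (hr i hi) w
  rw [(hasProd_fintype _).unique h2 |>.symm, ← Finset.mul_prod_erase _ _ (Finset.mem_univ i₀)]
  simp only [if_true]
  congr 1
  exact Finset.prod_congr rfl fun i hi => if_neg (Finset.ne_of_mem_erase hi)

/-- `e_Λ'(w) = c e_Λ(c⁻¹ w)` for `Λ' = c Λ`. -/
theorem expSub_smul {Λ' : AddSubgroup 𝕜} (hΛ : StronglyDiscrete Λ) {c : 𝕜} (hc : c ≠ 0)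
    (h : ∀ l, l ∈ Λ' ↔ c * l ∈ Λ) (w : 𝕜) : expSub Λ (c * w) = c * expSub Λ' w := by
  classical
  let e : Λ' ≃ Λ :=
    { toFun := fun l => ⟨c * l.1, (h l.1).1 l.2⟩
      invFun := fun l => ⟨c⁻¹ * l.1, (h _).2 (by rw [mul_inv_cancel_left₀ hc]; exact l.2)⟩
      left_inv := fun l => Subtype.ext (inv_mul_cancel_left₀ hc l.1)
      right_inv := fun l => Subtype.ext (mul_inv_cancel_left₀ hc l.1) }
  have hΛ' : StronglyDiscrete Λ' := fun R => by
    refine Set.Finite.of_finite_image (f := fun x => c * x) ((hΛ (‖c‖ * R)).subset ?_)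
      (mul_right_injective₀ hc).injOn
    rintro _ ⟨l, ⟨hl, hR⟩, rfl⟩
    exact ⟨(h l).1 hl, by rw [norm_mul]; gcongr⟩
  have h1 := e.hasProd_iff.2 (hΛ.hasProd (c * w))
  have h2 : HasProd (fun l : Λ' => if l = 0 then c else 1) c := by
    simpa using hasProd_ite_eq (0 : Λ') c
  refine h1.unique ?_
  convert h2.mul (hΛ'.hasProd w) using 2 with l
  by_cases hl : l = 0
  · subst hl; simp [expFactor, e]
  · have hl' : l.1 ≠ 0 := fun h' => hl (Subtype.ext h')
    simp only [Function.comp, e, Equiv.coe_fn_mk, expFactor, mul_eq_zero, hc, hl', or_self,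
      if_false, hl, one_mul, mul_div_mul_left _ _ hc]

end SubgroupExp

/-! ### Twisted polynomials -/

section Twisted

theorem exists_eq_prime_pow_of_dvd_choose {p : ℕ} (hp : p.Prime) (n : ℕ) (hn : n ≠ 0)
    (h : ∀ k, 0 < k → k < n → p ∣ n.choose k) : ∃ i, n = p ^ i := by
  induction n using Nat.strong_induction_on with
  | _ n ih =>
    have := Fact.mk hp
    by_cases h1 : n = 1
    · exact ⟨0, by simpa using h1⟩
    have hpn : p ∣ n := by simpa using h 1 one_pos (by omega)
    obtain ⟨m, rfl⟩ := hpn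
    have hm : m ≠ 0 := by rintro rfl; simp at hn
    have hlt : m < p * m := by
      nlinarith [hp.two_le, Nat.pos_of_ne_zero hm]
    obtain ⟨i, hi⟩ := ih m hlt hm fun k hk0 hk => by
      have h2 := h (p * k) (Nat.mul_pos hp.pos hk0) (Nat.mul_lt_mul_of_pos_left hk hp.pos)
      have h3 := Choose.choose_modEq_choose_mod_mul_choose_div_nat (n := p * m) (k := p * k)
        (p := p)
      rw [Nat.mul_mod_right, Nat.mul_mod_right, Nat.mul_div_cancel_left _ hp.pos,
        Nat.mul_div_cancel_left _ hp.pos, Nat.choose_self, one_mul] at h3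
      exact (Nat.modEq_zero_iff_dvd).1 (h3.symm.trans ((Nat.modEq_zero_iff_dvd).2 h2))
    exact ⟨i + 1, by rw [hi, pow_succ, mul_comm]⟩

/-- The exponents of an additive polynomial over an infinite field of characteristic `p` are powers
of `p`: its higher Hasse derivatives are constant. -/
theorem exists_eq_pow_of_additive {𝕜 : Type*} [Field 𝕜] [Infinite 𝕜] {p : ℕ} [CharP 𝕜 p]
    (hp : p.Prime) {u : 𝕜[X]} (hu : ∀ x y, u.eval (x + y) = u.eval x + u.eval y) {n : ℕ}
    (hn : n ∈ u.support) : ∃ i, n = p ^ i := by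
  have hu0 : u.eval 0 = 0 := by simpa using hu 0 0
  have hn' : u.coeff n ≠ 0 := mem_support_iff.1 hn
  have hn0 : n ≠ 0 := by
    rintro rfl
    exact hn' (by rw [coeff_zero_eq_eval_zero, hu0])
  have htaylor : ∀ y, taylor y u = u + C (u.eval y) := fun y => by
    refine Polynomial.funext fun x => ?_
    rw [taylor_eval, hu, eval_add, eval_C]
  have hhasse : ∀ k, k ≠ 0 → hasseDeriv k u = C (u.coeff k) := fun k hk => by
    refine Polynomial.funext fun y => ?_
    rw [← taylor_coeff, htaylor, coeff_add, coeff_C, if_neg hk, add_zero, eval_C]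
  refine exists_eq_prime_pow_of_dvd_choose hp n hn0 fun k hk0 hk => ?_
  have h1 := congrArg (fun v => v.coeff (n - k)) (hhasse k hk0.ne')
  simp only [hasseDeriv_coeff, coeff_C, if_neg (Nat.sub_ne_zero_of_lt hk),
    Nat.sub_add_cancel hk.le] at h1
  exact (CharP.cast_eq_zero_iff 𝕜 p _).1 ((mul_eq_zero.1 h1).resolve_right hn')

variable {F : Type*} [Field F] [Fintype F]

/-- If `x ↦ x ^ (p ^ i)` is the identity of `𝔽_q`, then `p ^ i` is a power of `q`. -/
theorem exists_eq_card_pow {p : ℕ} [CharP F p] (hp : p.Prime) (i : ℕ)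
    (h : ∀ α : F, α ^ p ^ i = α) : ∃ j, p ^ i = q F ^ j := by
  have := Fact.mk hp
  obtain ⟨s, -, hs⟩ := FiniteField.card F p
  have hs0 : 0 < (s : ℕ) := s.pos
  have hfrob : ∀ (j : ℕ) (α : F), α ^ p ^ ((s : ℕ) * j) = α := fun j α => by
    rw [pow_mul, ← hs, FiniteField.pow_card_pow]
  have hr : i % s = 0 := by
    by_contra hr
    have h1 : ∀ α : F, α ^ p ^ (i % s) = α := fun α => by
      have h2 := h α
      rw [← Nat.div_add_mod i s, pow_add, pow_mul, hfrob] at h2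
      exact h2
    have h2 : 1 < p ^ (i % s) := Nat.one_lt_pow hr hp.one_lt
    have h3 : (X ^ p ^ (i % s) - X : F[X]).natDegree = p ^ (i % s) :=
      FiniteField.X_pow_card_sub_X_natDegree_eq F h2
    have h4 : (X ^ p ^ (i % s) - X : F[X]) = 0 := by
      refine eq_zero_of_natDegree_lt_card_of_eval_eq_zero' _ Finset.univ
        (fun α _ => by simp [h1]) ?_
      rw [h3, Finset.card_univ, hs]
      exact Nat.pow_lt_pow_right hp.one_lt (Nat.mod_lt _ hs0)
    rw [h4, natDegree_zero] at h3
    omega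
  refine ⟨i / s, ?_⟩
  rw [q, hs, ← pow_mul, Nat.mul_div_cancel' (Nat.dvd_of_mod_eq_zero hr)]

instance : Infinite (CInf F) := Infinite.of_injective _ (toC_injective F)

theorem charP_CInf (p : ℕ) [CharP F p] : CharP (CInf F) p :=
  charP_of_injective_ringHom (f := (toC F).comp C) ((toC_injective F).comp C_injective) p

theorem isTwisted_of_additive {u : (CInf F)[X]}
    (hu : ∀ x y, u.eval (x + y) = u.eval x + u.eval y)
    (hF : ∀ (α : F) x, u.eval (toC F (C α) * x) = toC F (C α) * u.eval x) : IsTwisted u := by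
  intro n hn
  obtain ⟨p, hc⟩ := CharP.exists F
  have hp : p.Prime := CharP.char_is_prime F p
  have : CharP (CInf F) p := charP_CInf p
  obtain ⟨i, rfl⟩ := exists_eq_pow_of_additive hp hu hn
  refine exists_eq_card_pow hp i fun α => ?_
  have h : u.comp (C (toC F (C α)) * X) = C (toC F (C α)) * u :=
    Polynomial.funext fun x => by simp [eval_comp, hF]
  have h1 := congrArg (fun v => v.coeff (p ^ i)) h
  simp only [comp_C_mul_X_coeff, coeff_C_mul] at h1
  rw [mul_comm, mul_left_inj' (mem_support_iff.1 hn), ← map_pow, ← map_pow] at h1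
  exact C_injective (toC_injective F h1)

theorem IsTwisted.eval_add {u : (CInf F)[X]} (hu : IsTwisted u) (x y : CInf F) :
    u.eval (x + y) = u.eval x + u.eval y := by
  obtain ⟨p, hc⟩ := CharP.exists F
  have hp : p.Prime := CharP.char_is_prime F p
  have := Fact.mk hp
  have : CharP (CInf F) p := charP_CInf p
  obtain ⟨s, -, hs⟩ := FiniteField.card F p
  simp only [eval_eq_sum, Polynomial.sum, ← Finset.sum_add_distrib, ← mul_add]
  refine Finset.sum_congr rfl fun n hn => ?_
  obtain ⟨i, rfl⟩ := hu n hn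
  rw [q, hs, ← pow_mul, add_pow_char_pow]

theorem IsTwisted.coeff_zero {u : (CInf F)[X]} (hu : IsTwisted u) : u.coeff 0 = 0 := by
  simpa [coeff_zero_eq_eval_zero] using hu.eval_add 0 0

theorem DrinfeldModule.isTwisted_poly (φ : DrinfeldModule F) : IsTwisted φ.poly := by
  intro n hn
  rw [mem_support_iff, DrinfeldModule.poly, coeff_add, coeff_add, coeff_C_mul, coeff_C_mul,
    coeff_C_mul, coeff_X, coeff_X_pow, coeff_X_pow] at hn
  by_contra h
  push Not at h
  refine hn ?_
  rw [if_neg fun h1 => h 0 (by simpa using h1.symm), if_neg fun h1 => h 1 (by simpa using h1),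
    if_neg (h 2)]
  simp

theorem one_lt_card_q : 1 < q F := Fintype.one_lt_card

theorem DrinfeldModule.poly_coeff_one (φ : DrinfeldModule F) : φ.poly.coeff 1 = toC F X := by
  have h := one_lt_card_q (F := F)
  rw [DrinfeldModule.poly, coeff_add, coeff_add, coeff_C_mul, coeff_C_mul,
    coeff_C_mul, coeff_X, coeff_X_pow, coeff_X_pow, if_pos rfl, if_neg h.ne,
    if_neg (Nat.one_lt_pow two_ne_zero h).ne]
  simp

end Twisted

/-! ### Endomorphisms of a Drinfeld module in terms of its lattice -/

section Intertwine

open Filter Topology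

variable {𝕜 : Type*} [NormedField 𝕜] [IsUltrametricDist 𝕜]

theorem norm_eval_sub_le (u : 𝕜[X]) (h0 : u.coeff 0 = 0) :
    ∃ C : ℝ, 0 ≤ C ∧ ∀ x : 𝕜, ‖x‖ ≤ 1 → ‖u.eval x - u.coeff 1 * x‖ ≤ C * ‖x‖ ^ 2 := by
  set v := u.divX.divX with hv
  refine ⟨∑ n ∈ v.support, ‖v.coeff n‖, Finset.sum_nonneg fun _ _ => norm_nonneg _, fun x hx => ?_⟩
  have h1 : u.eval x - u.coeff 1 * x = v.eval x * x ^ 2 := by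
    have h2 := congrArg (eval x) (divX_mul_X_add u)
    have h3 := congrArg (eval x) (divX_mul_X_add u.divX)
    rw [coeff_divX] at h3
    simp only [eval_add, eval_mul, eval_X, eval_C, h0] at h2 h3
    rw [← h2, ← h3]
    simp only [hv, zero_add]
    ring
  rw [h1, norm_mul, norm_pow]
  gcongr
  rw [eval_eq_sum, Polynomial.sum]
  refine (norm_sum_le _ _).trans (Finset.sum_le_sum fun n _ => ?_)
  rw [norm_mul, norm_pow]
  exact mul_le_of_le_one_right (norm_nonneg _) (pow_le_one₀ (norm_nonneg _) hx)

variable {Λ : AddSubgroup 𝕜} [CompleteSpace 𝕜]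

/-- A polynomial `u` that commutes with `φ` lifts along `e_Λ` to multiplication by its linear
coefficient: `h(w) = u(e_Λ(w)) - e_Λ(c w)` is `O(w²)` and satisfies `h(T w) = φ(h(w))`, and `φ`
expands small elements only by the factor `|T|`. -/
theorem eval_expSub_of_comp_comm (hΛ : StronglyDiscrete Λ) {T : 𝕜} (hT : 1 < ‖T‖) {φ u : 𝕜[X]}
    (hφ0 : φ.coeff 0 = 0) (hφ1 : φ.coeff 1 = T) (hφ : ∀ x y, φ.eval (x + y) = φ.eval x + φ.eval y)
    (hu0 : u.coeff 0 = 0) (hcomm : u.comp φ = φ.comp u)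
    (he : ∀ w, expSub Λ (T * w) = φ.eval (expSub Λ w)) (w : 𝕜) :
    u.eval (expSub Λ w) = expSub Λ (u.coeff 1 * w) := by
  set c := u.coeff 1 with hc
  set h : 𝕜 → 𝕜 := fun w => u.eval (expSub Λ w) - expSub Λ (c * w) with hh
  have hφz : φ.eval 0 = 0 := by rw [← coeff_zero_eq_eval_zero, hφ0]
  have hT0 : T ≠ 0 := norm_pos_iff.1 (one_pos.trans hT)
  have hTpos : 0 < ‖T‖ := one_pos.trans hT
  have hneg : ∀ x, φ.eval (-x) = -φ.eval x := fun x => by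
    have := hφ x (-x)
    rw [add_neg_cancel, hφz] at this
    exact (neg_eq_of_add_eq_zero_right this.symm).symm
  have hfun : ∀ w, h (T * w) = φ.eval (h w) := fun w => by
    have h1 := congrArg (eval (expSub Λ w)) hcomm
    rw [eval_comp, eval_comp] at h1
    simp only [hh]
    rw [mul_left_comm, he, he, h1, sub_eq_add_neg, sub_eq_add_neg, hφ, hneg]
  obtain ⟨δ, C₁, hδ, hC₁, hexp⟩ := norm_expSub_sub_le hΛ
  obtain ⟨C₂, hC₂, hu⟩ := norm_eval_sub_le u hu0
  obtain ⟨C₃, hC₃, hφ'⟩ := norm_eval_sub_le φ hφ0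
  -- `h` vanishes to second order at `0`
  obtain ⟨δ', C, hδ', hC, hsmall⟩ : ∃ δ' C : ℝ, 0 < δ' ∧ 0 ≤ C ∧
      ∀ w, ‖w‖ ≤ δ' → ‖h w‖ ≤ C * ‖w‖ ^ 2 := by
    have hcw : ∀ w, ‖w‖ ≤ δ / (‖c‖ + 1) → ‖c * w‖ ≤ δ := fun w hw => by
      rw [le_div_iff₀ (by positivity)] at hw
      rw [norm_mul]
      nlinarith [norm_nonneg w, norm_nonneg c]
    refine ⟨min (min δ 1) (min (δ / (‖c‖ + 1)) (1 / (C₁ + 1))),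
      C₂ + ‖c‖ * C₁ + C₁ * ‖c‖ ^ 2, by positivity, by positivity, fun w hw => ?_⟩
    obtain ⟨hw1, hw2⟩ := le_min_iff.1 hw
    obtain ⟨hw3, hw4⟩ := le_min_iff.1 hw1
    obtain ⟨hw5, hw6⟩ := le_min_iff.1 hw2
    have h1 := hexp w hw3
    have h2 : ‖expSub Λ w‖ ≤ ‖w‖ := by
      have h3 : C₁ * ‖w‖ ^ 2 ≤ ‖w‖ := by
        rw [le_div_iff₀ (by positivity)] at hw6
        nlinarith [norm_nonneg w]
      calc ‖expSub Λ w‖ = ‖(expSub Λ w - w) + w‖ := by rw [sub_add_cancel]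
        _ ≤ max ‖expSub Λ w - w‖ ‖w‖ := IsUltrametricDist.norm_add_le_max _ _
        _ ≤ ‖w‖ := max_le (h1.trans h3) le_rfl
    have h3 := hu (expSub Λ w) (h2.trans hw4)
    have h4 := hexp (c * w) (hcw w hw5)
    have h5 : h w = (u.eval (expSub Λ w) - c * expSub Λ w) + c * (expSub Λ w - w)
        - (expSub Λ (c * w) - c * w) := by simp only [hh]; ring
    rw [h5]
    refine (norm_sub_le _ _).trans ?_
    refine (add_le_add_left (norm_add_le _ _) _).trans ?_
    rw [norm_mul]
    have h6 : C₂ * ‖expSub Λ w‖ ^ 2 ≤ C₂ * ‖w‖ ^ 2 := by gcongr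
    have h7 : ‖c‖ * ‖expSub Λ w - w‖ ≤ ‖c‖ * (C₁ * ‖w‖ ^ 2) := by gcongr
    rw [norm_mul, mul_pow] at h4
    linarith
  -- `φ` expands at most by `‖T‖` near `0`
  obtain ⟨ρ, hρ, hρφ⟩ : ∃ ρ : ℝ, 0 < ρ ∧ ∀ x, ‖x‖ ≤ ρ → ‖φ.eval x‖ ≤ ‖T‖ * ‖x‖ := by
    refine ⟨min 1 (1 / (C₃ + 1)), by positivity, fun x hx => ?_⟩
    obtain ⟨hx1, hx2⟩ := le_min_iff.1 hx
    have h1 := hφ' x hx1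
    rw [hφ1] at h1
    have h2 : C₃ * ‖x‖ ^ 2 ≤ ‖T‖ * ‖x‖ := by
      rw [le_div_iff₀ (by positivity)] at hx2
      nlinarith [norm_nonneg x]
    calc ‖φ.eval x‖ = ‖(φ.eval x - T * x) + T * x‖ := by rw [sub_add_cancel]
      _ ≤ max ‖φ.eval x - T * x‖ ‖T * x‖ := IsUltrametricDist.norm_add_le_max _ _
      _ ≤ ‖T‖ * ‖x‖ := max_le (h1.trans h2) (norm_mul _ _).le
  obtain ⟨η, hη, hη1, hη2⟩ : ∃ η : ℝ, 0 < η ∧ η ≤ δ' ∧ C * η ^ 2 ≤ ρ := by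
    refine ⟨min δ' (min 1 (ρ / (C + 1))), by positivity, min_le_left _ _, ?_⟩
    set η := min δ' (min 1 (ρ / (C + 1))) with hηd
    have h0 : 0 < η := by positivity
    have h1 : η ≤ 1 := (min_le_right _ _).trans (min_le_left _ _)
    have h2 : η ≤ ρ / (C + 1) := (min_le_right _ _).trans (min_le_right _ _)
    rw [le_div_iff₀ (by positivity)] at h2
    nlinarith
  have hiter : ∀ n : ℕ, ∀ w, ‖w‖ ≤ η → ‖h w‖ ≤ C * ‖w‖ ^ 2 / ‖T‖ ^ n := by
    intro n
    induction n with
    | zero => intro w hw; simpa using hsmall w (hw.trans hη1)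
    | succ n ih =>
      intro w hw
      have hw' : ‖w / T‖ ≤ ‖w‖ := by
        rw [norm_div]
        exact div_le_self (norm_nonneg _) hT.le
      have h1 := ih (w / T) (hw'.trans hw)
      have h2 : ‖h (w / T)‖ ≤ ρ := by
        refine (hsmall _ ((hw'.trans hw).trans hη1)).trans (le_trans ?_ hη2)
        gcongr
        exact hw'.trans hw
      have h3 : h w = φ.eval (h (w / T)) := by rw [← hfun, mul_div_cancel₀ _ hT0]
      rw [h3]
      refine (hρφ _ h2).trans ?_
      calc ‖T‖ * ‖h (w / T)‖ ≤ ‖T‖ * (C * ‖w / T‖ ^ 2 / ‖T‖ ^ n) := by gcongr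
        _ = C * ‖w‖ ^ 2 / ‖T‖ ^ (n + 1) := by
          rw [norm_div]
          field_simp
          ring
  have hzero : ∀ w, ‖w‖ ≤ η → h w = 0 := by
    intro w hw
    have h1 : Tendsto (fun n : ℕ => C * ‖w‖ ^ 2 / ‖T‖ ^ n) atTop (𝓝 0) :=
      tendsto_const_nhds.div_atTop (tendsto_pow_atTop_atTop_of_one_lt hT)
    exact norm_le_zero_iff.1 (ge_of_tendsto' h1 fun n => hiter n w hw)
  have hall : ∀ n : ℕ, ∀ w, ‖w‖ ≤ η * ‖T‖ ^ n → h w = 0 := by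
    intro n
    induction n with
    | zero => intro w hw; exact hzero w (by simpa using hw)
    | succ n ih =>
      intro w hw
      have h1 : h (w / T) = 0 := ih _ (by
        rw [norm_div, div_le_iff₀ hTpos, mul_assoc, ← pow_succ]
        exact hw)
      have h3 : h w = φ.eval (h (w / T)) := by rw [← hfun, mul_div_cancel₀ _ hT0]
      rw [h3, h1, hφz]
  obtain ⟨n, hn⟩ := pow_unbounded_of_one_lt (‖w‖ / η) hT
  rw [div_lt_iff₀ hη, mul_comm] at hn
  exact sub_eq_zero.1 (hall n w hn.le)

theorem infinite_range_expSub (hΛ : StronglyDiscrete Λ) [h : NeBot (𝓝[≠] (0 : 𝕜))] :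
    (Set.range (expSub Λ)).Infinite := by
  have hfin : {l : 𝕜 | l ∈ Λ ∧ ‖l‖ ≤ 1 ∧ l ≠ 0}.Finite :=
    (hΛ 1).subset fun l hl => ⟨hl.1, hl.2.1⟩
  have hopen : {l : 𝕜 | l ∈ Λ ∧ ‖l‖ ≤ 1 ∧ l ≠ 0}ᶜ ∈ 𝓝 (0 : 𝕜) :=
    hfin.isClosed.isOpen_compl.mem_nhds fun h => h.2.2 rfl
  obtain ⟨ε, hε, hball⟩ := Metric.mem_nhds_iff.1 (inter_mem hopen (Metric.ball_mem_nhds 0 one_pos))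
  have hinf : (Metric.ball (0 : 𝕜) ε).Infinite := infinite_of_mem_nhds 0 (Metric.ball_mem_nhds 0 hε)
  refine (hinf.image (f := expSub Λ) fun x hx y hy hxy => ?_).mono (Set.image_subset_range _ _)
  have h1 : x - y ∈ Λ := by
    rw [← expSub_eq_zero_iff hΛ, expSub_sub hΛ, hxy, sub_self]
  have h2 : x - y ∈ Metric.ball (0 : 𝕜) ε := by
    rw [mem_ball_zero_iff] at hx hy ⊢
    rw [sub_eq_add_neg]
    exact (IsUltrametricDist.norm_add_le_max _ _).trans_lt (max_lt hx (by rwa [norm_neg]))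
  have h3 := hball h2
  by_contra hne
  exact h3.1 ⟨h1, (mem_ball_zero_iff.1 h3.2).le, sub_ne_zero.2 hne⟩

/-- Multiplication by `c`, where `c Λ ⊆ Λ` has finite index, is given by a polynomial in `e_Λ`. -/
theorem exists_poly_expSub (hΛ : StronglyDiscrete Λ) {c : 𝕜} (hc : c ≠ 0)
    {Λ' : AddSubgroup 𝕜} (hΛ' : ∀ l, l ∈ Λ' ↔ c * l ∈ Λ) {ι : Type*} [Fintype ι] (r : ι → 𝕜)
    (i₀ : ι) (hi₀ : r i₀ = 0) (e : ι × Λ ≃ Λ') (he : ∀ i l, (e (i, l)).1 = r i + l.1) :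
    ∃ u : 𝕜[X], u.coeff 1 = c ∧ u.natDegree = Fintype.card ι ∧
      ∀ w, expSub Λ (c * w) = u.eval (expSub Λ w) := by
  classical
  have hd' : StronglyDiscrete Λ' := fun R => by
    refine Set.Finite.of_finite_image (f := fun x => c * x) ((hΛ (‖c‖ * R)).subset ?_)
      (mul_right_injective₀ hc).injOn
    rintro _ ⟨l, ⟨hl, hR⟩, rfl⟩
    exact ⟨(hΛ' l).1 hl, by rw [norm_mul]; gcongr⟩
  have hr : ∀ i ≠ i₀, expSub Λ (r i) ≠ 0 := by
    intro i hi h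
    rw [expSub_eq_zero_iff hΛ] at h
    have : e (i, 0) = e (i₀, ⟨r i, h⟩) := Subtype.ext (by rw [he, he, hi₀]; simp)
    exact hi (congrArg Prod.fst (e.injective this))
  have hfac : ∀ i ∈ Finset.univ.erase i₀,
      (1 - C (expSub Λ (r i))⁻¹ * X : 𝕜[X]).natDegree = 1 := fun i hi => by
    have h := hr i (Finset.ne_of_mem_erase hi)
    rw [← natDegree_neg, neg_sub, ← map_one C, natDegree_sub_C, natDegree_C_mul_X _ (inv_ne_zero h)]
  refine ⟨C c * (∏ i ∈ Finset.univ.erase i₀, (1 - C (expSub Λ (r i))⁻¹ * X)) * X, ?_, ?_, ?_⟩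
  · rw [show 1 = 0 + 1 from rfl, coeff_mul_X, coeff_C_mul, coeff_zero_eq_eval_zero, eval_prod]
    simp
  · have hne : ∏ i ∈ Finset.univ.erase i₀, (1 - C (expSub Λ (r i))⁻¹ * X : 𝕜[X]) ≠ 0 := by
      refine Finset.prod_ne_zero_iff.2 fun i hi h => ?_
      simpa [h] using hfac i hi
    rw [natDegree_mul_X (mul_ne_zero (C_ne_zero.2 hc) hne), natDegree_C_mul hc,
      natDegree_prod _ _ (Finset.prod_ne_zero_iff.1 hne), Finset.sum_congr rfl hfac]
    simp only [Finset.sum_const, Finset.card_erase_of_mem (Finset.mem_univ _), Finset.card_univ,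
      smul_eq_mul, mul_one]
    exact Nat.succ_pred_eq_of_pos (Fintype.card_pos_iff.2 ⟨i₀⟩)
  · intro w
    rw [expSub_smul hΛ hc hΛ', expSub_eq_mul_prod hΛ hd' r i₀ hi₀ e he]
    simp only [eval_mul, eval_C, eval_X, eval_prod, eval_sub, eval_one]
    rw [mul_assoc, mul_comm (expSub Λ w)]
    congr 2
    exact Finset.prod_congr rfl fun i _ => by rw [div_eq_inv_mul]

end Intertwine

/-! ### The Drinfeld module of a lattice -/

section LatticeDrinfeld

open Filter Topology

variable {F : Type*} [Field F] [Fintype F]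

/-- The lattice `Λ_z = A + zA` as a subgroup of `ℂ_∞`. -/
def latSub (z : CInf F) : AddSubgroup (CInf F) where
  carrier := lattice z
  zero_mem' := ⟨0, 0, by simp⟩
  add_mem' := by
    rintro _ _ ⟨a, b, rfl⟩ ⟨c, d, rfl⟩
    exact ⟨a + c, b + d, by simp only [map_add]; ring⟩
  neg_mem' := by
    rintro _ ⟨a, b, rfl⟩
    exact ⟨-a, -b, by simp only [map_neg]; ring⟩

theorem toC_mul_mem_latSub {z l : CInf F} (s : F[X]) (hl : l ∈ latSub z) :
    toC F s * l ∈ latSub z := by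
  obtain ⟨a, b, rfl⟩ := hl
  exact ⟨s * a, s * b, by simp only [map_mul]; ring⟩

/-- `1` and `z` are linearly independent over `k_∞`, with an explicit lower bound. -/
theorem exists_norm_add_mul_ge (z : Omega F) : ∃ δ : ℝ, 0 < δ ∧ ∀ a b : KInf F,
    δ * ‖b‖ ≤ ‖algebraMap (KInf F) (CInf F) a + z.1 * algebraMap (KInf F) (CInf F) b‖ := by
  have hcl : IsClosed (Set.range (algebraMap (KInf F) (CInf F))) :=
    ((algebraMap_isometry (KInf F) (CInf F)).isClosedEmbedding).isClosed_range
  obtain ⟨δ, hδ, hball⟩ := Metric.isOpen_iff.1 hcl.isOpen_compl z.1 z.2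
  refine ⟨δ, hδ, fun a b => ?_⟩
  by_cases hb : b = 0
  · simp [hb]
  have hb' : algebraMap (KInf F) (CInf F) b ≠ 0 := (_root_.map_ne_zero _).2 hb
  have h1 : δ ≤ ‖z.1 + algebraMap (KInf F) (CInf F) (a / b)‖ := by
    by_contra h
    refine hball (a := -algebraMap (KInf F) (CInf F) (a / b)) ?_ ⟨-(a / b), map_neg _ _⟩
    rw [Metric.mem_ball, dist_comm, dist_eq_norm, sub_neg_eq_add]
    exact not_le.1 h
  have h2 : algebraMap (KInf F) (CInf F) a + z.1 * algebraMap (KInf F) (CInf F) b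
      = (z.1 + algebraMap (KInf F) (CInf F) (a / b)) * algebraMap (KInf F) (CInf F) b := by
    rw [map_div₀]
    field_simp
    ring
  rw [h2, norm_mul, norm_algebraMap_CInf]
  gcongr

theorem eq_zero_of_add_mul_eq_zero (z : Omega F) {a b : KInf F}
    (h : algebraMap (KInf F) (CInf F) a + z.1 * algebraMap (KInf F) (CInf F) b = 0) :
    a = 0 ∧ b = 0 := by
  obtain ⟨δ, hδ, h1⟩ := exists_norm_add_mul_ge z
  have h2 := h1 a b
  rw [h, norm_zero] at h2
  have hb : b = 0 := norm_le_zero_iff.1 (by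
    by_contra hc
    exact absurd h2 (not_le.2 (mul_pos hδ (not_le.1 hc))))
  refine ⟨?_, hb⟩
  simpa [hb] using h

theorem eq_zero_of_toC_add_mul_eq_zero (z : Omega F) {a b : F[X]}
    (h : toC F a + z.1 * toC F b = 0) : a = 0 ∧ b = 0 := by
  obtain ⟨h1, h2⟩ := eq_zero_of_add_mul_eq_zero z (a := toK F a) (b := toK F b) h
  exact ⟨(map_eq_zero_iff _ (toK_injective F)).1 h1, (map_eq_zero_iff _ (toK_injective F)).1 h2⟩

theorem toC_add_mul_inj (z : Omega F) {a b c d : F[X]}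
    (h : toC F a + z.1 * toC F b = toC F c + z.1 * toC F d) : a = c ∧ b = d := by
  have := eq_zero_of_toC_add_mul_eq_zero z (a := a - c) (b := b - d) (by
    rw [map_sub, map_sub]
    linear_combination h)
  exact ⟨sub_eq_zero.1 this.1, sub_eq_zero.1 this.2⟩

theorem finite_natDegree_lt (n : ℕ) : {p : F[X] | p.natDegree < n}.Finite := by
  have : Finite (degreeLT F n) := Finite.of_equiv _ (degreeLTEquiv F n).toEquiv.symm
  refine (Set.toFinite (degreeLT F n : Set F[X])).subset fun p hp => ?_
  rw [SetLike.mem_coe, mem_degreeLT]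
  exact degree_le_natDegree.trans_lt (by exact_mod_cast hp)

theorem finite_norm_toK_le (R : ℝ) : {p : F[X] | ‖toK F p‖ ≤ R}.Finite := by
  obtain ⟨n, hn⟩ := pow_unbounded_of_one_lt R (one_lt_q_real F)
  refine (finite_natDegree_lt (F := F) (n + 1)).subset fun p hp => ?_
  by_cases h : p = 0
  · simp [h]
  · simp only [Set.mem_ofPred_eq, norm_toK h] at hp
    have := (pow_lt_pow_iff_right₀ (one_lt_q_real F)).1 (hp.trans_lt hn)
    exact this.trans (Nat.lt_succ_self n)

theorem stronglyDiscrete_latSub (z : Omega F) : StronglyDiscrete (latSub z.1) := by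
  intro R
  obtain ⟨δ, hδ, h1⟩ := exists_norm_add_mul_ge z
  refine (((finite_norm_toK_le (F := F) (max R (‖z.1‖ * (R / δ)))).prod
    (finite_norm_toK_le (F := F) (R / δ))).image
      fun p : F[X] × F[X] => toC F p.1 + z.1 * toC F p.2).subset ?_
  rintro _ ⟨⟨a, b, rfl⟩, hR⟩
  have hb : ‖toK F b‖ ≤ R / δ := by
    rw [le_div_iff₀ hδ, mul_comm]
    exact (h1 (toK F a) (toK F b)).trans hR
  refine ⟨(a, b), ⟨?_, hb⟩, rfl⟩
  have h2 : toC F a = (toC F a + z.1 * toC F b) + -(z.1 * toC F b) := by ring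
  change ‖toK F a‖ ≤ _
  rw [← norm_algebraMap_CInf, algebraMap_toK, h2]
  refine (IsUltrametricDist.norm_add_le_max _ _).trans (max_le_max hR ?_)
  rw [norm_neg, norm_mul]
  gcongr
  rwa [← algebraMap_toK, norm_algebraMap_CInf]

theorem latticeExp_eq (z : Omega F) (w : CInf F) : latticeExp z.1 w = expSub (latSub z.1) w :=
  (expSub_eq_mul_tprod (stronglyDiscrete_latSub z) w).symm

instance : NeBot (𝓝[≠] (0 : CInf F)) := Module.punctured_nhds_neBot (KInf F) (CInf F) 0

theorem expSub_latSub_const_mul (z : Omega F) (α : F) (w : CInf F) :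
    expSub (latSub z.1) (toC F (C α) * w) = toC F (C α) * expSub (latSub z.1) w := by
  by_cases hα : α = 0
  · simp [hα, expSub_zero (stronglyDiscrete_latSub z)]
  refine expSub_smul (stronglyDiscrete_latSub z) (toC_ne_zero (C_ne_zero.2 hα)) (fun l => ?_) w
  refine ⟨toC_mul_mem_latSub _, fun h => ?_⟩
  have := toC_mul_mem_latSub (C α⁻¹) h
  rwa [← mul_assoc, ← map_mul, ← C_mul, inv_mul_cancel₀ hα, C_1, map_one, one_mul] at this

theorem eq_of_eval_expSub_eq (z : Omega F) {u v : (CInf F)[X]}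
    (h : ∀ w, u.eval (expSub (latSub z.1) w) = v.eval (expSub (latSub z.1) w)) : u = v := by
  refine Polynomial.eq_of_infinite_eval_eq u v
    ((infinite_range_expSub (stronglyDiscrete_latSub z)).mono ?_)
  rintro _ ⟨w, rfl⟩
  exact h w

/-- A polynomial that intertwines multiplications under `e_Λ` is twisted. -/
theorem isTwisted_of_expSub (z : Omega F) {u : (CInf F)[X]} {c : CInf F}
    (h : ∀ w, expSub (latSub z.1) (c * w) = u.eval (expSub (latSub z.1) w)) : IsTwisted u := by
  have hΛ := stronglyDiscrete_latSub z
  refine isTwisted_of_additive (fun x y => ?_) fun α x => ?_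
  · have h1 : ∀ w, u.comp (X + C (expSub (latSub z.1) w))
        = u + C (u.eval (expSub (latSub z.1) w)) := fun w =>
      eq_of_eval_expSub_eq z fun w' => by
        simp only [eval_comp, eval_add, eval_X, eval_C]
        rw [← expSub_add hΛ, ← h, ← h, ← h, mul_add, expSub_add hΛ]
    have h2 : u.comp (C x + X) = C (u.eval x) + u := eq_of_eval_expSub_eq z fun w => by
      have := congrArg (eval x) (h1 w)
      simpa [eval_comp] using this
    have := congrArg (eval y) h2
    simpa [eval_comp] using this
  · have h1 : u.comp (C (toC F (C α)) * X) = C (toC F (C α)) * u :=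
      eq_of_eval_expSub_eq z fun w => by
        simp only [eval_comp, eval_mul, eval_X, eval_C]
        rw [← expSub_latSub_const_mul, ← h, ← h, mul_left_comm, expSub_latSub_const_mul]
    have := congrArg (eval x) h1
    simpa [eval_comp] using this

/-- The lattice `T⁻¹ Λ`, and more generally `c⁻¹ Λ`. -/
def latDiv (z c : CInf F) : AddSubgroup (CInf F) :=
  (latSub z).comap (AddMonoidHom.mulLeft c)

theorem mem_latDiv {z c l : CInf F} : l ∈ latDiv z c ↔ c * l ∈ latSub z := Iff.rfl

theorem exists_isUniformizedBy (z : Omega F) : ∃ φ : DrinfeldModule F, φ.IsUniformizedBy z := by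
  classical
  have hT : toC F X ≠ 0 := toC_ne_zero X_ne_zero
  -- the classes of `(α + β z) / T`, `α, β ∈ 𝔽_q`, are the elements of `T⁻¹ Λ / Λ`
  let r : F × F → CInf F := fun p => (toC F (C p.1) + z.1 * toC F (C p.2)) / toC F X
  have hr : ∀ p (l : latSub z.1), r p + l.1 ∈ latDiv z.1 (toC F X) := fun p l => by
    rw [mem_latDiv, mul_add, mul_div_cancel₀ _ hT]
    exact (latSub z.1).add_mem ⟨_, _, rfl⟩ (toC_mul_mem_latSub _ l.2)
  let e₀ : (F × F) × latSub z.1 → latDiv z.1 (toC F X) := fun p => ⟨r p.1 + p.2.1, hr p.1 p.2⟩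
  have hmul : ∀ α β a b, (toC F (C α) + z.1 * toC F (C β)) / toC F X
      + (toC F a + z.1 * toC F b)
      = (toC F (C α + X * a) + z.1 * toC F (C β + X * b)) / toC F X := fun α β a b => by
    simp only [map_add, map_mul]
    field_simp
    ring
  have he₀ : Function.Bijective e₀ := by
    constructor
    · rintro ⟨⟨α, β⟩, ⟨_, a, b, rfl⟩⟩ ⟨⟨α', β'⟩, ⟨_, a', b', rfl⟩⟩ h
      have h1 : r (α, β) + (toC F a + z.1 * toC F b) = r (α', β') + (toC F a' + z.1 * toC F b') :=
        congrArg Subtype.val h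
      simp only [r] at h1
      rw [hmul, hmul, div_left_inj' hT] at h1
      obtain ⟨h2, h3⟩ := toC_add_mul_inj z h1
      have key : ∀ {α α' : F} {a a' : F[X]}, C α + X * a = C α' + X * a' → α = α' ∧ a = a' := by
        intro α α' a a' h
        have h0 : α = α' := by simpa using congrArg (fun p => p.coeff 0) h
        subst h0
        exact ⟨rfl, mul_left_cancel₀ X_ne_zero (add_left_cancel h)⟩
      obtain ⟨rfl, rfl⟩ := key h2
      obtain ⟨rfl, rfl⟩ := key h3
      rfl
    · rintro ⟨l, a, b, hl⟩
      refine ⟨((a.coeff 0, b.coeff 0), ⟨toC F a.divX + z.1 * toC F b.divX, _, _, rfl⟩),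
        Subtype.ext ?_⟩
      change r (a.coeff 0, b.coeff 0) + _ = l
      simp only [r]
      rw [hmul, div_eq_iff hT, mul_comm l]
      have h1 : ∀ p : F[X], C (p.coeff 0) + X * p.divX = p := fun p => by
        rw [add_comm, X_mul_divX_add]
      rw [h1, h1]
      exact hl.symm
  obtain ⟨u, hu1, hudeg, hu⟩ := exists_poly_expSub (stronglyDiscrete_latSub z) hT
    (Λ' := latDiv z.1 (toC F X)) (fun l => mem_latDiv) r (0, 0) (by simp [r])
    (Equiv.ofBijective e₀ he₀) fun i l => rfl
  have htw := isTwisted_of_expSub z hu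
  have hcard : u.natDegree = q F ^ 2 := by rw [hudeg, Fintype.card_prod, sq]
  have hq := one_lt_card_q (F := F)
  have hu0 : u ≠ 0 := by
    rintro rfl
    rw [natDegree_zero] at hcard
    have : 0 < q F ^ 2 := by positivity
    omega
  refine ⟨⟨u.coeff (q F), u.coeff (q F ^ 2), ?_⟩, fun w => ?_⟩
  · rw [← hcard]
    exact leadingCoeff_ne_zero.2 hu0
  · rw [latticeExp_eq, latticeExp_eq, hu]
    congr 1
    ext n
    rw [DrinfeldModule.poly]
    simp only [coeff_add, coeff_C_mul, coeff_X_pow, coeff_X]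
    have hlt : 1 < q F ^ 2 := Nat.one_lt_pow two_ne_zero hq
    have hlt' : q F < q F ^ 2 := by nlinarith
    by_cases h1 : n = 1
    · subst h1
      simp [hu1, hq.ne, hlt.ne]
    by_cases h2 : n = q F
    · subst h2
      simp [hq.ne, hlt'.ne]
    by_cases h3 : n = q F ^ 2
    · subst h3
      simp [hlt.ne, hlt'.ne']
    · rw [if_neg (Ne.symm h1), if_neg h2, if_neg h3]
      simp only [mul_zero, add_zero]
      by_contra hne
      obtain ⟨i, rfl⟩ := htw n (mem_support_iff.2 hne)
      have hle := le_natDegree_of_ne_zero hne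
      rw [hcard, Nat.pow_le_pow_iff_right hq] at hle
      interval_cases i <;> simp_all

/-- The multiplier ring `{c ∈ ℂ_∞ : c Λ_z ⊆ Λ_z}` of `Λ_z`. -/
def multipliers (z : CInf F) : Set (CInf F) := {c | ∀ l ∈ lattice z, c * l ∈ lattice z}

/-- A non-zero multiplier `c` divides some `N ∈ A`, namely the determinant of its matrix. -/
theorem exists_norm_multiplier (z : Omega F) {c : CInf F} (hc : c ≠ 0)
    (hm : c ∈ multipliers z.1) : ∃ N : F[X], N ≠ 0 ∧ ∀ l, c * l ∈ latSub z.1 →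
      toC F N * l ∈ latSub z.1 := by
  obtain ⟨α, β, h1⟩ := hm 1 ⟨1, 0, by simp⟩
  obtain ⟨γ, δ, h2⟩ := hm z.1 ⟨0, 1, by simp⟩
  have hadj : ∀ l ∈ latSub z.1, ∃ l' ∈ latSub z.1, toC F (α * δ - β * γ) * l = c * l' := by
    rintro _ ⟨a, b, rfl⟩
    refine ⟨(toC F δ - z.1 * toC F β) * toC F a + (z.1 * toC F α - toC F γ) * toC F b,
      ⟨δ * a - γ * b, α * b - β * a, ?_⟩, ?_⟩
    · simp only [map_sub, map_mul]; ring
    · simp only [map_sub, map_mul]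
      linear_combination (-toC F δ * toC F a + toC F γ * toC F b) * h1
        - (-toC F β * toC F a + toC F α * toC F b) * h2
  refine ⟨α * δ - β * γ, fun h0 => ?_, fun l hl => ?_⟩
  · have e1 : (toC F δ - z.1 * toC F β) = 0 := by
      refine (mul_eq_zero.1 (?_ : c * (toC F δ - z.1 * toC F β) = 0)).resolve_left hc
      have h0' : toC F α * toC F δ - toC F β * toC F γ = 0 := by
        rw [← map_mul, ← map_mul, ← map_sub, h0, map_zero]
      linear_combination toC F δ * h1 - toC F β * h2 + h0'
    have e2 := eq_zero_of_toC_add_mul_eq_zero z (a := δ) (b := -β) (by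
      rw [map_neg]; linear_combination e1)
    have hβ : β = 0 := by simpa using e2.2
    have hδ : δ = 0 := e2.1
    have e3 : c * (z.1 * toC F α - toC F γ) = 0 := by
      rw [hβ] at h1
      rw [hδ] at h2
      simp only [map_zero, mul_zero, add_zero, mul_one] at h1 h2
      linear_combination toC F α * h2 - toC F γ * h1
    have e4 := eq_zero_of_toC_add_mul_eq_zero z (a := -γ) (b := α) (by
      rw [map_neg]; linear_combination (mul_eq_zero.1 e3).resolve_left hc)
    refine hc ?_
    rw [hβ, e4.2] at h1
    simpa using h1
  · obtain ⟨l', hl', h3⟩ := hadj _ hl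
    have : toC F (α * δ - β * γ) * l = l' := by
      apply mul_left_cancel₀ hc
      rw [← h3]; ring
    rwa [this]

theorem exists_endo_of_multiplier (z : Omega F) {c : CInf F} (hm : c ∈ multipliers z.1) :
    ∃ u : (CInf F)[X], u.coeff 1 = c ∧
      ∀ w, expSub (latSub z.1) (c * w) = u.eval (expSub (latSub z.1) w) := by
  classical
  have hΛ := stronglyDiscrete_latSub z
  by_cases hc : c = 0
  · exact ⟨0, by simp [hc], fun w => by simp [hc, expSub_zero hΛ]⟩
  obtain ⟨N, hN, hNl⟩ := exists_norm_multiplier z hc hm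
  have hNC : toC F N ≠ 0 := toC_ne_zero hN
  set Λ' := latDiv z.1 c with hΛ'
  have hle : latSub z.1 ≤ Λ' := fun l hl => hm l hl
  let S : AddSubgroup Λ' := (latSub z.1).addSubgroupOf Λ'
  have hdisc : {l : CInf F | l ∈ Λ' ∧ ‖l‖ ≤ max 1 ‖z.1‖}.Finite := by
    refine Set.Finite.of_finite_image (f := fun x => c * x)
      ((hΛ (‖c‖ * max 1 ‖z.1‖)).subset ?_) (mul_right_injective₀ hc).injOn
    rintro _ ⟨l, ⟨hl, hR⟩, rfl⟩
    exact ⟨hl, by rw [norm_mul]; gcongr⟩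
  -- every coset of `Λ` in `c⁻¹ Λ` has a small representative
  have hfin : Finite (Λ' ⧸ S) := by
    have := hdisc.to_subtype
    refine Finite.of_surjective
      (fun l : {l : CInf F | l ∈ Λ' ∧ ‖l‖ ≤ max 1 ‖z.1‖} =>
        (QuotientAddGroup.mk (⟨l.1, l.2.1⟩ : Λ') : Λ' ⧸ S)) fun x => ?_
    induction x using QuotientAddGroup.induction_on with
    | H x =>
    obtain ⟨a, b, hab⟩ := hNl x.1 x.2
    have hdm : ∀ p : F[X], toC F p = toC F N * toC F (p / N) + toC F (p % N) := fun p => by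
      rw [← map_mul, ← map_add, EuclideanDomain.div_add_mod]
    have hmod : ∀ p : F[X], ‖toC F (p % N)‖ ≤ ‖toC F N‖ := fun p => by
      by_cases h : p % N = 0
      · simp [h]
      · rw [norm_toC h, norm_toC hN]
        exact pow_le_pow_right₀ (one_lt_q_real F).le
          (natDegree_le_natDegree (EuclideanDomain.mod_lt p hN).le)
    set l : CInf F := toC F (a / N) + z.1 * toC F (b / N) with hl
    have hlm : l ∈ latSub z.1 := ⟨_, _, rfl⟩
    have hx : toC F N * (x.1 - l) = toC F (a % N) + z.1 * toC F (b % N) := by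
      rw [mul_sub, hab, hl, hdm a, hdm b]
      simp only [← hdm]
      rw [hdm a, hdm b]
      ring
    have hnorm : ‖x.1 - l‖ ≤ max 1 ‖z.1‖ := by
      have h1 : ‖toC F N‖ * ‖x.1 - l‖ ≤ ‖toC F N‖ * max 1 ‖z.1‖ := by
        rw [← norm_mul, hx]
        refine (IsUltrametricDist.norm_add_le_max _ _).trans (max_le ?_ ?_)
        · exact (hmod a).trans (le_mul_of_one_le_right (norm_nonneg _) (le_max_left _ _))
        · rw [norm_mul, mul_comm]
          exact mul_le_mul (hmod b) (le_max_right _ _) (norm_nonneg _) (norm_nonneg _)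
      exact le_of_mul_le_mul_left h1 (norm_pos_iff.2 hNC)
    refine ⟨⟨x.1 - l, Λ'.sub_mem x.2 (hle hlm), hnorm⟩, ?_⟩
    rw [QuotientAddGroup.eq]
    change -(x.1 - l) + x.1 ∈ latSub z.1
    simpa using hlm
  have := Fintype.ofFinite (Λ' ⧸ S)
  let r : Λ' ⧸ S → CInf F := fun i => if i = 0 then 0 else (Quotient.out i).1
  have hr : ∀ i, r i ∈ Λ' := fun i => by
    simp only [r]
    split_ifs
    · exact Λ'.zero_mem
    · exact (Quotient.out i).2
  have hri : ∀ i, (QuotientAddGroup.mk (⟨r i, hr i⟩ : Λ') : Λ' ⧸ S) = i := fun i => by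
    by_cases h : i = 0
    · subst h
      have : (⟨r 0, hr 0⟩ : Λ') = 0 := Subtype.ext (if_pos rfl)
      rw [this]
      rfl
    · have : (⟨r i, hr i⟩ : Λ') = Quotient.out i := Subtype.ext (if_neg h)
      rw [this]
      exact Quotient.out_eq i
  let e₀ : (Λ' ⧸ S) × latSub z.1 → Λ' := fun p => ⟨r p.1 + p.2.1, Λ'.add_mem (hr _) (hle p.2.2)⟩
  have hmk : ∀ p, (QuotientAddGroup.mk (e₀ p) : Λ' ⧸ S) = p.1 := fun p => by
    conv_rhs => rw [← hri p.1]
    rw [eq_comm, QuotientAddGroup.eq]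
    change -(r p.1) + (r p.1 + p.2.1) ∈ latSub z.1
    simp
  have he₀ : Function.Bijective e₀ := by
    constructor
    · intro p p' h
      have h1 : p.1 = p'.1 := by rw [← hmk, h, hmk]
      have h2 : r p.1 + p.2.1 = r p'.1 + p'.2.1 := congrArg Subtype.val h
      rw [h1] at h2
      exact Prod.ext h1 (Subtype.ext (add_left_cancel h2))
    · intro x
      have h1 : -(r (QuotientAddGroup.mk x : Λ' ⧸ S)) + x.1 ∈ latSub z.1 :=
        (QuotientAddGroup.eq (s := S) (a := (⟨r _, hr _⟩ : Λ')) (b := x)).1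
          (hri (QuotientAddGroup.mk x))
      exact ⟨(QuotientAddGroup.mk x, ⟨_, h1⟩), Subtype.ext (add_neg_cancel_left _ _)⟩
  obtain ⟨u, hu1, -, hu⟩ := exists_poly_expSub hΛ hc (Λ' := Λ') (fun l => mem_latDiv) r 0
    (if_pos rfl) (Equiv.ofBijective e₀ he₀) fun i l => rfl
  exact ⟨u, hu1, hu⟩

/-- `End(φ_z) = {c : c Λ_z ⊆ Λ_z}`. -/
theorem endos_image_eq_multipliers {φ : DrinfeldModule F} {z : Omega F}
    (hφ : φ.IsUniformizedBy z) :
    (fun u : (CInf F)[X] => u.coeff 1) '' φ.endos = multipliers z.1 := by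
  have hΛ := stronglyDiscrete_latSub z
  have hφ' : ∀ w, expSub (latSub z.1) (toC F X * w) = φ.poly.eval (expSub (latSub z.1) w) :=
    fun w => by rw [← latticeExp_eq, ← latticeExp_eq]; exact hφ w
  ext c
  constructor
  · rintro ⟨u, ⟨hu, hcomm⟩, rfl⟩ l hl
    have hT : 1 < ‖toC F X‖ := by
      rw [norm_toC X_ne_zero, natDegree_X, pow_one]
      exact one_lt_q_real F
    have h := eval_expSub_of_comp_comm hΛ hT φ.isTwisted_poly.coeff_zero φ.poly_coeff_one
      φ.isTwisted_poly.eval_add hu.coeff_zero hcomm hφ' l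
    have h0 : expSub (latSub z.1) l = 0 := (expSub_eq_zero_iff hΛ).2 hl
    rw [h0, ← coeff_zero_eq_eval_zero, hu.coeff_zero] at h
    exact (expSub_eq_zero_iff hΛ).1 h.symm
  · intro hm
    obtain ⟨u, hu1, hu⟩ := exists_endo_of_multiplier z hm
    refine ⟨u, ⟨isTwisted_of_expSub z hu, eq_of_eval_expSub_eq z fun w => ?_⟩, hu1⟩
    rw [eval_comp, eval_comp, ← hφ', ← hu, ← hu, ← hφ', mul_left_comm]

theorem mem_CM_iff {D : F[X]} {x : Y F} :
    x ∈ CM D ↔ ∃ z : Omega F, z.toY = x ∧ multipliers z.1 = (order D : Set (CInf F)) := by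
  constructor
  · rintro ⟨z, hz, φ, hφ, hcm⟩
    exact ⟨z, hz, (endos_image_eq_multipliers hφ).symm.trans hcm⟩
  · rintro ⟨z, hz, hm⟩
    obtain ⟨φ, hφ⟩ := exists_isUniformizedBy z
    exact ⟨z, hz, φ, hφ, (endos_image_eq_multipliers hφ).trans hm⟩

end LatticeDrinfeld

/-! ### Reduction theory for norms on `k_∞²` -/

section Reduction

variable {F : Type*} [Field F] [Fintype F]

/-- An ultrametric norm on the space `k_∞²` of row vectors. -/
structure IsUltraNorm (N : (Fin 2 → KInf F) → ℝ) : Prop where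
  smul : ∀ (c : KInf F) (x : Fin 2 → KInf F), N (c • x) = ‖c‖ * N x
  add_le : ∀ x y, N (x + y) ≤ max (N x) (N y)
  pos : ∀ x, x ≠ 0 → 0 < N x

variable {N : (Fin 2 → KInf F) → ℝ}

theorem IsUltraNorm.zero (hN : IsUltraNorm N) : N 0 = 0 := by
  simpa using hN.smul 0 0

theorem IsUltraNorm.nonneg (hN : IsUltraNorm N) (x : Fin 2 → KInf F) : 0 ≤ N x := by
  by_cases h : x = 0
  · rw [h, hN.zero]
  · exact (hN.pos x h).le

theorem IsUltraNorm.add_eq_right (hN : IsUltraNorm N) {x y : Fin 2 → KInf F} (h : N x < N y) :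
    N (x + y) = N y := by
  refine le_antisymm ((hN.add_le x y).trans (max_le h.le le_rfl)) ?_
  have h1 := hN.add_le (x + y) ((-1 : KInf F) • x)
  rw [hN.smul, norm_neg, norm_one, one_mul,
    show x + y + (-1 : KInf F) • x = y by rw [neg_one_smul]; abel] at h1
  exact (le_max_iff.1 h1).resolve_right (not_le.2 h)

theorem IsUltraNorm.add_eq_max (hN : IsUltraNorm N) {x y : Fin 2 → KInf F} (h : N x ≠ N y) :
    N (x + y) = max (N x) (N y) := by
  rcases lt_or_gt_of_ne h with h | h
  · rw [hN.add_eq_right h, max_eq_right h.le]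
  · rw [add_comm, hN.add_eq_right h, max_eq_left h.le]

theorem exists_eq_smul_add_smul {x y : Fin 2 → KInf F}
    (h : ∀ α β : KInf F, α • x + β • y = 0 → α = 0 ∧ β = 0) (w : Fin 2 → KInf F) :
    ∃ α β : KInf F, w = α • x + β • y := by
  have hdet : x 0 * y 1 - x 1 * y 0 ≠ 0 := by
    intro hd
    have h1 := h (y 1) (-x 1) (by
      ext i; fin_cases i
      · simp; linear_combination hd
      · simp; ring)
    have h2 := h (y 0) (-x 0) (by
      ext i; fin_cases i
      · simp; ring
      · simp; linear_combination -hd)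
    have h3 := h 1 0 (by
      ext i; fin_cases i
      · simpa using h2.2
      · simpa using h1.2)
    exact one_ne_zero h3.1
  refine ⟨(w 0 * y 1 - w 1 * y 0) / (x 0 * y 1 - x 1 * y 0),
    (x 0 * w 1 - x 1 * w 0) / (x 0 * y 1 - x 1 * y 0), ?_⟩
  ext i
  fin_cases i <;> simp <;>
    rw [div_mul_eq_mul_div, div_mul_eq_mul_div, ← add_div, eq_div_iff hdet] <;> ring

theorem exists_forall_le_of_finite {α : Type*} (g : α → ℝ) {S : Set α} (hS : S.Nonempty)
    (hfin : ∀ R, {x | x ∈ S ∧ g x ≤ R}.Finite) : ∃ x ∈ S, ∀ y ∈ S, g x ≤ g y := by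
  obtain ⟨x₀, hx₀⟩ := hS
  obtain ⟨x, hx, hmin⟩ := (hfin (g x₀)).exists_minimalFor g _ ⟨x₀, hx₀, le_rfl⟩
  refine ⟨x, hx.1, fun y hy => ?_⟩
  by_contra h
  exact h (hmin ⟨hy, (not_le.1 h).le.trans hx.2⟩ (not_le.1 h).le)

/-- Reduction theory: a discrete `A`-lattice `M` in `k_∞²` has an `A`-basis that is orthogonal for
the ultrametric norm `N`. The first vector is a shortest non-zero vector `x₁` of `M`, the second one
a shortest vector of `M ∖ A x₁`. -/
theorem exists_reduced_basis (hN : IsUltraNorm N) (M : AddSubgroup (Fin 2 → KInf F))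
    (hM : ∀ (s : F[X]), ∀ x ∈ M, toK F s • x ∈ M) (hfin : ∀ R, {x | x ∈ M ∧ N x ≤ R}.Finite)
    {v w : Fin 2 → KInf F} (hv : v ∈ M) (hw : w ∈ M)
    (hvw : ∀ α β : KInf F, α • v + β • w = 0 → α = 0 ∧ β = 0) :
    ∃ x₁ ∈ M, ∃ x₂ ∈ M, (∀ y ∈ M, ∃ a b : F[X], y = toK F a • x₁ + toK F b • x₂) ∧
      0 < N x₁ ∧ N x₁ ≤ N x₂ ∧
      ∀ α β : KInf F, N (α • x₁ + β • x₂) = max (‖α‖ * N x₁) (‖β‖ * N x₂) := by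
  have hv0 : v ≠ 0 := by
    rintro rfl
    exact one_ne_zero (hvw 1 0 (by simp)).1
  obtain ⟨x₁, ⟨hx₁, hx₁0⟩, hmin₁⟩ := exists_forall_le_of_finite N (S := {x | x ∈ M ∧ x ≠ 0})
    ⟨v, hv, hv0⟩ fun R => (hfin R).subset fun x hx => ⟨hx.1.1, hx.2⟩
  have hne : ∃ y ∈ M, ¬ ∃ a : F[X], y = toK F a • x₁ := by
    by_contra hcon
    push Not at hcon
    obtain ⟨a, ha⟩ := hcon v hv
    obtain ⟨b, hb⟩ := hcon w hw
    have h1 := hvw (toK F b) (-toK F a) (by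
      rw [ha, hb, smul_smul, smul_smul, ← add_smul, mul_comm]; simp)
    exact hv0 (by rw [ha, neg_eq_zero.1 h1.2, zero_smul])
  obtain ⟨x₂, ⟨hx₂, hx₂n⟩, hmin₂⟩ := exists_forall_le_of_finite N
    (S := {y | y ∈ M ∧ ¬ ∃ a : F[X], y = toK F a • x₁}) hne
    fun R => (hfin R).subset fun x hx => ⟨hx.1.1, hx.2⟩
  have hx₂0 : x₂ ≠ 0 := fun h => hx₂n ⟨0, by simp [h]⟩
  have h12 : N x₁ ≤ N x₂ := hmin₁ x₂ ⟨hx₂, hx₂0⟩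
  have hpos₁ := hN.pos x₁ hx₁0
  have hpos₂ := hN.pos x₂ hx₂0
  have horth : ∀ α β : KInf F, N (α • x₁ + β • x₂) = max (‖α‖ * N x₁) (‖β‖ * N x₂) := by
    intro α β
    by_cases hne : N (α • x₁) = N (β • x₂)
    swap
    · rw [hN.add_eq_max hne, hN.smul, hN.smul]
    by_cases hβ : β = 0
    · subst hβ
      rw [zero_smul, add_zero, hN.smul, norm_zero, zero_mul, max_eq_left]
      positivity
    refine le_antisymm ((hN.add_le _ _).trans (by rw [hN.smul, hN.smul])) ?_
    rw [hN.smul, hN.smul] at hne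
    rw [hne, max_self]
    by_contra hlt
    rw [not_le] at hlt
    -- otherwise `x₂ + s x₁` is shorter than `x₂`, where `s` is the integral part of `α / β`
    have hβ' : 0 < ‖β‖ := norm_pos_iff.2 hβ
    have h1 : N ((α / β) • x₁ + x₂) < N x₂ := by
      have e : α • x₁ + β • x₂ = β • ((α / β) • x₁ + x₂) := by
        rw [smul_add, smul_smul, mul_div_cancel₀ _ hβ]
      rw [e, hN.smul] at hlt
      exact lt_of_mul_lt_mul_left hlt hβ'.le
    obtain ⟨s, hs⟩ := exists_norm_sub_toK_lt_one (α / β)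
    have h2 : N (toK F s • x₁ + x₂) < N x₂ := by
      have e : toK F s • x₁ + x₂ = ((α / β) • x₁ + x₂) + (-(α / β - toK F s)) • x₁ := by
        rw [neg_smul, sub_smul]; abel
      rw [e]
      refine (hN.add_le _ _).trans_lt (max_lt h1 ?_)
      rw [hN.smul, norm_neg]
      nlinarith
    refine absurd (hmin₂ (toK F s • x₁ + x₂) ⟨M.add_mem (hM s _ hx₁) hx₂, ?_⟩) (not_le.2 h2)
    rintro ⟨a, ha⟩
    exact hx₂n ⟨a - s, by rw [map_sub, sub_smul, ← ha]; abel⟩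
  refine ⟨x₁, hx₁, x₂, hx₂, fun y hy => ?_, hpos₁, h12, horth⟩
  have hind : ∀ α β : KInf F, α • x₁ + β • x₂ = 0 → α = 0 ∧ β = 0 := by
    intro α β h
    have h1 := horth α β
    rw [h, hN.zero] at h1
    have h2 : ‖α‖ * N x₁ ≤ 0 := h1 ▸ le_max_left _ _
    have h3 : ‖β‖ * N x₂ ≤ 0 := h1 ▸ le_max_right _ _
    exact ⟨norm_le_zero_iff.1 (nonpos_of_mul_nonpos_left h2 hpos₁),
      norm_le_zero_iff.1 (nonpos_of_mul_nonpos_left h3 hpos₂)⟩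
  obtain ⟨α, β, hy'⟩ := exists_eq_smul_add_smul hind y
  obtain ⟨s, hs⟩ := exists_norm_sub_toK_lt_one α
  obtain ⟨t, ht⟩ := exists_norm_sub_toK_lt_one β
  have hmem : (α - toK F s) • x₁ + (β - toK F t) • x₂ ∈ M := by
    have e : (α - toK F s) • x₁ + (β - toK F t) • x₂ = y - (toK F s • x₁ + toK F t • x₂) := by
      rw [hy', sub_smul, sub_smul]; abel
    rw [e]
    exact M.sub_mem hy (M.add_mem (hM s _ hx₁) (hM t _ hx₂))
  have hex : ∃ a : F[X], (α - toK F s) • x₁ + (β - toK F t) • x₂ = toK F a • x₁ := by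
    by_contra hcon
    have h1 := hmin₂ _ ⟨hmem, hcon⟩
    rw [horth] at h1
    rcases le_max_iff.1 h1 with h2 | h2
    · nlinarith
    · nlinarith
  obtain ⟨a, ha⟩ := hex
  have h1 := hind (α - toK F s - toK F a) (β - toK F t) (by
    rw [sub_smul (α - toK F s), sub_add_eq_add_sub, ha, sub_self])
  refine ⟨s + a, t, ?_⟩
  rw [hy', sub_eq_zero.1 h1.2, map_add, ← sub_eq_zero.1 h1.1]
  simp

/-- Reduction theory for `A²`: up to `GL₂(A)` a norm on `k_∞²` is diagonal. -/
theorem exists_reducing_matrix (hN : IsUltraNorm N)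
    (hfin : ∀ R, {p : Fin 2 → F[X] | N (fun i => toK F (p i)) ≤ R}.Finite) :
    ∃ (γ : GL (Fin 2) F[X]) (ρ₁ ρ₂ : ℝ), 0 < ρ₁ ∧ ρ₁ ≤ ρ₂ ∧
      (∃ w, w ≠ 0 ∧ N w = ρ₁) ∧ (∃ w, w ≠ 0 ∧ N w = ρ₂) ∧
      ∀ w : Fin 2 → KInf F,
        N (Matrix.vecMul w (γ.1.map (toK F))) = max (‖w 0‖ * ρ₂) (‖w 1‖ * ρ₁) := by
  let M : AddSubgroup (Fin 2 → KInf F) :=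
    { carrier := Set.range fun (p : Fin 2 → F[X]) i => toK F (p i)
      zero_mem' := ⟨0, by ext; simp⟩
      add_mem' := by rintro _ _ ⟨p, rfl⟩ ⟨p', rfl⟩; exact ⟨p + p', by ext; simp⟩
      neg_mem' := by rintro _ ⟨p, rfl⟩; exact ⟨-p, by ext; simp⟩ }
  obtain ⟨_, ⟨p₁, rfl⟩, _, ⟨p₂, rfl⟩, hspan, hpos, hle, horth⟩ := exists_reduced_basis hN M
    (by rintro s _ ⟨p, rfl⟩; exact ⟨fun i => s * p i, by ext; simp⟩)
    (fun R => ((hfin R).image fun p i => toK F (p i)).subset (by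
      rintro _ ⟨⟨p, rfl⟩, hp⟩; exact ⟨p, hp, rfl⟩))
    (v := ![1, 0]) (w := ![0, 1]) ⟨![1, 0], by ext i; fin_cases i <;> simp⟩
    ⟨![0, 1], by ext i; fin_cases i <;> simp⟩ (fun α β h => by
      have h0 := congrFun h 0
      have h1 := congrFun h 1
      simp at h0 h1
      exact ⟨h0, h1⟩)
  have hcoef : ∀ p : Fin 2 → F[X], ∃ a b : F[X], ∀ i, p i = a * p₁ i + b * p₂ i := fun p => by
    obtain ⟨a, b, hab⟩ := hspan _ ⟨p, rfl⟩
    refine ⟨a, b, fun i => toK_injective F ?_⟩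
    have := congrFun hab i
    simpa using this
  obtain ⟨a₀, b₀, h₀⟩ := hcoef ![1, 0]
  obtain ⟨a₁, b₁, h₁⟩ := hcoef ![0, 1]
  have hinv : !![b₀, a₀; b₁, a₁] * Matrix.of ![p₂, p₁] = 1 := by
    have e00 := h₀ 0
    have e01 := h₀ 1
    have e10 := h₁ 0
    have e11 := h₁ 1
    simp at e00 e01 e10 e11
    ext i j : 1
    fin_cases i <;> fin_cases j <;> simp [Matrix.mul_apply, Fin.sum_univ_two]
    · rw [e00]; ring
    · rw [e01]; ring
    · rw [e10]; ring
    · rw [e11]; ring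
  obtain ⟨γ, hγ⟩ := IsUnit.of_mul_eq_one_right _ hinv
  have hne : ∀ {x}, 0 < N x → x ≠ 0 := fun hx h0 => by
    rw [h0, hN.zero] at hx; exact lt_irrefl _ hx
  refine ⟨γ, _, _, hpos, hle, ⟨_, hne hpos, rfl⟩, ⟨_, hne (hpos.trans_le hle), rfl⟩, fun w => ?_⟩
  have e : Matrix.vecMul w (γ.1.map (toK F))
      = w 1 • (fun i => toK F (p₁ i)) + w 0 • (fun i => toK F (p₂ i)) := by
    rw [hγ]
    ext i
    simp [Matrix.vecMul, dotProduct, Fin.sum_univ_two]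
    ring
  rw [e, horth, max_comm]

end Reduction

/-! ### The norm of an `𝒪_∞`-lattice -/

section LatticeNorm

variable {F : Type*} [Field F] [Fintype F]

/-- The norm `w ↦ sup_{x ∈ L} |w x|` on row vectors that belongs to the lattice `L`, computed in
a basis of `L`. -/
def latNorm (L : OLattice F) (w : Fin 2 → KInf F) : ℝ :=
  max ‖w ⬝ᵥ L.2.choose 0‖ ‖w ⬝ᵥ L.2.choose 1‖

theorem mem_span_OInf_iff (b : Module.Basis (Fin 2) (KInf F) (Fin 2 → KInf F))
    (x : Fin 2 → KInf F) : x ∈ Submodule.span (OInf F) (Set.range b) ↔ ∀ i, ‖b.repr x i‖ ≤ 1 := by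
  constructor
  · intro hx
    induction hx using Submodule.span_induction with
    | mem x h =>
      obtain ⟨j, rfl⟩ := h
      intro i
      rw [Module.Basis.repr_self, Finsupp.single_apply]
      split_ifs <;> simp
    | zero => simp
    | add x y _ _ hx hy =>
      intro i
      rw [map_add, Finsupp.add_apply]
      exact (IsUltrametricDist.norm_add_le_max _ _).trans (max_le (hx i) (hy i))
    | smul c x _ hx =>
      intro i
      have : c • x = (c : KInf F) • x := rfl
      rw [this, map_smul, Finsupp.smul_apply, smul_eq_mul, norm_mul]
      exact mul_le_one₀ (mem_OInf.1 c.2) (norm_nonneg _) (hx i)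
  · intro h
    rw [← b.sum_repr x]
    refine Submodule.sum_mem _ fun i _ => ?_
    exact Submodule.smul_mem _ (⟨b.repr x i, mem_OInf.2 (h i)⟩ : OInf F)
      (Submodule.subset_span ⟨i, rfl⟩)

theorem isLUB_of_basis {L : OLattice F} (b : Module.Basis (Fin 2) (KInf F) (Fin 2 → KInf F))
    (hb : L.1 = Submodule.span (OInf F) (Set.range b)) (w : Fin 2 → KInf F) :
    IsLUB ((fun x : Fin 2 → KInf F => ‖w ⬝ᵥ x‖) '' (L.1 : Set (Fin 2 → KInf F)))
      (max ‖w ⬝ᵥ b 0‖ ‖w ⬝ᵥ b 1‖) := by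
  constructor
  · rintro _ ⟨x, hx, rfl⟩
    rw [SetLike.mem_coe, hb, mem_span_OInf_iff] at hx
    have e : w ⬝ᵥ x = b.repr x 0 * (w ⬝ᵥ b 0) + b.repr x 1 * (w ⬝ᵥ b 1) := by
      conv_lhs => rw [← b.sum_repr x]
      rw [Fin.sum_univ_two, dotProduct_add, dotProduct_smul, dotProduct_smul, smul_eq_mul,
        smul_eq_mul]
    change ‖w ⬝ᵥ x‖ ≤ _
    rw [e]
    refine (IsUltrametricDist.norm_add_le_max _ _).trans (max_le_max ?_ ?_) <;> rw [norm_mul]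
    · exact mul_le_of_le_one_left (norm_nonneg _) (hx 0)
    · exact mul_le_of_le_one_left (norm_nonneg _) (hx 1)
  · intro r hr
    refine max_le (hr ⟨b 0, ?_, rfl⟩) (hr ⟨b 1, ?_, rfl⟩) <;> rw [SetLike.mem_coe, hb] <;>
      exact Submodule.subset_span ⟨_, rfl⟩

theorem isLUB_latNorm (L : OLattice F) (w : Fin 2 → KInf F) :
    IsLUB ((fun x : Fin 2 → KInf F => ‖w ⬝ᵥ x‖) '' (L.1 : Set (Fin 2 → KInf F))) (latNorm L w) :=
  isLUB_of_basis _ L.2.choose_spec w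

theorem latNorm_of_basis {L : OLattice F} (b : Module.Basis (Fin 2) (KInf F) (Fin 2 → KInf F))
    (hb : L.1 = Submodule.span (OInf F) (Set.range b)) (w : Fin 2 → KInf F) :
    latNorm L w = max ‖w ⬝ᵥ b 0‖ ‖w ⬝ᵥ b 1‖ :=
  (isLUB_latNorm L w).unique (isLUB_of_basis b hb w)

theorem latNorm_gLattice (n : ℕ) (w : Fin 2 → KInf F) :
    latNorm (gLattice F n) w = max ((q F : ℝ) ^ n * ‖w 0‖) ‖w 1‖ := by
  rw [latNorm_of_basis (gBasis F n) rfl]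
  have h : ∀ i, w ⬝ᵥ gBasis F n i
      = ((![Units.mk0 _ (pow_ne_zero n (toK_X_ne_zero F)), 1] : Fin 2 → (KInf F)ˣ) i : KInf F)
        * w i := by
    intro i
    rw [gBasis, Module.Basis.unitsSMul_apply, Units.smul_def, dotProduct_smul, Pi.basisFun_apply,
      dotProduct_single, mul_one, smul_eq_mul]
  rw [h, h]
  simp [norm_toK_X]

theorem exists_norm_eq_latNorm (L : OLattice F) (w : Fin 2 → KInf F) :
    ∃ c : KInf F, latNorm L w = ‖c‖ := by
  rcases max_choice ‖w ⬝ᵥ L.2.choose 0‖ ‖w ⬝ᵥ L.2.choose 1‖ with h | h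
  · exact ⟨_, h⟩
  · exact ⟨_, h⟩

theorem exists_norm_apply_le_latNorm (L : OLattice F) : ∃ C : ℝ, ∀ (w : Fin 2 → KInf F) (k : Fin 2),
    ‖w k‖ ≤ C * latNorm L w := by
  set b := L.2.choose with hb
  refine ⟨∑ k, ∑ i, ‖b.repr (Pi.single k 1) i‖, fun w k => ?_⟩
  have hle : ∀ i, ‖w ⬝ᵥ b i‖ ≤ latNorm L w := fun i => by
    fin_cases i
    · exact le_max_left _ _
    · exact le_max_right _ _
  have h0 : 0 ≤ latNorm L w := (norm_nonneg _).trans (hle 0)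
  have e : w k = ∑ i, b.repr (Pi.single k 1) i * (w ⬝ᵥ b i) := by
    have : w ⬝ᵥ (Pi.single k 1 : Fin 2 → KInf F) = w k := by rw [dotProduct_single, mul_one]
    rw [← this]
    conv_lhs => rw [← b.sum_repr (Pi.single k 1)]
    rw [dotProduct_sum]
    simp only [dotProduct_smul, smul_eq_mul]
  calc ‖w k‖ ≤ ∑ i, ‖b.repr (Pi.single k 1) i * (w ⬝ᵥ b i)‖ := by
        conv_lhs => rw [e]
        exact norm_sum_le _ _
    _ ≤ ∑ i, ‖b.repr (Pi.single k 1) i‖ * latNorm L w := by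
        refine Finset.sum_le_sum fun i _ => ?_
        rw [norm_mul]
        gcongr
        exact hle i
    _ = (∑ i, ‖b.repr (Pi.single k 1) i‖) * latNorm L w := by rw [Finset.sum_mul]
    _ ≤ _ := by
        refine mul_le_mul_of_nonneg_right ?_ h0
        exact Finset.single_le_sum (f := fun k => ∑ i, ‖b.repr (Pi.single k 1) i‖)
          (fun _ _ => Finset.sum_nonneg fun _ _ => norm_nonneg _) (Finset.mem_univ k)

theorem isUltraNorm_latNorm (L : OLattice F) : IsUltraNorm (latNorm L) where
  smul c x := by
    simp only [latNorm, smul_dotProduct, smul_eq_mul, norm_mul]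
    rw [mul_max_of_nonneg _ _ (norm_nonneg c)]
  add_le x y := by
    simp only [latNorm, add_dotProduct]
    refine max_le ((IsUltrametricDist.norm_add_le_max _ _).trans ?_)
      ((IsUltrametricDist.norm_add_le_max _ _).trans ?_)
    · exact max_le_max (le_max_left _ _) (le_max_left _ _)
    · exact max_le_max (le_max_right _ _) (le_max_right _ _)
  pos x hx := by
    obtain ⟨C, hC⟩ := exists_norm_apply_le_latNorm L
    have h0 : 0 ≤ latNorm L x := (norm_nonneg _).trans (le_max_left _ _)
    refine lt_of_le_of_ne h0 fun h => hx ?_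
    ext k
    have := hC x k
    rw [← h, mul_zero] at this
    exact norm_le_zero_iff.1 this

theorem mem_iff_latNorm (L : OLattice F) (x : Fin 2 → KInf F) :
    x ∈ L.1 ↔ ∀ w, ‖w ⬝ᵥ x‖ ≤ latNorm L w := by
  constructor
  · intro hx w
    exact (isLUB_latNorm L w).1 ⟨x, hx, rfl⟩
  · intro h
    obtain ⟨b, hb⟩ := L.2
    rw [hb, mem_span_OInf_iff]
    intro i
    -- test against the dual basis
    let w : Fin 2 → KInf F := fun k => b.repr (Pi.single k 1) i
    have hw : ∀ y, w ⬝ᵥ y = b.repr y i := fun y => by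
      have e : y = ∑ k, y k • (Pi.single k 1 : Fin 2 → KInf F) := by
        ext j
        simp [Finset.sum_apply, Pi.single_apply]
      conv_rhs => rw [e]
      rw [map_sum, Finsupp.finsetSum_apply]
      simp only [map_smul, Finsupp.smul_apply, smul_eq_mul, dotProduct, w]
      exact Finset.sum_congr rfl fun k _ => mul_comm _ _
    have h1 := h w
    rw [latNorm_of_basis b hb, hw, hw, hw] at h1
    refine h1.trans (max_le ?_ ?_) <;> rw [Module.Basis.repr_self, Finsupp.single_apply] <;>
      split_ifs <;> simp

theorem mapsClass_iff {γ : GL (Fin 2) F[X]} {L L' : OLattice F} :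
    MapsClass γ L L' ↔ ∃ ρ : ℝ, 0 < ρ ∧ ∀ w : Fin 2 → KInf F,
      latNorm L' w = ρ * latNorm L (Matrix.vecMul w (γ.1.map (toK F))) := by
  constructor
  · rintro ⟨c, hc, h⟩
    refine ⟨‖c‖, norm_pos_iff.2 hc, fun w => ?_⟩
    refine (isLUB_latNorm L' w).unique ?_
    have h1 := isLUB_latNorm L (Matrix.vecMul w (γ.1.map (toK F)))
    rw [h, Set.image_image]
    have h2 : ∀ x : Fin 2 → KInf F, ‖w ⬝ᵥ c • (γ.1.map (toK F)).mulVec x‖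
        = ‖c‖ * ‖Matrix.vecMul w (γ.1.map (toK F)) ⬝ᵥ x‖ := fun x => by
      rw [dotProduct_smul, smul_eq_mul, norm_mul, Matrix.dotProduct_mulVec]
    simp only [h2]
    rw [← Set.image_image (fun t : ℝ => ‖c‖ * t)
      (fun x : Fin 2 → KInf F => ‖Matrix.vecMul w (γ.1.map (toK F)) ⬝ᵥ x‖)]
    exact h1.mul_left (norm_nonneg c)
  · rintro ⟨ρ, hρ, h⟩
    have hinv : ∀ w : Fin 2 → KInf F, Matrix.vecMul (Matrix.vecMul w (γ⁻¹.1.map (toK F)))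
        (γ.1.map (toK F)) = w := fun w => by
      rw [Matrix.vecMul_vecMul, ← Matrix.map_mul, ← Units.val_mul, inv_mul_cancel]
      simp
    have hinv' : ∀ x : Fin 2 → KInf F, (γ.1.map (toK F)).mulVec ((γ⁻¹.1.map (toK F)).mulVec x)
        = x := fun x => by
      rw [Matrix.mulVec_mulVec, ← Matrix.map_mul, ← Units.val_mul, mul_inv_cancel]
      simp
    obtain ⟨c, hc0, hc⟩ : ∃ c : KInf F, c ≠ 0 ∧ ‖c‖ = ρ := by
      obtain ⟨s, hs⟩ := exists_norm_eq_latNorm L' ![1, 0]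
      obtain ⟨t, ht⟩ := exists_norm_eq_latNorm L (Matrix.vecMul ![1, 0] (γ.1.map (toK F)))
      have h1 := h ![1, 0]
      have h2 : 0 < latNorm L' ![1, 0] :=
        (isUltraNorm_latNorm L').pos _ fun h => one_ne_zero (congrFun h 0)
      rw [hs, ht] at h1
      rw [hs] at h2
      have ht0 : ‖t‖ ≠ 0 := fun h0 => by rw [h1, h0, mul_zero] at h2; exact lt_irrefl _ h2
      refine ⟨s / t, div_ne_zero (norm_pos_iff.1 h2) (norm_ne_zero_iff.1 ht0), ?_⟩
      rw [norm_div, h1, mul_div_cancel_right₀ _ ht0]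
    refine ⟨c, hc0, ?_⟩
    ext x
    rw [SetLike.mem_coe, mem_iff_latNorm]
    constructor
    · intro hx
      refine ⟨c⁻¹ • (γ⁻¹.1.map (toK F)).mulVec x, ?_, ?_⟩
      · rw [SetLike.mem_coe, mem_iff_latNorm]
        intro w
        rw [dotProduct_smul, smul_eq_mul, norm_mul, norm_inv, hc, Matrix.dotProduct_mulVec,
          inv_mul_le_iff₀ hρ]
        have := hx (Matrix.vecMul w (γ⁻¹.1.map (toK F)))
        rwa [h, hinv] at this
      · simp only [Matrix.mulVec_smul, smul_smul, mul_inv_cancel₀ hc0, one_smul, hinv']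
    · rintro ⟨y, hy, rfl⟩ w
      rw [SetLike.mem_coe, mem_iff_latNorm] at hy
      rw [dotProduct_smul, smul_eq_mul, norm_mul, Matrix.dotProduct_mulVec, h, hc]
      gcongr
      exact hy _

end LatticeNorm

/-! ### The building map -/

section BuildingMap

variable {F : Type*} [Field F] [Fintype F]

/-- The norm `w ↦ |w₀ z + w₁|` on row vectors. -/
def rowNorm (z : CInf F) (w : Fin 2 → KInf F) : ℝ :=
  ‖algebraMap (KInf F) (CInf F) (w 0) * z + algebraMap (KInf F) (CInf F) (w 1)‖

theorem isUltraNorm_rowNorm (z : Omega F) : IsUltraNorm (rowNorm z.1) where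
  smul c x := by
    simp only [rowNorm, Pi.smul_apply, smul_eq_mul, map_mul]
    rw [← norm_algebraMap_CInf c, ← norm_mul]
    congr 1
    ring
  add_le x y := by
    simp only [rowNorm, Pi.add_apply, map_add]
    refine le_trans (le_of_eq ?_) (IsUltrametricDist.norm_add_le_max _ _)
    congr 1
    ring
  pos x hx := by
    refine norm_pos_iff.2 fun h => hx ?_
    have h1 := eq_zero_of_add_mul_eq_zero z (a := x 1) (b := x 0) (by rw [← h]; ring)
    ext i
    fin_cases i
    · exact h1.2
    · exact h1.1

theorem finite_rowNorm_le (z : Omega F) (R : ℝ) :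
    {p : Fin 2 → F[X] | rowNorm z.1 (fun i => toK F (p i)) ≤ R}.Finite := by
  refine Set.Finite.of_finite_image
    (f := fun p : Fin 2 → F[X] => toC F (p 1) + z.1 * toC F (p 0))
    ((stronglyDiscrete_latSub z R).subset ?_) ?_
  · rintro _ ⟨p, hp, rfl⟩
    refine ⟨⟨_, _, rfl⟩, ?_⟩
    have e : toC F (p 1) + z.1 * toC F (p 0) = toC F (p 0) * z.1 + toC F (p 1) := by ring
    change ‖toC F (p 1) + z.1 * toC F (p 0)‖ ≤ R
    rw [e]
    exact hp
  · intro p _ p' _ h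
    obtain ⟨h1, h0⟩ := toC_add_mul_inj z h
    ext i : 1
    fin_cases i
    · exact h0
    · exact h1

theorem isBuildingVertex_iff {z : Omega F} {L : OLattice F} :
    IsBuildingVertex z L ↔ ∃ r : ℝ, 0 < r ∧ ∀ w, latNorm L w = r * rowNorm z.1 w := by
  refine exists_congr fun r => and_congr_right fun _ => forall_congr' fun w => ?_
  exact ⟨fun h => (isLUB_latNorm L w).unique h, fun h => by
    have := isLUB_latNorm L w
    rwa [h] at this⟩

theorem rowNorm_vecMul {γ : GL (Fin 2) F[X]} {z z' : Omega F} (h : z'.1 = moebius γ z.1)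
    (w : Fin 2 → KInf F) : rowNorm z.1 (Matrix.vecMul w (γ.1.map (toK F)))
      = ‖toC F (γ 1 0) * z.1 + toC F (γ 1 1)‖ * rowNorm z'.1 w := by
  have hd := denom_ne_zero γ z
  rw [rowNorm, rowNorm, ← norm_mul, h, moebius]
  congr 1
  simp only [Matrix.vecMul, dotProduct, Fin.sum_univ_two, Matrix.map_apply, map_add, map_mul,
    algebraMap_toK]
  field_simp
  ring

theorem exists_mapsClass (γ : GL (Fin 2) F[X]) (L : OLattice F) :
    ∃ L' : OLattice F, MapsClass γ L L' := by
  obtain ⟨b, hb⟩ := L.2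
  have h1 : γ.1.map (toK F) * γ⁻¹.1.map (toK F) = 1 := by
    rw [← Matrix.map_mul, ← Units.val_mul, mul_inv_cancel]; simp
  have h2 : γ⁻¹.1.map (toK F) * γ.1.map (toK F) = 1 := by
    rw [← Matrix.map_mul, ← Units.val_mul, inv_mul_cancel]; simp
  let e : (Fin 2 → KInf F) ≃ₗ[KInf F] (Fin 2 → KInf F) :=
    { toFun := fun x => (γ.1.map (toK F)).mulVec x
      map_add' := Matrix.mulVec_add _
      map_smul' := fun c x => Matrix.mulVec_smul _ c x
      invFun := fun x => (γ⁻¹.1.map (toK F)).mulVec x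
      left_inv := fun x => by
        change (γ⁻¹.1.map (toK F)).mulVec ((γ.1.map (toK F)).mulVec x) = x
        rw [Matrix.mulVec_mulVec, h2, Matrix.one_mulVec]
      right_inv := fun x => by
        change (γ.1.map (toK F)).mulVec ((γ⁻¹.1.map (toK F)).mulVec x) = x
        rw [Matrix.mulVec_mulVec, h1, Matrix.one_mulVec] }
  have he : ∀ x, e x = (γ.1.map (toK F)).mulVec x := fun x => rfl
  refine ⟨⟨Submodule.span (OInf F) (Set.range (b.map e)), b.map e, rfl⟩, 1, one_ne_zero, ?_⟩
  ext x
  rw [SetLike.mem_coe, mem_span_OInf_iff]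
  constructor
  · intro h
    refine ⟨e.symm x, ?_, ?_⟩
    · rw [SetLike.mem_coe, hb, mem_span_OInf_iff]
      exact h
    · simp only [one_smul]
      rw [← he, e.apply_symm_apply]
  · rintro ⟨y, hy, rfl⟩
    rw [SetLike.mem_coe, hb, mem_span_OInf_iff] at hy
    simp only [one_smul]
    rw [← he]
    intro i
    simpa using hy i

theorem isBuildingVertex_of_moebius {γ : GL (Fin 2) F[X]} {z z' : Omega F}
    (h : z'.1 = moebius γ z.1) {L : OLattice F} (hL : IsBuildingVertex z L) :
    ∃ L' : OLattice F, IsBuildingVertex z' L' := by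
  obtain ⟨L', hL'⟩ := exists_mapsClass γ L
  obtain ⟨ρ, hρ, h1⟩ := mapsClass_iff.1 hL'
  obtain ⟨r, hr, h2⟩ := isBuildingVertex_iff.1 hL
  refine ⟨L', isBuildingVertex_iff.2 ⟨ρ * (r * ‖toC F (γ 1 0) * z.1 + toC F (γ 1 1)‖), ?_,
    fun w => ?_⟩⟩
  · have := norm_pos_iff.2 (denom_ne_zero γ z)
    positivity
  · rw [h1, h2, rowNorm_vecMul h]
    ring

theorem mapsClass_of_isBuildingVertex {γ : GL (Fin 2) F[X]} {z z' : Omega F}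
    (h : z'.1 = moebius γ z.1) {L L' : OLattice F} (hL : IsBuildingVertex z L)
    (hL' : IsBuildingVertex z' L') : MapsClass γ L L' := by
  obtain ⟨r, hr, h1⟩ := isBuildingVertex_iff.1 hL
  obtain ⟨r', hr', h2⟩ := isBuildingVertex_iff.1 hL'
  have hd := norm_pos_iff.2 (denom_ne_zero γ z)
  refine mapsClass_iff.2 ⟨r' / (r * ‖toC F (γ 1 0) * z.1 + toC F (γ 1 1)‖), by positivity,
    fun w => ?_⟩
  rw [h2, h1, rowNorm_vecMul h]
  field_simp

theorem lambdaBar_toY {z : Omega F} {L : OLattice F} (hL : IsBuildingVertex z L) :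
    lambdaBar z.toY = L.toQ := by
  have h : ∃ L : OLattice F, ∃ z' : Omega F, z'.toY = z.toY ∧ IsBuildingVertex z' L :=
    ⟨L, z, rfl, hL⟩
  rw [lambdaBar, dif_pos h]
  obtain ⟨z', hz', hL'⟩ := h.choose_spec
  obtain ⟨γ, hγ⟩ : ∃ γ : GL (Fin 2) F[X], z.1 = moebius γ z'.1 := Quotient.exact hz'
  exact Quotient.sound ⟨γ, mapsClass_of_isBuildingVertex hγ hL' hL⟩

theorem exists_nat_ratio {N : (Fin 2 → KInf F) → ℝ}
    (hval : ∀ w, w ≠ 0 → ∃ n : ℤ, N w = (q F : ℝ) ^ n) {ρ₁ ρ₂ : ℝ} (h0 : 0 < ρ₁) (h : ρ₁ ≤ ρ₂)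
    (h1 : ∃ w, w ≠ 0 ∧ N w = ρ₁) (h2 : ∃ w, w ≠ 0 ∧ N w = ρ₂) :
    ∃ n : ℕ, ρ₂ = (q F : ℝ) ^ n * ρ₁ := by
  obtain ⟨w₁, hw₁, rfl⟩ := h1
  obtain ⟨w₂, hw₂, rfl⟩ := h2
  obtain ⟨n₁, e₁⟩ := hval w₁ hw₁
  obtain ⟨n₂, e₂⟩ := hval w₂ hw₂
  rw [e₁, e₂, zpow_le_zpow_iff_right₀ (one_lt_q_real F)] at h
  obtain ⟨n, hn⟩ := Int.eq_ofNat_of_zero_le (sub_nonneg.2 h)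
  refine ⟨n, ?_⟩
  rw [e₁, e₂, ← zpow_natCast, ← zpow_add₀ (q_pos F).ne']
  congr 1
  omega

end BuildingMap

/-! ### The vertices of `Γ \ 𝒯` and their stabilizers -/

section Vertices

variable {F : Type*} [Field F] [Fintype F]

theorem vtx_surjective : Function.Surjective (vtx F) := by
  intro v
  obtain ⟨L, rfl⟩ : ∃ L : OLattice F, L.toQ = v := Quotient.exists_rep v
  have hN := isUltraNorm_latNorm L
  obtain ⟨γ, ρ₁, ρ₂, h0, hle, hw₁, hw₂, hred⟩ := exists_reducing_matrix hN fun R => by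
    obtain ⟨C, hC⟩ := exists_norm_apply_le_latNorm L
    refine Set.Finite.subset (Set.Finite.pi' fun _ : Fin 2 => finite_norm_toK_le (F := F)
      (|C| * max R 0)) fun p hp i => ?_
    refine (hC (fun i => toK F (p i)) i).trans ?_
    refine mul_le_mul (le_abs_self C) (le_trans ?_ (le_max_left _ _)) (hN.nonneg _) (abs_nonneg C)
    exact hp
  obtain ⟨n, rfl⟩ := exists_nat_ratio (N := latNorm L) (fun w hw => by
    obtain ⟨c, hc⟩ := exists_norm_eq_latNorm L w
    have hpos := hN.pos w hw
    rw [hc] at hpos ⊢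
    exact norm_KInf_eq_zpow (norm_pos_iff.1 hpos)) h0 hle hw₁ hw₂
  refine ⟨n, (Quotient.sound ⟨γ, mapsClass_iff.2 ⟨ρ₁⁻¹, inv_pos.2 h0, fun w => ?_⟩⟩ :
    L.toQ = (gLattice F n).toQ).symm⟩
  rw [latNorm_gLattice, hred, eq_inv_mul_iff_mul_eq₀ h0.ne', mul_max_of_nonneg _ _ h0.le]
  congr 1 <;> ring

theorem one_le_max_norm_row {γ : GL (Fin 2) F[X]} (n : ℕ) :
    1 ≤ max ((q F : ℝ) ^ n * ‖toK F (γ 1 0)‖) ‖toK F (γ 1 1)‖ := by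
  by_cases h : γ 1 1 = 0
  · have h1 : γ 1 0 ≠ 0 := by
      intro h1
      have hdet : γ.1.det ≠ 0 := ((Matrix.isUnit_iff_isUnit_det _).1 γ.isUnit).ne_zero
      rw [Matrix.det_fin_two] at hdet
      exact hdet (by rw [h, h1]; ring)
    refine le_max_of_le_left ?_
    exact one_le_mul_of_one_le_of_one_le (one_le_pow₀ (one_lt_q_real F).le) (one_le_norm_toK h1)
  · exact le_max_of_le_right (one_le_norm_toK h)

theorem vecMul_unit_zero (γ : GL (Fin 2) F[X]) :
    Matrix.vecMul ![1, 0] (γ.1.map (toK F)) = ![toK F (γ 0 0), toK F (γ 0 1)] := by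
  ext i
  fin_cases i <;> simp [Matrix.vecMul, dotProduct, Fin.sum_univ_two]

theorem vecMul_unit_one (γ : GL (Fin 2) F[X]) :
    Matrix.vecMul ![0, 1] (γ.1.map (toK F)) = ![toK F (γ 1 0), toK F (γ 1 1)] := by
  ext i
  fin_cases i <;> simp [Matrix.vecMul, dotProduct, Fin.sum_univ_two]

/-- Comparing shortest vectors shows that the factor `ρ` in `mapsClass_iff` is `1` for the standard
lattices. -/
theorem latNorm_eq_of_mapsClass {γ : GL (Fin 2) F[X]} {n m : ℕ}
    (h : MapsClass γ (gLattice F n) (gLattice F m)) (w : Fin 2 → KInf F) :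
    latNorm (gLattice F m) w = latNorm (gLattice F n) (Matrix.vecMul w (γ.1.map (toK F))) := by
  have key : ∀ {γ : GL (Fin 2) F[X]} {n m : ℕ} {ρ : ℝ}, 0 < ρ →
      (∀ w, latNorm (gLattice F m) w
        = ρ * latNorm (gLattice F n) (Matrix.vecMul w (γ.1.map (toK F)))) → ρ ≤ 1 := by
    intro γ n m ρ hρ h
    have h1 := h ![0, 1]
    rw [vecMul_unit_one, latNorm_gLattice, latNorm_gLattice] at h1
    simp only [Matrix.cons_val_zero, Matrix.cons_val_one, norm_zero, mul_zero, norm_one] at h1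
    rw [max_eq_right zero_le_one] at h1
    have h2 := one_le_max_norm_row (γ := γ) n
    nlinarith
  obtain ⟨ρ, hρ, h1⟩ := mapsClass_iff.1 h
  have hρ1 := key hρ h1
  have hρ2 : ρ⁻¹ ≤ 1 := by
    refine key (γ := γ⁻¹) (n := m) (m := n) (inv_pos.2 hρ) fun w => ?_
    have hinv : Matrix.vecMul (Matrix.vecMul w (γ⁻¹.1.map (toK F))) (γ.1.map (toK F)) = w := by
      rw [Matrix.vecMul_vecMul, ← Matrix.map_mul, ← Units.val_mul, inv_mul_cancel]
      simp
    rw [h1, hinv, inv_mul_cancel_left₀ hρ.ne']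
  have : ρ = 1 := le_antisymm hρ1 ((inv_le_one₀ hρ).1 hρ2)
  rw [h1, this, one_mul]

theorem rows_of_mapsClass {γ : GL (Fin 2) F[X]} {n m : ℕ}
    (h : MapsClass γ (gLattice F n) (gLattice F m)) :
    (q F : ℝ) ^ m = max ((q F : ℝ) ^ n * ‖toK F (γ 0 0)‖) ‖toK F (γ 0 1)‖ ∧
      1 = max ((q F : ℝ) ^ n * ‖toK F (γ 1 0)‖) ‖toK F (γ 1 1)‖ := by
  have h0 := latNorm_eq_of_mapsClass h ![1, 0]
  have h1 := latNorm_eq_of_mapsClass h ![0, 1]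
  rw [vecMul_unit_zero, latNorm_gLattice, latNorm_gLattice] at h0
  rw [vecMul_unit_one, latNorm_gLattice, latNorm_gLattice] at h1
  simp only [Matrix.cons_val_zero, Matrix.cons_val_one, norm_zero, mul_zero, norm_one,
    mul_one] at h0 h1
  rw [max_eq_left (pow_pos (q_pos F) m).le] at h0
  rw [max_eq_right zero_le_one] at h1
  exact ⟨h0, h1⟩

theorem eq_zero_of_pow_mul_norm_le_one {n : ℕ} (hn : n ≠ 0) {p : F[X]}
    (h : (q F : ℝ) ^ n * ‖toK F p‖ ≤ 1) : p = 0 := by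
  by_contra hp
  have h1 := one_le_norm_toK hp
  have h2 : 1 < (q F : ℝ) ^ n := one_lt_pow₀ (one_lt_q_real F) hn
  nlinarith

theorem norm_toK_le_pow_iff {n : ℕ} {p : F[X]} : ‖toK F p‖ ≤ (q F : ℝ) ^ n ↔ p.natDegree ≤ n := by
  by_cases hp : p = 0
  · simp [hp, (q_pos F).le]
  · rw [norm_toK hp, pow_le_pow_iff_right₀ (one_lt_q_real F)]

theorem norm_toK_le_one_iff {p : F[X]} : ‖toK F p‖ ≤ 1 ↔ p.natDegree = 0 := by
  simpa using norm_toK_le_pow_iff (n := 0) (p := p)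

theorem vtx_injective : Function.Injective (vtx F) := by
  have key : ∀ {n m : ℕ}, vtx F n = vtx F m → n ≤ m := by
    intro n m h
    obtain ⟨γ, hγ⟩ : ∃ γ : GL (Fin 2) F[X], MapsClass γ (gLattice F n) (gLattice F m) :=
      Quotient.exact h
    by_cases hn : n = 0
    · omega
    obtain ⟨h0, h1⟩ := rows_of_mapsClass hγ
    have hc := eq_zero_of_pow_mul_norm_le_one hn (h1 ▸ le_max_left _ _)
    have ha : γ 0 0 ≠ 0 := by
      intro ha
      have hdet : γ.1.det ≠ 0 := ((Matrix.isUnit_iff_isUnit_det _).1 γ.isUnit).ne_zero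
      rw [Matrix.det_fin_two] at hdet
      exact hdet (by rw [ha, hc]; ring)
    have h2 : (q F : ℝ) ^ n ≤ (q F : ℝ) ^ m := by
      rw [h0]
      exact le_max_of_le_left (le_mul_of_one_le_right (pow_pos (q_pos F) n).le (one_le_norm_toK ha))
    exact (pow_le_pow_iff_right₀ (one_lt_q_real F)).1 h2
  exact fun n m h => le_antisymm (key h) (key h.symm)

/-- The stabilizer of `v_n` in `GL₂(A)`, up to homothety. -/
theorem mapsClass_gLattice_iff {γ : GL (Fin 2) F[X]} {n : ℕ} :
    MapsClass γ (gLattice F n) (gLattice F n) ↔ ‖toK F (γ 0 0)‖ ≤ 1 ∧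
      ‖toK F (γ 0 1)‖ ≤ (q F : ℝ) ^ n ∧ (q F : ℝ) ^ n * ‖toK F (γ 1 0)‖ ≤ 1 ∧
      ‖toK F (γ 1 1)‖ ≤ 1 := by
  have hqn : 0 < (q F : ℝ) ^ n := pow_pos (q_pos F) n
  constructor
  · intro h
    obtain ⟨h0, h1⟩ := rows_of_mapsClass h
    refine ⟨?_, h0.symm ▸ le_max_right _ _, h1.symm ▸ le_max_left _ _, h1.symm ▸ le_max_right _ _⟩
    have : (q F : ℝ) ^ n * ‖toK F (γ 0 0)‖ ≤ (q F : ℝ) ^ n * 1 := by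
      rw [mul_one]
      conv_rhs => rw [h0]
      exact le_max_left _ _
    exact le_of_mul_le_mul_left this hqn
  · rintro ⟨ha, hb, hc, hd⟩
    have hle : ∀ M : Matrix (Fin 2) (Fin 2) F[X], ‖toK F (M 0 0)‖ ≤ 1 →
        ‖toK F (M 0 1)‖ ≤ (q F : ℝ) ^ n → (q F : ℝ) ^ n * ‖toK F (M 1 0)‖ ≤ 1 →
        ‖toK F (M 1 1)‖ ≤ 1 → ∀ w : Fin 2 → KInf F,
        latNorm (gLattice F n) (Matrix.vecMul w (M.map (toK F))) ≤ latNorm (gLattice F n) w := by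
      intro M ha hb hc hd w
      rw [latNorm_gLattice, latNorm_gLattice]
      simp only [Matrix.vecMul, dotProduct, Fin.sum_univ_two, Matrix.map_apply]
      have h0 := norm_nonneg (w 0)
      have h1 := norm_nonneg (w 1)
      refine max_le ?_ ?_
      · refine (mul_le_mul_of_nonneg_left (IsUltrametricDist.norm_add_le_max _ _) hqn.le).trans ?_
        rw [mul_max_of_nonneg _ _ hqn.le, norm_mul, norm_mul]
        refine max_le_max ?_ ?_
        · exact mul_le_mul_of_nonneg_left (mul_le_of_le_one_right h0 ha) hqn.le
        · calc _ = ‖w 1‖ * ((q F : ℝ) ^ n * ‖toK F (M 1 0)‖) := by ring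
            _ ≤ ‖w 1‖ := mul_le_of_le_one_right h1 hc
      · refine (IsUltrametricDist.norm_add_le_max _ _).trans ?_
        rw [norm_mul, norm_mul]
        refine max_le_max ?_ (mul_le_of_le_one_right h1 hd)
        rw [mul_comm]
        exact mul_le_mul_of_nonneg_right hb h0
    have hdet : IsUnit γ.1.det := (Matrix.isUnit_iff_isUnit_det _).1 γ.isUnit
    obtain ⟨u, hu, hu'⟩ := Polynomial.isUnit_iff.1 hdet
    have hdinv : γ⁻¹.1 = C u⁻¹ • γ.1.adjugate := by
      have h1 : γ.1 * (C u⁻¹ • γ.1.adjugate) = 1 := by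
        rw [Matrix.mul_smul, Matrix.mul_adjugate, ← hu', smul_smul, ← C_mul,
          inv_mul_cancel₀ hu.ne_zero, C_1, one_smul]
      have h2 : γ⁻¹.1 * (γ.1 * (C u⁻¹ • γ.1.adjugate)) = C u⁻¹ • γ.1.adjugate := by
        rw [← mul_assoc, ← Units.val_mul, inv_mul_cancel, Units.val_one, one_mul]
      rw [← h2, h1, mul_one]
    have hnu : ‖toK F (C u⁻¹)‖ = 1 := by
      rw [norm_toK (C_ne_zero.2 (inv_ne_zero hu.ne_zero)), natDegree_C, pow_zero]
    refine mapsClass_iff.2 ⟨1, one_pos, fun w => ?_⟩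
    rw [one_mul]
    refine le_antisymm ?_ (hle γ.1 ha hb hc hd w)
    have hinv : Matrix.vecMul (Matrix.vecMul w (γ.1.map (toK F))) (γ⁻¹.1.map (toK F)) = w := by
      rw [Matrix.vecMul_vecMul, ← Matrix.map_mul, ← Units.val_mul, mul_inv_cancel]
      simp
    conv_lhs => rw [← hinv]
    refine hle γ⁻¹.1 ?_ ?_ ?_ ?_ _ <;> rw [hdinv] <;>
      simp only [Matrix.smul_apply, Matrix.adjugate_fin_two, Matrix.of_apply, Matrix.cons_val_zero,
        Matrix.cons_val_one, smul_eq_mul, map_mul, norm_mul, hnu, one_mul, map_neg, norm_neg,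
        Matrix.cons_val', Matrix.cons_val_fin_one]
    · exact hd
    · exact hb
    · exact hc
    · exact ha

theorem card_stab_eq {L L' : OLattice F} (h : L.toQ = L'.toQ) :
    Nat.card (stab L) = Nat.card (stab L') := by
  obtain ⟨δ, hδ⟩ : ∃ δ : GL (Fin 2) F[X], MapsClass δ L L' := Quotient.exact h
  let d : PGL(2, F[X]) := Matrix.ProjGenLinGroup.mk δ
  have himg : stab L' = (fun g => d * g * d⁻¹) '' stab L := by
    ext g
    constructor
    · rintro ⟨γ, rfl, hγ⟩
      refine ⟨_, ⟨δ⁻¹ * γ * δ, rfl, ?_⟩, ?_⟩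
      · exact mapsClass_mul hδ (mapsClass_mul hγ (mapsClass_inv hδ))
      · simp only [map_mul, map_inv, d]
        group
    · rintro ⟨_, ⟨γ, rfl, hγ⟩, rfl⟩
      refine ⟨δ * γ * δ⁻¹, by simp [d], ?_⟩
      rw [mul_assoc]
      exact mapsClass_mul (mapsClass_mul (mapsClass_inv hδ) hγ) hδ
  rw [himg, Nat.card_image_of_injective]
  intro a b hab
  simpa using hab

theorem eq_C_of_natDegree_eq_zero' {p : F[X]} (h : p.natDegree = 0) : ∃ c, p = C c :=
  ⟨_, eq_C_of_natDegree_eq_zero h⟩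

/-- The upper triangular matrix `(a, b; 0, 1)`. -/
def upperGL (a : Fˣ) (b : F[X]) : GL (Fin 2) F[X] :=
  ⟨!![C (a : F), b; 0, 1], !![C ((a⁻¹ : Fˣ) : F), -C ((a⁻¹ : Fˣ) : F) * b; 0, 1], by
    ext i j : 1
    fin_cases i <;> fin_cases j <;>
      simp [Matrix.mul_apply, Fin.sum_univ_two, ← mul_assoc, ← C_mul], by
    ext i j : 1
    fin_cases i <;> fin_cases j <;>
      simp [Matrix.mul_apply, Fin.sum_univ_two, ← C_mul]⟩

theorem card_stab_gLattice {n : ℕ} (hn : n ≠ 0) :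
    Nat.card (stab (gLattice F n)) = (q F - 1) * q F ^ (n + 1) := by
  classical
  let f : Fˣ × degreeLT F (n + 1) → stab (gLattice F n) := fun p =>
    ⟨Matrix.ProjGenLinGroup.mk (upperGL p.1 p.2.1), upperGL p.1 p.2.1, rfl, by
      rw [mapsClass_gLattice_iff]
      have hdeg : (p.2.1 : F[X]).natDegree ≤ n :=
        Nat.lt_succ_iff.1 (by
          by_cases h : (p.2.1 : F[X]) = 0
          · simp [h]
          · exact (natDegree_lt_iff_degree_lt h).2 (mem_degreeLT.1 p.2.2))
      refine ⟨?_, norm_toK_le_pow_iff.2 ?_, ?_, ?_⟩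
      · exact norm_toK_le_one_iff.2 (by simp [upperGL])
      · simpa [upperGL] using hdeg
      · simp [upperGL]
      · simp [upperGL]⟩
  have hf : Function.Bijective f := by
    constructor
    · rintro ⟨a, b⟩ ⟨a', b'⟩ h
      have h1 := congrArg Subtype.val h
      obtain ⟨u, hu⟩ := Matrix.ProjGenLinGroup.mk_eq_mk_iff.1 h1
      have h2 : ∀ i j, (upperGL a b.1) i j * u.1 = (upperGL a' b'.1) i j := fun i j => by
        have := congrArg (fun g : GL (Fin 2) F[X] => g.1 i j) hu
        simpa using this
      have h11 := h2 1 1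
      have h00 := h2 0 0
      have h01 := h2 0 1
      simp only [upperGL, Matrix.of_apply, Matrix.cons_val_zero, Matrix.cons_val_one,
        Matrix.cons_val', Matrix.cons_val_fin_one, one_mul] at h11 h00 h01
      rw [h11, mul_one] at h00 h01
      refine Prod.ext (Units.ext (C_injective h00)) (Subtype.ext h01)
    · rintro ⟨_, γ, rfl, hγ⟩
      obtain ⟨h00, h01, h10, h11⟩ := mapsClass_gLattice_iff.1 hγ
      have hc := eq_zero_of_pow_mul_norm_le_one hn h10
      obtain ⟨a, ha⟩ := eq_C_of_natDegree_eq_zero' (norm_toK_le_one_iff.1 h00)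
      obtain ⟨d, hd⟩ := eq_C_of_natDegree_eq_zero' (norm_toK_le_one_iff.1 h11)
      have hdeg := norm_toK_le_pow_iff.1 h01
      have hdet : γ.1.det ≠ 0 := ((Matrix.isUnit_iff_isUnit_det _).1 γ.isUnit).ne_zero
      rw [Matrix.det_fin_two] at hdet
      have ha0 : a ≠ 0 := by
        rintro rfl
        exact hdet (by rw [ha, hc]; simp)
      have hd0 : d ≠ 0 := by
        rintro rfl
        exact hdet (by rw [hd, hc]; simp)
      refine ⟨(Units.mk0 (a / d) (div_ne_zero ha0 hd0), ⟨C d⁻¹ * γ 0 1, ?_⟩), Subtype.ext ?_⟩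
      · rw [mem_degreeLT]
        refine (degree_le_natDegree).trans_lt ?_
        have := natDegree_C_mul_le d⁻¹ (γ 0 1)
        exact_mod_cast Nat.lt_succ_of_le (this.trans hdeg)
      · refine Matrix.ProjGenLinGroup.mk_eq_mk_iff.2
          ⟨Units.map (C : F →+* F[X]).toMonoidHom (Units.mk0 d hd0), ?_⟩
        ext i j : 2
        have hdd : C d⁻¹ * C d = (1 : F[X]) := by rw [← C_mul, inv_mul_cancel₀ hd0, C_1]
        fin_cases i <;> fin_cases j <;>
          simp [upperGL, Matrix.mul_apply, Fin.sum_univ_two]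
        · rw [ha, ← C_mul, div_mul_cancel₀ _ hd0]
        · rw [mul_right_comm, hdd, one_mul]
        · exact hc.symm
        · exact hd.symm
  rw [← Nat.card_eq_of_bijective f hf, Nat.card_prod, Nat.card_eq_fintype_card,
    Fintype.card_units, Nat.card_congr (degreeLTEquiv F (n + 1)).toEquiv, Nat.card_fun]
  simp

theorem card_stab_gLattice_zero :
    (q F - 1) * Nat.card (stab (gLattice F 0)) = (q F ^ 2 - 1) * (q F ^ 2 - q F) := by
  classical
  let φ : GL (Fin 2) F →* PGL(2, F[X]) :=
    Matrix.ProjGenLinGroup.mk.comp (Matrix.GeneralLinearGroup.map (C : F →+* F[X]))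
  have hrange : stab (gLattice F 0) = (φ.range : Set PGL(2, F[X])) := by
    ext g
    constructor
    · rintro ⟨γ, rfl, hγ⟩
      obtain ⟨h00, h01, h10, h11⟩ := mapsClass_gLattice_iff.1 hγ
      rw [pow_zero] at h01
      rw [pow_zero, one_mul] at h10
      have hconst : ∀ i j, C ((γ i j).coeff 0) = γ i j := by
        intro i j
        refine (eq_C_of_natDegree_eq_zero (norm_toK_le_one_iff.1 ?_)).symm
        fin_cases i <;> fin_cases j <;> assumption
      let M : Matrix (Fin 2) (Fin 2) F := Matrix.of fun i j => (γ i j).coeff 0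
      have hM : M.map C = γ.1 := by
        ext i j : 1
        exact hconst i j
      have hdet : M.det ≠ 0 := by
        intro h
        have hdet : γ.1.det ≠ 0 := ((Matrix.isUnit_iff_isUnit_det _).1 γ.isUnit).ne_zero
        apply hdet
        rw [← hM]
        have := RingHom.map_det (C : F →+* F[X]) M
        rw [h, map_zero] at this
        exact this.symm
      refine ⟨Matrix.GeneralLinearGroup.mkOfDetNeZero M hdet, ?_⟩
      change Matrix.ProjGenLinGroup.mk _ = _
      congr 1
      ext i j : 2
      exact hconst i j
    · rintro ⟨M, rfl⟩
      refine ⟨_, rfl, mapsClass_gLattice_iff.2 ?_⟩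
      have : ∀ i j, ‖toK F ((Matrix.GeneralLinearGroup.map (C : F →+* F[X]) M) i j)‖ ≤ 1 := by
        intro i j
        exact norm_toK_le_one_iff.2 (natDegree_C _)
      simp only [pow_zero, one_mul]
      exact ⟨this _ _, this _ _, this _ _, this _ _⟩
  have hker : Nat.card φ.ker = q F - 1 := by
    have hk : (φ.ker : Set (GL (Fin 2) F))
        = Set.range (Matrix.GeneralLinearGroup.scalar (Fin 2)) := by
      ext M
      rw [SetLike.mem_coe, MonoidHom.mem_ker]
      constructor
      · intro h
        have h1 : Matrix.ProjGenLinGroup.mk (Matrix.GeneralLinearGroup.map (C : F →+* F[X]) M)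
          = Matrix.ProjGenLinGroup.mk 1 := by rw [map_one]; exact h
        obtain ⟨u, hu⟩ := Matrix.ProjGenLinGroup.mk_eq_mk_iff.1 h1.symm
        obtain ⟨c, hc, hc'⟩ := Polynomial.isUnit_iff.1 u.isUnit
        refine ⟨hc.unit, ?_⟩
        ext i j : 2
        have h2 := congrArg (fun g : GL (Fin 2) F[X] => g.1 i j) hu
        simp only [one_mul] at h2
        apply C_injective
        refine Eq.trans ?_ h2
        fin_cases i <;> fin_cases j <;> simp [hc']
      · rintro ⟨c, rfl⟩
        refine (Matrix.ProjGenLinGroup.mk_eq_mk_iff (g₁ := 1)).2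
          ⟨Units.map (C : F →+* F[X]).toMonoidHom c, ?_⟩ |>.symm
        ext i j : 2
        fin_cases i <;> fin_cases j <;> simp
    have hinj : Function.Injective
        (Matrix.GeneralLinearGroup.scalar (Fin 2) : Fˣ → GL (Fin 2) F) := by
      intro a b h
      have := congrArg (fun g : GL (Fin 2) F => g.1 0 0) h
      ext
      simpa using this
    calc Nat.card φ.ker = Nat.card (φ.ker : Set (GL (Fin 2) F)) := rfl
      _ = q F - 1 := by
        rw [hk, Nat.card_range_of_injective hinj, Nat.card_eq_fintype_card, Fintype.card_units]
  have h1 := Subgroup.card_eq_card_quotient_mul_card_subgroup φ.ker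
  rw [Nat.card_congr (QuotientGroup.quotientKerEquivRange φ).toEquiv, hker,
    Matrix.card_GL_field] at h1
  simp only [Fin.prod_univ_two, Fin.val_zero, pow_zero, Fin.val_one, pow_one] at h1
  rw [hrange, mul_comm]
  exact h1.symm

end Vertices

/-! ### The measure `μ` -/

section MeasureMu

variable {F : Type*} [Field F] [Fintype F]

/-- The masses `μ(v_0) = (q - 1) / 2q` and `μ(v_n) = (q² - 1) / 2q^(n+1)`, `n ≥ 1`. -/
def vtxMass (Q : ℝ) (n : ℕ) : ℝ :=
  if n = 0 then (Q - 1) / (2 * Q) else (Q ^ 2 - 1) / (2 * Q ^ (n + 1))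

theorem vtxMass_pos {Q : ℝ} (hQ : 1 < Q) (n : ℕ) : 0 < vtxMass Q n := by
  unfold vtxMass
  have h0 : 0 < Q := by linarith
  have h1 : 0 < Q - 1 := by linarith
  have h2 : 0 < Q ^ 2 - 1 := by nlinarith
  split_ifs <;> positivity

theorem vtxMass_le {Q : ℝ} (hQ : 1 < Q) (n : ℕ) : vtxMass Q n ≤ Q / Q ^ n := by
  have h0 : 0 < Q := by linarith
  have h1 : (0 : ℝ) < Q ^ n := by positivity
  unfold vtxMass
  split_ifs with h
  · subst h
    rw [pow_zero, div_one, div_le_iff₀ (by positivity)]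
    nlinarith
  · rw [div_le_div_iff₀ (by positivity) h1, pow_succ Q n]
    nlinarith [mul_pos h1 h0, mul_pos h1 (mul_pos h0 h0)]

theorem hasSum_vtxMass {Q : ℝ} (hQ : 1 < Q) : HasSum (vtxMass Q) 1 := by
  have h0 : 0 < Q := by linarith
  have h1 : Q - 1 ≠ 0 := by linarith
  have hg : HasSum (fun n : ℕ => (Q⁻¹) ^ n) (1 - Q⁻¹)⁻¹ :=
    hasSum_geometric_of_lt_one (by positivity) (inv_lt_one_of_one_lt₀ hQ)
  have hs : HasSum (fun n : ℕ => vtxMass Q (n + 1)) ((Q ^ 2 - 1) / (2 * Q ^ 2) * (1 - Q⁻¹)⁻¹) := by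
    have h2 : (fun n : ℕ => vtxMass Q (n + 1))
        = fun n : ℕ => (Q ^ 2 - 1) / (2 * Q ^ 2) * (Q⁻¹) ^ n := by
      funext n
      rw [vtxMass, if_neg (Nat.succ_ne_zero n), inv_pow]
      field_simp
      ring
    rw [h2]
    exact hg.mul_left _
  refine (hasSum_nat_add_iff' (f := vtxMass Q) 1 (g := 1)).1 ?_
  have h2 : (1 - Q⁻¹) = (Q - 1) / Q := by field_simp
  have h3 : 1 - ∑ i ∈ Finset.range 1, vtxMass Q i
      = (Q ^ 2 - 1) / (2 * Q ^ 2) * (1 - Q⁻¹)⁻¹ := by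
    rw [Finset.sum_range_one, vtxMass, if_pos rfl, h2, inv_div]
    field_simp
    ring
  rw [h3]
  exact hs

theorem inv_card_stab (n : ℕ) : ((Nat.card (stab (gLattice F n)) : ℕ) : ℝ)⁻¹
    = 2 / (((q F : ℝ) ^ 2 - 1) * ((q F : ℝ) - 1)) * vtxMass (q F) n := by
  have hQ := one_lt_q_real F
  have h0 := q_pos F
  have h1 : (q F : ℝ) - 1 ≠ 0 := by linarith
  have h2 : (q F : ℝ) ^ 2 - 1 ≠ 0 := by nlinarith
  have hn1 : 1 ≤ q F := one_lt_card_q.le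
  unfold vtxMass
  split_ifs with h
  · subst h
    have h3 := congrArg (fun n : ℕ => (n : ℝ)) (card_stab_gLattice_zero (F := F))
    have h4 : q F ≤ q F ^ 2 := Nat.le_self_pow two_ne_zero _
    simp only [Nat.cast_mul] at h3
    rw [Nat.cast_sub hn1, Nat.cast_sub (hn1.trans h4), Nat.cast_sub h4] at h3
    push_cast at h3
    have h5 : ((Nat.card (stab (gLattice F 0)) : ℕ) : ℝ) = ((q F : ℝ) ^ 2 - 1) * q F := by
      apply mul_left_cancel₀ h1
      rw [h3]; ring
    rw [h5]
    field_simp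
  · rw [card_stab_gLattice h, Nat.cast_mul, Nat.cast_sub hn1]
    push_cast
    field_simp

/-- The vertices of `Γ \ 𝒯` are the `v_n`. -/
def vtxEquiv : ℕ ≃ QVertex F := Equiv.ofBijective (vtx F) ⟨vtx_injective, vtx_surjective⟩

instance : Countable (QVertex F) := (vtxEquiv (F := F)).symm.injective.countable

instance : MeasurableSingletonClass (QVertex F) := ⟨fun _ => trivial⟩

theorem stabMeasure_density (n : ℕ) :
    ((Nat.card (stab (Quotient.out (vtx F n))) : ℕ) : ℝ≥0∞)⁻¹
      = ENNReal.ofReal (2 / (((q F : ℝ) ^ 2 - 1) * ((q F : ℝ) - 1)))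
        * ENNReal.ofReal (vtxMass (q F) n) := by
  have hQ := one_lt_q_real F
  have h : (Quotient.out (vtx F n)).toQ = (gLattice F n).toQ := Quotient.out_eq _
  have hc : 0 < 2 / (((q F : ℝ) ^ 2 - 1) * ((q F : ℝ) - 1)) := by
    have h1 : 0 < (q F : ℝ) - 1 := by linarith
    have h2 : 0 < (q F : ℝ) ^ 2 - 1 := by nlinarith
    positivity
  rw [card_stab_eq h, ← ENNReal.ofReal_mul hc.le, ← inv_card_stab]
  have hpos : 0 < ((Nat.card (stab (gLattice F n)) : ℕ) : ℝ) := by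
    rw [← inv_pos, inv_card_stab]
    exact mul_pos hc (vtxMass_pos hQ n)
  rw [ENNReal.ofReal_inv_of_pos hpos, ENNReal.ofReal_natCast]

theorem mu_singleton (n : ℕ) : mu F {vtx F n} = ENNReal.ofReal (vtxMass (q F) n) := by
  have hQ := one_lt_q_real F
  have hc : 0 < 2 / (((q F : ℝ) ^ 2 - 1) * ((q F : ℝ) - 1)) := by
    have h1 : 0 < (q F : ℝ) - 1 := by linarith
    have h2 : 0 < (q F : ℝ) ^ 2 - 1 := by nlinarith
    positivity
  have huniv : stabMeasure F Set.univ
      = ENNReal.ofReal (2 / (((q F : ℝ) ^ 2 - 1) * ((q F : ℝ) - 1))) := by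
    rw [stabMeasure, withDensity_apply _ MeasurableSet.univ, Measure.restrict_univ,
      lintegral_count, ← (vtxEquiv (F := F)).tsum_eq]
    have : ∀ n, (((Nat.card (stab (Quotient.out (vtxEquiv (F := F) n))) : ℕ) : ℝ≥0∞)⁻¹)
      = ENNReal.ofReal (2 / (((q F : ℝ) ^ 2 - 1) * ((q F : ℝ) - 1)))
        * ENNReal.ofReal (vtxMass (q F) n) := stabMeasure_density
    simp only [this]
    rw [ENNReal.tsum_mul_left, ← ENNReal.ofReal_tsum_of_nonneg
      (fun n => (vtxMass_pos hQ n).le) (hasSum_vtxMass hQ).summable, (hasSum_vtxMass hQ).tsum_eq,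
      ENNReal.ofReal_one, mul_one]
  rw [mu, Measure.smul_apply, huniv, stabMeasure,
    withDensity_apply _ (measurableSet_singleton _), lintegral_singleton, Measure.count_singleton,
    mul_one, stabMeasure_density, smul_eq_mul, ← mul_assoc, ENNReal.inv_mul_cancel, one_mul]
  · exact (ENNReal.ofReal_pos.2 hc).ne'
  · exact ENNReal.ofReal_ne_top

instance : IsProbabilityMeasure (mu F) := by
  constructor
  have hQ := one_lt_q_real F
  have h := lintegral_countable' (μ := mu F) (fun _ => 1)
  rw [lintegral_one, ← (vtxEquiv (F := F)).tsum_eq] at h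
  have h2 : ∀ n, mu F {vtxEquiv (F := F) n} = ENNReal.ofReal (vtxMass (q F) n) := mu_singleton
  simp only [one_mul, h2] at h
  rw [h, ← ENNReal.ofReal_tsum_of_nonneg (fun n => (vtxMass_pos hQ n).le)
    (hasSum_vtxMass hQ).summable, (hasSum_vtxMass hQ).tsum_eq, ENNReal.ofReal_one]

theorem hasSum_integral_mu {f : QVertex F → ℂ} (hf : MemLp f 2 (mu F)) :
    HasSum (fun n => (vtxMass (q F) n : ℂ) * f (vtx F n)) (∫ v, f v ∂(mu F)) := by
  have hint : Integrable f (mu F) := hf.integrable one_le_two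
  have h := hasSum_integral_iUnion (μ := mu F) (f := f) (s := fun n => {vtx F n})
    (fun n => measurableSet_singleton _)
    (fun m n hmn => Set.disjoint_singleton.2 fun h => hmn (vtx_injective h)) hint.integrableOn
  have hU : (⋃ n, ({vtx F n} : Set (QVertex F))) = Set.univ := by
    refine Set.eq_univ_of_forall fun v => ?_
    obtain ⟨n, rfl⟩ := vtx_surjective v
    exact Set.mem_iUnion.2 ⟨n, rfl⟩
  rw [hU, setIntegral_univ] at h
  have h2 : (fun n => (vtxMass (q F) n : ℂ) * f (vtx F n))
      = fun n => ∫ v in {vtx F n}, f v ∂(mu F) := by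
    funext n
    rw [integral_singleton, Measure.real, mu_singleton,
      ENNReal.toReal_ofReal (vtxMass_pos (one_lt_q_real F) n).le, Complex.real_smul]
  rw [h2]
  exact h

/-- A square integrable function satisfies `f(v_n) = O(q ^ (n / 2))`. -/
theorem exists_norm_le_of_memLp {f : QVertex F → ℂ} (hf : MemLp f 2 (mu F)) :
    ∃ M : ℝ, 0 ≤ M ∧ ∀ n, ‖f (vtx F n)‖ ^ 2 ≤ M ^ 2 * (q F : ℝ) ^ n := by
  have hQ := one_lt_q_real F
  have h0 := q_pos F
  have hint : Integrable (fun v => ‖f v‖ ^ 2) (mu F) := by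
    simpa using hf.integrable_norm_pow two_ne_zero
  set I := ∫ v, ‖f v‖ ^ 2 ∂(mu F) with hI
  have hI0 : 0 ≤ I := integral_nonneg fun v => by positivity
  refine ⟨Real.sqrt (I * (2 * (q F : ℝ) / ((q F : ℝ) - 1))), Real.sqrt_nonneg _, fun n => ?_⟩
  have h1 : 0 < (q F : ℝ) - 1 := by linarith
  rw [Real.sq_sqrt (by positivity)]
  have hle : vtxMass (q F) n * ‖f (vtx F n)‖ ^ 2 ≤ I := by
    have h2 := setIntegral_le_integral (s := {vtx F n}) hint
      (Filter.Eventually.of_forall fun v => by positivity)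
    rw [integral_singleton, Measure.real, mu_singleton,
      ENNReal.toReal_ofReal (vtxMass_pos hQ n).le, smul_eq_mul] at h2
    exact h2
  have hlow : ((q F : ℝ) - 1) / (2 * q F) / (q F : ℝ) ^ n ≤ vtxMass (q F) n := by
    unfold vtxMass
    split_ifs with h
    · simp [h]
    · rw [div_div, div_le_div_iff₀ (by positivity) (by positivity), pow_succ]
      have : (0 : ℝ) < (q F : ℝ) ^ n := by positivity
      have h3 : ((q F : ℝ) - 1) * (2 * ((q F : ℝ) ^ n * q F))
          ≤ (((q F : ℝ) ^ 2 - 1)) * (2 * ((q F : ℝ) ^ n * q F)) := by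
        gcongr
        nlinarith
      linarith
  have h2 : ((q F : ℝ) - 1) / (2 * q F) / (q F : ℝ) ^ n * ‖f (vtx F n)‖ ^ 2 ≤ I :=
    (mul_le_mul_of_nonneg_right hlow (by positivity)).trans hle
  have h3 : ‖f (vtx F n)‖ ^ 2 = ((q F : ℝ) - 1) / (2 * q F) / (q F : ℝ) ^ n * ‖f (vtx F n)‖ ^ 2
      * (2 * (q F : ℝ) / ((q F : ℝ) - 1)) * (q F : ℝ) ^ n := by
    field_simp
  rw [h3]
  gcongr

end MeasureMu

/-! ### Divisors and coprime residues of polynomials over a finite field -/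

section Sieve

variable {k : Type*} [Field k]

theorem finite_degree_lt [Finite k] (n : ℕ) : {x : k[X] | x.degree < n}.Finite := by
  have : Finite (degreeLT k n) := Finite.of_equiv _ (degreeLTEquiv k n).toEquiv.symm
  refine (Set.toFinite (degreeLT k n : Set k[X])).subset fun p hp => ?_
  rw [SetLike.mem_coe, mem_degreeLT]
  exact hp

theorem ncard_degree_lt [Fintype k] (n : ℕ) :
    {x : k[X] | x.degree < n}.ncard = Fintype.card k ^ n := by
  have h : {x : k[X] | x.degree < n} = (degreeLT k n : Set k[X]) := by
    ext x
    rw [SetLike.mem_coe, mem_degreeLT]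
    rfl
  rw [h]
  change Nat.card (degreeLT k n) = _
  rw [Nat.card_congr (degreeLTEquiv k n).toEquiv, Nat.card_fun, Nat.card_eq_fintype_card,
    Nat.card_eq_fintype_card, Fintype.card_fin]

/-- The number of monic divisors of a polynomial. -/
def numDiv (N : k[X]) : ℕ := {g : k[X] | g.Monic ∧ g ∣ N}.ncard

theorem finite_monic_dvd [Finite k] {N : k[X]} (hN : N ≠ 0) :
    {g : k[X] | g.Monic ∧ g ∣ N}.Finite :=
  (finite_degree_lt (k := k) (N.natDegree + 1)).subset fun g hg => by
    have h := natDegree_le_of_dvd hg.2 hN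
    exact degree_le_natDegree.trans_lt (by exact_mod_cast Nat.lt_succ_of_le h)

theorem one_le_numDiv [Finite k] {N : k[X]} (hN : N ≠ 0) : 1 ≤ numDiv N :=
  (Set.ncard_pos (finite_monic_dvd hN)).2 ⟨1, monic_one, one_dvd N⟩

theorem numDiv_le_of_dvd [Finite k] {M N : k[X]} (hN : N ≠ 0) (h : M ∣ N) :
    numDiv M ≤ numDiv N :=
  Set.ncard_le_ncard (fun _ hg => ⟨hg.1, hg.2.trans h⟩) (finite_monic_dvd hN)

theorem numDiv_mul_le [Finite k] {M N : k[X]} (hM : M ≠ 0) (hN : N ≠ 0) :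
    numDiv (M * N) ≤ numDiv M * numDiv N := by
  classical
  have h : {g : k[X] | g.Monic ∧ g ∣ M * N} ⊆ (fun p : k[X] × k[X] => p.1 * p.2) ''
      ({g : k[X] | g.Monic ∧ g ∣ M} ×ˢ {g : k[X] | g.Monic ∧ g ∣ N}) := by
    rintro g ⟨hg, hd⟩
    obtain ⟨a, b, ha, hb, rfl⟩ := exists_dvd_and_dvd_of_dvd_mul hd
    have ha0 : a ≠ 0 := fun h => hM (zero_dvd_iff.1 (h ▸ ha))
    have hb0 : b ≠ 0 := fun h => hN (zero_dvd_iff.1 (h ▸ hb))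
    refine ⟨(normalize a, normalize b), ⟨⟨monic_normalize ha0, normalize_dvd_iff.2 ha⟩,
      ⟨monic_normalize hb0, normalize_dvd_iff.2 hb⟩⟩, ?_⟩
    change normalize a * normalize b = a * b
    rw [← normalize_mul, hg.normalize_eq_self]
  refine (Set.ncard_le_ncard h
    (((finite_monic_dvd hM).prod (finite_monic_dvd hN)).image _)).trans ?_
  refine (Set.ncard_image_le ((finite_monic_dvd hM).prod (finite_monic_dvd hN))).trans ?_
  rw [Set.ncard_prod]
  rfl

theorem numDiv_prime_pow_le {p : k[X]} (hp : Prime p) (e : ℕ) : numDiv (p ^ e) ≤ e + 1 := by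
  classical
  have h : {g : k[X] | g.Monic ∧ g ∣ p ^ e} ⊆
      ((Finset.range (e + 1)).image fun i => normalize p ^ i : Finset k[X]) := by
    rintro g ⟨hg, hd⟩
    obtain ⟨i, hi, ha⟩ := (dvd_prime_pow hp e).1 hd
    rw [Finset.coe_image]
    refine ⟨i, by simpa using Nat.lt_succ_of_le hi, ?_⟩
    change normalize p ^ i = g
    have hpow : normalize p ^ i = normalize (p ^ i) := (map_pow normalizeHom p i).symm
    rw [hpow, ← hg.normalize_eq_self]
    exact normalize_eq_normalize ha.symm.dvd ha.dvd
  refine (Set.ncard_le_ncard h (Finset.finite_toSet _)).trans ?_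
  rw [Set.ncard_coe_finset]
  exact Finset.card_image_le.trans (by simp)

theorem two_mul_numDiv_le [Finite k] {p N : k[X]} (hp : Prime p) (hN : N ≠ 0) (h : ¬ p ∣ N) :
    2 * numDiv N ≤ numDiv (p * N) := by
  classical
  have hm : (normalize p).Monic := monic_normalize hp.ne_zero
  have hd : Disjoint {g : k[X] | g.Monic ∧ g ∣ N}
      ((fun g => normalize p * g) '' {g : k[X] | g.Monic ∧ g ∣ N}) := by
    rw [Set.disjoint_left]
    rintro _ hg ⟨g, -, rfl⟩
    exact h (((dvd_normalize_iff.2 dvd_rfl).mul_right g).trans hg.2)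
  have hsub : {g : k[X] | g.Monic ∧ g ∣ N} ∪
      ((fun g => normalize p * g) '' {g : k[X] | g.Monic ∧ g ∣ N})
      ⊆ {g : k[X] | g.Monic ∧ g ∣ p * N} := by
    rintro g (hg | ⟨g, hg, rfl⟩)
    · exact ⟨hg.1, hg.2.mul_left p⟩
    · exact ⟨hm.mul hg.1, mul_dvd_mul (normalize_dvd_iff.2 dvd_rfl) hg.2⟩
  have := Set.ncard_le_ncard hsub (finite_monic_dvd (mul_ne_zero hp.ne_zero hN))
  rw [Set.ncard_union_eq hd (finite_monic_dvd hN) ((finite_monic_dvd hN).image _),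
    Set.ncard_image_of_injective _ (mul_right_injective₀ hm.ne_zero)] at this
  unfold numDiv at *
  omega

/-- The number of polynomials of degree `< l` that are prime to `N`. -/
def coprimeCount (l : ℕ) (N : k[X]) : ℕ := {y : k[X] | y.degree < l ∧ IsCoprime y N}.ncard

theorem finite_coprime [Finite k] (l : ℕ) (N : k[X]) :
    {y : k[X] | y.degree < l ∧ IsCoprime y N}.Finite :=
  (finite_degree_lt (k := k) l).subset fun _ h => h.1

theorem coprimeCount_zero_le (N : k[X]) : coprimeCount 0 N ≤ 1 := by
  have h : {y : k[X] | y.degree < (0 : ℕ) ∧ IsCoprime y N} ⊆ {0} := by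
    rintro y ⟨hy, -⟩
    by_contra hy0
    exact absurd hy (not_lt.2 (zero_le_degree_iff.2 hy0))
  exact (Set.ncard_le_ncard h (Set.finite_singleton _)).trans (Set.ncard_singleton _).le

theorem coprimeCount_mul_of_dvd {p N : k[X]} (h : p ∣ N) (l : ℕ) :
    coprimeCount l (p * N) = coprimeCount l N := by
  unfold coprimeCount
  congr 1
  ext y
  refine and_congr_right fun _ => ⟨fun hc => hc.of_mul_right_right, fun hc => ?_⟩
  exact (hc.of_isCoprime_of_dvd_right h).mul_right hc

theorem degree_mul_lt_iff {p y : k[X]} (hp : p ≠ 0) (l : ℕ) :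
    (p * y).degree < l ↔ y.degree < (l - p.natDegree : ℕ) := by
  by_cases hy : y = 0
  · simp [hy]
  · rw [degree_eq_natDegree (mul_ne_zero hp hy), degree_eq_natDegree hy, natDegree_mul hp hy]
    norm_cast
    omega

theorem coprimeCount_eq_add [Finite k] {p N : k[X]} (hp : Prime p) (h : ¬ p ∣ N) (l : ℕ) :
    coprimeCount l N = coprimeCount l (p * N) + coprimeCount (l - p.natDegree) N := by
  have hpN : IsCoprime p N := (Irreducible.coprime_iff_not_dvd hp.irreducible).2 h
  have h1 : {y : k[X] | y.degree < l ∧ IsCoprime y N} =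
      {y : k[X] | y.degree < l ∧ IsCoprime y (p * N)} ∪
      (fun y => p * y) '' {y : k[X] | y.degree < (l - p.natDegree : ℕ) ∧ IsCoprime y N} := by
    ext y
    constructor
    · rintro ⟨hy, hc⟩
      by_cases hpy : p ∣ y
      · obtain ⟨z, rfl⟩ := hpy
        exact Or.inr ⟨z, ⟨(degree_mul_lt_iff hp.ne_zero l).1 hy, hc.of_mul_left_right⟩, rfl⟩
      · exact Or.inl ⟨hy, IsCoprime.mul_right
          ((Irreducible.coprime_iff_not_dvd hp.irreducible).2 hpy).symm hc⟩
    · rintro (⟨hy, hc⟩ | ⟨z, ⟨hz, hc⟩, rfl⟩)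
      · exact ⟨hy, hc.of_mul_right_right⟩
      · exact ⟨(degree_mul_lt_iff hp.ne_zero l).2 hz, hpN.mul_left hc⟩
  have h2 : Disjoint {y : k[X] | y.degree < l ∧ IsCoprime y (p * N)}
      ((fun y => p * y) '' {y : k[X] | y.degree < (l - p.natDegree : ℕ) ∧ IsCoprime y N}) := by
    rw [Set.disjoint_left]
    rintro _ ⟨-, hc⟩ ⟨z, -, rfl⟩
    exact hp.not_isUnit (hc.of_mul_right_left.of_mul_left_left.isUnit_of_dvd' dvd_rfl dvd_rfl)
  unfold coprimeCount
  rw [h1, Set.ncard_union_eq h2 (finite_coprime _ _) ((finite_coprime _ _).image _),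
    Set.ncard_image_of_injective _ (mul_right_injective₀ hp.ne_zero)]

/-- The sieve of Eratosthenes–Legendre: up to an error at most the number of divisors of `N`, the
polynomials prime to `N` have a density `ρ`, and there is no error from degree `deg N` on. -/
theorem exists_density [Fintype k] {N : k[X]} (hN : N ≠ 0) : ∃ ρ : ℝ, 0 < ρ ∧ ρ ≤ 1 ∧
    1 ≤ ρ * numDiv N ∧
    (∀ l : ℕ, |(coprimeCount l N : ℝ) - (Fintype.card k : ℝ) ^ l * ρ| ≤ numDiv N) ∧
    (∀ l : ℕ, N.natDegree ≤ l → (coprimeCount l N : ℝ) = (Fintype.card k : ℝ) ^ l * ρ) := by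
  have hQ : (2 : ℝ) ≤ Fintype.card k := by exact_mod_cast Fintype.one_lt_card
  have hQ0 : (0 : ℝ) < Fintype.card k := by linarith
  revert hN
  induction N using UniqueFactorizationMonoid.induction_on_prime with
  | h₁ => exact fun h => absurd rfl h
  | h₂ N hu =>
    intro hN
    have h1 : ∀ l : ℕ, coprimeCount l N = Fintype.card k ^ l := by
      intro l
      rw [← ncard_degree_lt, coprimeCount]
      congr 1
      ext y
      exact ⟨fun h => h.1, fun h => ⟨h, 0, ↑(hu.unit⁻¹), by simp⟩⟩
    have h2 := one_le_numDiv hN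
    refine ⟨1, one_pos, le_rfl, ?_, ?_, ?_⟩
    · rw [one_mul]; exact_mod_cast h2
    · intro l
      rw [h1]
      push_cast
      simp
    · intro l _
      rw [h1]
      push_cast
      ring
  | h₃ N p hN hp ih =>
    intro hpN
    obtain ⟨ρ, h0, h1, h2, h3, h4⟩ := ih hN
    by_cases hd : p ∣ N
    · have hle : (numDiv N : ℝ) ≤ numDiv (p * N) := by
        exact_mod_cast numDiv_le_of_dvd hpN (dvd_mul_left N p)
      refine ⟨ρ, h0, h1, h2.trans (mul_le_mul_of_nonneg_left hle h0.le), ?_, ?_⟩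
      · intro l
        rw [coprimeCount_mul_of_dvd hd]
        exact (h3 l).trans hle
      · intro l hl
        rw [coprimeCount_mul_of_dvd hd]
        refine h4 l (le_trans ?_ hl)
        exact natDegree_le_of_dvd (dvd_mul_left N p) hpN
    · have hle : 2 * (numDiv N : ℝ) ≤ numDiv (p * N) := by
        exact_mod_cast two_mul_numDiv_le hp hN hd
      have hW : (1 : ℝ) ≤ numDiv N := by exact_mod_cast one_le_numDiv hN
      set δ := p.natDegree with hδ
      have hδ1 : 1 ≤ δ := Irreducible.natDegree_pos hp.irreducible
      set Q : ℝ := (Fintype.card k : ℝ) with hQd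
      have hQδ : 2 ≤ Q ^ δ := hQ.trans (le_self_pow₀ (by linarith) (by omega))
      have hi : (Q ^ δ)⁻¹ ≤ 1 / 2 := by
        rw [one_div]
        exact inv_anti₀ two_pos hQδ
      have hi0 : 0 < (Q ^ δ)⁻¹ := by positivity
      have hc : ∀ l : ℕ, (coprimeCount l (p * N) : ℝ)
          = coprimeCount l N - coprimeCount (l - δ) N := by
        intro l
        rw [coprimeCount_eq_add hp hd l]
        push_cast
        ring
      refine ⟨ρ * (1 - (Q ^ δ)⁻¹), mul_pos h0 (by linarith), ?_, ?_, ?_, ?_⟩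
      · nlinarith
      · have h5 : ρ / 2 ≤ ρ * (1 - (Q ^ δ)⁻¹) := by nlinarith
        calc (1 : ℝ) ≤ ρ * numDiv N := h2
          _ = ρ / 2 * (2 * numDiv N) := by ring
          _ ≤ ρ * (1 - (Q ^ δ)⁻¹) * numDiv (p * N) :=
            mul_le_mul h5 hle (by positivity) ((half_pos h0).le.trans h5)
      · intro l
        have h6 : |(coprimeCount (l - δ) N : ℝ) - Q ^ l * (Q ^ δ)⁻¹ * ρ| ≤ numDiv N := by
          by_cases hl : δ ≤ l
          · have := h3 (l - δ)
            rwa [pow_sub₀ Q hQ0.ne' hl] at this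
          · rw [Nat.sub_eq_zero_of_le (not_le.1 hl).le]
            have h7 : (coprimeCount 0 N : ℝ) ≤ 1 := by exact_mod_cast coprimeCount_zero_le N
            have h8 : Q ^ l * (Q ^ δ)⁻¹ ≤ 1 := by
              rw [← div_eq_mul_inv, div_le_one (by positivity)]
              exact pow_le_pow_right₀ (by linarith) (not_le.1 hl).le
            have h9 : 0 ≤ Q ^ l * (Q ^ δ)⁻¹ := by positivity
            have h10 : Q ^ l * (Q ^ δ)⁻¹ * ρ ≤ 1 := mul_le_one₀ h8 h0.le h1
            have h11 : 0 ≤ Q ^ l * (Q ^ δ)⁻¹ * ρ := by positivity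
            have h12 : (0 : ℝ) ≤ coprimeCount 0 N := Nat.cast_nonneg _
            rw [abs_le]
            constructor <;> linarith
        have h5 := h3 l
        rw [hc]
        rw [abs_le] at h5 h6 ⊢
        constructor <;> nlinarith
      · intro l hl
        rw [natDegree_mul hp.ne_zero hN] at hl
        rw [hc, h4 l (by omega), h4 (l - δ) (by omega), pow_sub₀ Q hQ0.ne' (by omega)]
        ring

/-- The proportion of residues mod `N` prime to `N` that have a representative of degree `< l`. -/
theorem abs_coprimeCount_div_sub_le [Fintype k] {N : k[X]} (hN : N ≠ 0) (l : ℕ) :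
    |(coprimeCount l N : ℝ) / coprimeCount N.natDegree N
        - (Fintype.card k : ℝ) ^ l / (Fintype.card k : ℝ) ^ N.natDegree|
      ≤ (numDiv N : ℝ) ^ 2 / (Fintype.card k : ℝ) ^ N.natDegree := by
  obtain ⟨ρ, h0, h1, h2, h3, h4⟩ := exists_density hN
  have hQ0 : (0 : ℝ) < Fintype.card k := by exact_mod_cast Fintype.card_pos
  have hQn : (0 : ℝ) < (Fintype.card k : ℝ) ^ N.natDegree := by positivity
  rw [h4 _ le_rfl]
  have e : (coprimeCount l N : ℝ) / ((Fintype.card k : ℝ) ^ N.natDegree * ρ)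
        - (Fintype.card k : ℝ) ^ l / (Fintype.card k : ℝ) ^ N.natDegree
      = ((coprimeCount l N : ℝ) - (Fintype.card k : ℝ) ^ l * ρ)
        / ((Fintype.card k : ℝ) ^ N.natDegree * ρ) := by
    field_simp
  rw [e, abs_div, abs_of_pos (mul_pos hQn h0), div_le_div_iff₀ (mul_pos hQn h0) hQn]
  calc |(coprimeCount l N : ℝ) - (Fintype.card k : ℝ) ^ l * ρ| * (Fintype.card k : ℝ) ^ N.natDegree
      ≤ numDiv N * (Fintype.card k : ℝ) ^ N.natDegree * 1 := by
        rw [mul_one]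
        gcongr
        exact h3 l
    _ ≤ numDiv N * (Fintype.card k : ℝ) ^ N.natDegree * (ρ * numDiv N) := by gcongr
    _ = _ := by ring

theorem exists_succ_le_mul_rpow {Q δ : ℝ} (hQ : 1 < Q) (hδ : 0 < δ) :
    ∃ C : ℝ, 1 ≤ C ∧ ∀ e : ℕ, (e : ℝ) + 1 ≤ C * Q ^ (δ * e) := by
  have hL : 0 < δ * Real.log Q := mul_pos hδ (Real.log_pos hQ)
  refine ⟨1 + (δ * Real.log Q)⁻¹, by linarith [inv_pos.2 hL], fun e => ?_⟩
  have h1 : 1 + e * (δ * Real.log Q) ≤ Q ^ (δ * e) := by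
    rw [Real.rpow_def_of_pos (by linarith), add_comm]
    convert Real.add_one_le_exp (e * (δ * Real.log Q)) using 2
    ring
  have h2 : (e : ℝ) + 1 ≤ (1 + (δ * Real.log Q)⁻¹) * (1 + e * (δ * Real.log Q)) := by
    have h3 : (δ * Real.log Q)⁻¹ * (e * (δ * Real.log Q)) = e := by
      rw [mul_comm, mul_assoc, mul_inv_cancel₀ hL.ne', mul_one]
    have h4 : 0 ≤ (e : ℝ) * (δ * Real.log Q) := by positivity
    have h5 : 0 < (δ * Real.log Q)⁻¹ := inv_pos.2 hL
    calc (e : ℝ) + 1 ≤ 1 + e * (δ * Real.log Q) + (δ * Real.log Q)⁻¹ + e := by linarith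
      _ = 1 + e * (δ * Real.log Q) + (δ * Real.log Q)⁻¹
          + (δ * Real.log Q)⁻¹ * (e * (δ * Real.log Q)) := by rw [h3]
      _ = _ := by ring
  exact h2.trans (mul_le_mul_of_nonneg_left h1 (by linarith [inv_pos.2 hL]))

/-- The divisor bound: the number of divisors of `N` is `O(|N| ^ δ)` for every `δ > 0`. A prime
power `p ^ e` contributes a factor `e + 1 ≤ 2 ^ e`, which is at most `|p ^ e| ^ δ` unless `p` is one
of the finitely many primes of small degree. -/
theorem exists_numDiv_le [Fintype k] {δ : ℝ} (hδ : 0 < δ) : ∃ C : ℝ, 1 ≤ C ∧ ∀ N : k[X], N ≠ 0 →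
    (numDiv N : ℝ) ≤ C * (Fintype.card k : ℝ) ^ (δ * N.natDegree) := by
  classical
  have hQ : (2 : ℝ) ≤ Fintype.card k := by exact_mod_cast Fintype.one_lt_card
  set Q : ℝ := (Fintype.card k : ℝ) with hQd
  have hQ0 : 0 < Q := by linarith
  obtain ⟨C, hC1, hC⟩ := exists_succ_le_mul_rpow (Q := Q) (by linarith) hδ
  obtain ⟨m, hm⟩ := exists_nat_ge δ⁻¹
  have hm2 : ∀ d : ℕ, m ≤ d → 2 ≤ Q ^ (δ * d) := by
    intro d hd
    have h1 : (1 : ℝ) ≤ δ * d := by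
      have : δ⁻¹ ≤ (d : ℝ) := hm.trans (by exact_mod_cast hd)
      calc (1 : ℝ) = δ * δ⁻¹ := by field_simp
        _ ≤ δ * d := by gcongr
    calc (2 : ℝ) ≤ Q := hQ
      _ = Q ^ (1 : ℝ) := (Real.rpow_one Q).symm
      _ ≤ Q ^ (δ * d) := Real.rpow_le_rpow_of_exponent_le (by linarith) h1
  set S : Finset k[X] := ((finite_degree_lt (k := k) m).toFinset).filter
    fun p => p.Monic ∧ Prime p with hS
  have key : ∀ N : k[X], N ≠ 0 →
      (numDiv N : ℝ) ≤ C ^ (S.filter (· ∣ N)).card * Q ^ (δ * N.natDegree) := by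
    intro N
    induction N using UniqueFactorizationMonoid.induction_on_coprime with
    | h0 => exact fun h => absurd rfl h
    | @h1 N hu =>
      intro hN
      have h1 : numDiv N ≤ 1 := by
        have h : {g : k[X] | g.Monic ∧ g ∣ N} ⊆ {1} := by
          rintro g ⟨hg, hd⟩
          exact hg.eq_one_of_isUnit (isUnit_of_dvd_unit hd hu)
        exact (Set.ncard_le_ncard h (Set.finite_singleton _)).trans (Set.ncard_singleton _).le
      calc (numDiv N : ℝ) ≤ 1 := by exact_mod_cast h1
        _ = 1 * 1 := (one_mul 1).symm
        _ ≤ _ := by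
          gcongr
          · exact one_le_pow₀ hC1
          · exact Real.one_le_rpow (by linarith) (by positivity)
    | @hpr p e hp =>
      intro hN
      have hle : (numDiv (p ^ e) : ℝ) ≤ e + 1 := by exact_mod_cast numDiv_prime_pow_le hp e
      rw [natDegree_pow]
      rcases Nat.eq_zero_or_pos e with rfl | he
      · refine hle.trans ?_
        simp only [Nat.cast_zero, zero_add, zero_mul, mul_zero, Real.rpow_zero, mul_one]
        exact one_le_pow₀ hC1
      by_cases hpm : p.natDegree < m
      · have hmem : normalize p ∈ S.filter (· ∣ p ^ e) := by
          rw [Finset.mem_filter, hS, Finset.mem_filter, Set.Finite.mem_toFinset]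
          refine ⟨⟨?_, monic_normalize hp.ne_zero,
            (normalize_associated p).symm.prime hp⟩, ?_⟩
          · change (normalize p).degree < m
            rw [degree_normalize, degree_eq_natDegree hp.ne_zero]
            exact_mod_cast hpm
          · exact (normalize_dvd_iff.2 dvd_rfl).trans (dvd_pow_self p he.ne')
        have hcard : 1 ≤ (S.filter (· ∣ p ^ e)).card := Finset.card_pos.2 ⟨_, hmem⟩
        refine hle.trans ((hC e).trans ?_)
        have hd : 1 ≤ p.natDegree := Irreducible.natDegree_pos hp.irreducible
        gcongr
        · exact le_self_pow₀ hC1 (by omega)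
        · linarith
        · exact_mod_cast Nat.le_mul_of_pos_right e hd
      · calc (numDiv (p ^ e) : ℝ) ≤ e + 1 := hle
          _ ≤ 2 ^ e := by exact_mod_cast Nat.lt_two_pow_self
          _ ≤ (Q ^ (δ * p.natDegree)) ^ e := by
            gcongr
            exact hm2 _ (not_lt.1 hpm)
          _ = 1 * Q ^ (δ * (e * p.natDegree : ℕ)) := by
            rw [one_mul, ← Real.rpow_natCast, ← Real.rpow_mul hQ0.le]
            push_cast
            ring_nf
          _ ≤ _ := by
            gcongr
            exact one_le_pow₀ hC1
    | @hcp x y hxy ihx ihy =>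
      intro hN
      have hx : x ≠ 0 := left_ne_zero_of_mul hN
      have hy : y ≠ 0 := right_ne_zero_of_mul hN
      have hcard : (S.filter (· ∣ x)).card + (S.filter (· ∣ y)).card
          ≤ (S.filter (· ∣ x * y)).card := by
        rw [← Finset.card_union_of_disjoint]
        · refine Finset.card_le_card (Finset.union_subset ?_ ?_)
          · exact Finset.monotone_filter_right S fun p _ hp => hp.mul_right y
          · exact Finset.monotone_filter_right S fun p _ hp => hp.mul_left x
        · rw [Finset.disjoint_left]
          intro p hp hp'
          rw [Finset.mem_filter] at hp hp'
          have hpr : Prime p := by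
            have := hp.1
            rw [hS, Finset.mem_filter] at this
            exact this.2.2
          exact hpr.not_isUnit (hxy hp.2 hp'.2)
      calc (numDiv (x * y) : ℝ) ≤ numDiv x * numDiv y := by exact_mod_cast numDiv_mul_le hx hy
        _ ≤ (C ^ (S.filter (· ∣ x)).card * Q ^ (δ * x.natDegree))
            * (C ^ (S.filter (· ∣ y)).card * Q ^ (δ * y.natDegree)) := by
          gcongr
          · exact ihx hx
          · exact ihy hy
        _ = C ^ ((S.filter (· ∣ x)).card + (S.filter (· ∣ y)).card)
            * Q ^ (δ * (x * y).natDegree) := by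
          rw [natDegree_mul hx hy, pow_add]
          push_cast
          rw [mul_add, Real.rpow_add hQ0]
          ring
        _ ≤ _ := by gcongr
  refine ⟨C ^ S.card, one_le_pow₀ hC1, fun N hN => (key N hN).trans ?_⟩
  gcongr
  exact Finset.filter_subset _ _

end Sieve

/-! ### Equidistribution of the points of small degree on the lines `u A + 𝔣 B` -/

section LineCount

variable {F : Type*} [Field F] (E : Type*) [Field E] [Algebra F E]

/-- The embedding of `A = F[X]` into `B = E[X]`. -/
def up : F[X] →+* E[X] := mapRingHom (algebraMap F E)

variable {E}

theorem up_injective : Function.Injective (up (F := F) E) :=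
  map_injective _ (algebraMap F E).injective

theorem natDegree_up (p : F[X]) : (up E p).natDegree = p.natDegree := natDegree_map _

theorem degree_up (p : F[X]) : (up E p).degree = p.degree := degree_map _ _

theorem up_dvd_up {p r : F[X]} : up E p ∣ up E r ↔ p ∣ r := map_dvd_map' (algebraMap F E)

theorem up_ne_zero {p : F[X]} (hp : p ≠ 0) : up E p ≠ 0 :=
  (map_ne_zero_iff _ up_injective).2 hp

theorem numDiv_le_numDiv_up [Finite E] {p : F[X]} (hp : p ≠ 0) : numDiv p ≤ numDiv (up E p) := by
  unfold numDiv
  rw [← Set.ncard_image_of_injective _ (up_injective (E := E))]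
  refine Set.ncard_le_ncard ?_ (finite_monic_dvd (up_ne_zero hp))
  rintro _ ⟨g, hg, rfl⟩
  exact ⟨hg.1.map _, up_dvd_up.2 hg.2⟩

variable (E) in
/-- The residue ring `B / 𝔣 B`. -/
abbrev ResRing (𝔣 : F[X]) : Type _ := E[X] ⧸ Ideal.span {up E 𝔣}

variable (E) in
/-- The projection of `B` to `B / 𝔣 B`. -/
abbrev res (𝔣 : F[X]) : E[X] →+* ResRing E 𝔣 := Ideal.Quotient.mk _

theorem res_eq_res {𝔣 : F[X]} {x y : E[X]} : res E 𝔣 x = res E 𝔣 y ↔ up E 𝔣 ∣ x - y := by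
  rw [Ideal.Quotient.mk_eq_mk_iff_sub_mem, Ideal.mem_span_singleton]

theorem res_eq_zero {𝔣 : F[X]} {x : E[X]} : res E 𝔣 x = 0 ↔ up E 𝔣 ∣ x := by
  rw [Ideal.Quotient.eq_zero_iff_mem, Ideal.mem_span_singleton]

theorem isUnit_res {𝔣 : F[X]} {x : E[X]} : IsUnit (res E 𝔣 x) ↔ IsCoprime x (up E 𝔣) := by
  constructor
  · intro h
    obtain ⟨y, hy⟩ := h.exists_right_inv
    obtain ⟨y, rfl⟩ := Ideal.Quotient.mk_surjective y
    rw [← map_mul, ← map_one (res E 𝔣), res_eq_res] at hy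
    obtain ⟨z, hz⟩ := hy
    exact ⟨y, -z, by linear_combination hz⟩
  · rintro ⟨a, b, h⟩
    refine IsUnit.of_mul_eq_one (res E 𝔣 a) ?_
    rw [← map_mul, ← map_one (res E 𝔣), res_eq_res]
    exact ⟨-b, by linear_combination h⟩

theorem finite_resRing [Finite E] {𝔣 : F[X]} (h𝔣 : 𝔣.Monic) : Finite (ResRing E 𝔣) := by
  have hm : (up E 𝔣).Monic := h𝔣.map _
  refine Set.finite_univ_iff.1 (((finite_degree_lt (k := E) 𝔣.natDegree).image (res E 𝔣)).subset ?_)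
  intro x _
  obtain ⟨x, rfl⟩ := Ideal.Quotient.mk_surjective x
  refine ⟨x %ₘ up E 𝔣, ?_, ?_⟩
  · have := degree_modByMonic_lt x hm
    rwa [degree_up, degree_eq_natDegree h𝔣.ne_zero] at this
  · rw [res_eq_res]
    exact ⟨-(x /ₘ up E 𝔣), by linear_combination modByMonic_add_div x (up E 𝔣)⟩

/-- The lattice `u A + 𝔣 B` of a unit `u` of `B / 𝔣 B`. -/
def lineLat {𝔣 : F[X]} (u : (ResRing E 𝔣)ˣ) : AddSubgroup E[X] where
  carrier := {x | ∃ c : F[X], res E 𝔣 x = res E 𝔣 (up E c) * u}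
  zero_mem' := ⟨0, by simp⟩
  add_mem' := by
    rintro x y ⟨c, hc⟩ ⟨d, hd⟩
    exact ⟨c + d, by rw [map_add, hc, hd, map_add, map_add, add_mul]⟩
  neg_mem' := by
    rintro x ⟨c, hc⟩
    exact ⟨-c, by rw [map_neg, hc, map_neg, map_neg]; ring⟩

theorem mem_lineLat {𝔣 : F[X]} {u : (ResRing E 𝔣)ˣ} {x : E[X]} :
    x ∈ lineLat u ↔ ∃ c : F[X], res E 𝔣 x = res E 𝔣 (up E c) * u := Iff.rfl

/-- Residues prime to `N` lift to residues prime to `N g`. -/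
theorem exists_isCoprime_add_mul {k : Type*} [Field k] {N v g : k[X]} (hv : IsCoprime v N)
    (hg : g ≠ 0) : ∃ t, IsCoprime (v + N * t) (N * g) := by
  revert hg
  induction g using UniqueFactorizationMonoid.induction_on_prime with
  | h₁ => exact fun h => absurd rfl h
  | h₂ g hu =>
    refine fun _ => ⟨0, ?_⟩
    rw [mul_zero, add_zero]
    exact (isCoprime_mul_unit_right_right hu v N).2 hv
  | h₃ g p hg hp ih =>
    intro _
    obtain ⟨t, ht⟩ := ih hg
    have hirr := hp.irreducible
    have e : N * (p * g) = p * (N * g) := by ring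
    rw [e]
    by_cases hd : p ∣ v + N * t
    · refine ⟨t + g, IsCoprime.mul_right ?_ ?_⟩
      · refine ((Irreducible.coprime_iff_not_dvd hirr).2 fun h => ?_).symm
        have h2 : p ∣ N * g := by
          have h3 : N * g = v + N * (t + g) - (v + N * t) := by ring
          rw [h3]
          exact dvd_sub h hd
        exact hp.not_isUnit (ht.isUnit_of_dvd' hd h2)
      · have e2 : v + N * (t + g) = v + N * t + N * g * 1 := by ring
        rw [e2]
        exact IsCoprime.add_mul_left_left ht 1
    · exact ⟨t, IsCoprime.mul_right ((Irreducible.coprime_iff_not_dvd hirr).2 hd).symm ht⟩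

/-- The polynomials in the orbit of a residue `c = g c'` with `gcd(c, 𝔣) = g` are the `g y` with `y`
prime to `𝔣 / g`. -/
theorem ncard_orbit {g N c' : F[X]} (hg : g ≠ 0) (hc : IsCoprime c' N) (L : ℕ) :
    {x : E[X] | x.degree < L ∧ ∃ u : (ResRing E (g * N))ˣ,
      res E (g * N) x = res E (g * N) (up E (g * c')) * u}.ncard
      = coprimeCount (L - g.natDegree) (up E N) := by
  have hc2 : IsCoprime (up E c') (up E N) := hc.map (up E)
  have hg2 : up E g ≠ 0 := up_ne_zero hg
  have h : {x : E[X] | x.degree < L ∧ ∃ u : (ResRing E (g * N))ˣ,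
      res E (g * N) x = res E (g * N) (up E (g * c')) * u} = (fun y => up E g * y) ''
      {y : E[X] | y.degree < (L - g.natDegree : ℕ) ∧ IsCoprime y (up E N)} := by
    ext x
    constructor
    · rintro ⟨hx, u, hu⟩
      obtain ⟨v, hv⟩ := Ideal.Quotient.mk_surjective u.1
      have hvc : IsCoprime v (up E (g * N)) := isUnit_res.1 (hv ▸ u.isUnit)
      rw [map_mul] at hvc
      rw [← hv, ← map_mul, res_eq_res] at hu
      obtain ⟨b, hb⟩ := hu
      rw [map_mul, map_mul] at hb
      have hx2 : x = up E g * (up E c' * v + up E N * b) := by linear_combination hb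
      refine ⟨up E c' * v + up E N * b, ⟨?_, ?_⟩, hx2.symm⟩
      · rw [hx2, degree_mul_lt_iff hg2, natDegree_up] at hx
        exact hx
      · exact IsCoprime.add_mul_left_left (hc2.mul_left hvc.of_mul_right_right) b
    · rintro ⟨y, ⟨hy, hyc⟩, rfl⟩
      refine ⟨?_, ?_⟩
      · change (up E g * y).degree < L
        rw [degree_mul_lt_iff hg2, natDegree_up]
        exact hy
      · obtain ⟨s, t, hst⟩ := hc2
        have hs : IsCoprime s (up E N) := ⟨up E c', t, by linear_combination hst⟩
        obtain ⟨r, hr⟩ := exists_isCoprime_add_mul (hs.mul_left hyc) hg2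
        rw [mul_comm (up E N) (up E g), ← map_mul] at hr
        refine ⟨(isUnit_res.2 hr).unit, ?_⟩
        rw [IsUnit.unit_spec, ← map_mul, res_eq_res, map_mul, map_mul]
        exact ⟨y * t - up E c' * r, by linear_combination (-up E g * y) * hst⟩
  rw [h, Set.ncard_image_of_injective _ (mul_right_injective₀ hg2)]
  rfl

open scoped Classical in
/-- The polynomials of degree `< L`. -/
def polysLT (k : Type*) [Field k] [Finite k] (L : ℕ) : Finset k[X] :=
  (finite_degree_lt (k := k) L).toFinset

theorem mem_polysLT {k : Type*} [Field k] [Finite k] {L : ℕ} {x : k[X]} :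
    x ∈ polysLT k L ↔ x.degree < L := by
  rw [polysLT, Set.Finite.mem_toFinset]
  rfl

theorem card_polysLT {k : Type*} [Field k] [Fintype k] (L : ℕ) :
    (polysLT k L).card = Fintype.card k ^ L := by
  rw [← ncard_degree_lt (k := k), ← Set.ncard_coe_finset]
  congr 1
  ext x
  exact mem_polysLT

open scoped Classical in
/-- Summing over the orbit of a residue `c` under the unit group: each element of the orbit is hit
equally often. -/
theorem sum_card_orbit {R : Type*} [CommRing R] [Fintype Rˣ] {α : Type*} (X : Finset α) (π : α → R)
    (c : R) : ∑ u : Rˣ, (X.filter fun x => π x = c * u).card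
      = (Finset.univ.filter fun u : Rˣ => c * u = c).card
        * (X.filter fun x => ∃ u : Rˣ, π x = c * u).card := by
  have h1 : ∑ u : Rˣ, (X.filter fun x => π x = c * u).card
      = ∑ x ∈ X, (Finset.univ.filter fun u : Rˣ => π x = c * u).card := by
    simp only [Finset.card_filter]
    exact Finset.sum_comm
  rw [h1, mul_comm, ← smul_eq_mul, ← Finset.sum_const, ← Finset.sum_filter_add_sum_filter_not X
    (fun x => ∃ u : Rˣ, π x = c * u)]
  have h2 : ∑ x ∈ X.filter (fun x => ¬ ∃ u : Rˣ, π x = c * u),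
      (Finset.univ.filter fun u : Rˣ => π x = c * u).card = 0 := by
    refine Finset.sum_eq_zero fun x hx => ?_
    rw [Finset.mem_filter] at hx
    rw [Finset.card_eq_zero, Finset.filter_eq_empty_iff]
    exact fun u _ h => hx.2 ⟨u, h⟩
  rw [h2, add_zero]
  refine Finset.sum_congr rfl fun x hx => ?_
  rw [Finset.mem_filter] at hx
  obtain ⟨-, w, hw⟩ := hx
  refine Finset.card_bij (fun u _ => u * w⁻¹) ?_ ?_ ?_
  · intro u hu
    rw [Finset.mem_filter] at hu ⊢
    refine ⟨Finset.mem_univ _, ?_⟩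
    rw [Units.val_mul, ← mul_assoc, ← hu.2, hw, mul_assoc, Units.mul_inv, mul_one]
  · intro u _ v _ h
    exact mul_right_cancel h
  · intro u hu
    rw [Finset.mem_filter] at hu
    refine ⟨u * w, ?_, by rw [mul_assoc, mul_inv_cancel, mul_one]⟩
    rw [Finset.mem_filter]
    refine ⟨Finset.mem_univ _, ?_⟩
    rw [Units.val_mul, ← mul_assoc, hu.2, hw]

end LineCount

section LineAverage

variable {F : Type*} [Field F] {E : Type*} [Field E] [Algebra F E]

theorem exists_monic_gcd (c : F[X]) {𝔣 : F[X]} (h𝔣 : 𝔣 ≠ 0) : ∃ g c' N : F[X], g.Monic ∧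
    c = g * c' ∧ 𝔣 = g * N ∧ IsCoprime c' N := by
  classical
  obtain ⟨g, hg⟩ : ∃ g, g = EuclideanDomain.gcd c 𝔣 := ⟨_, rfl⟩
  have hg0 : g ≠ 0 := fun h => h𝔣 (EuclideanDomain.gcd_eq_zero_iff.1 (hg.symm.trans h)).2
  obtain ⟨a, ha⟩ := EuclideanDomain.gcd_dvd_left c 𝔣
  obtain ⟨b, hb⟩ := EuclideanDomain.gcd_dvd_right c 𝔣
  have h := EuclideanDomain.gcd_eq_gcd_ab c 𝔣
  rw [← hg] at ha hb h
  obtain ⟨A, hA⟩ : ∃ A, A = EuclideanDomain.gcdA c 𝔣 := ⟨_, rfl⟩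
  obtain ⟨B, hB⟩ : ∃ B, B = EuclideanDomain.gcdB c 𝔣 := ⟨_, rfl⟩
  rw [← hA, ← hB, ha, hb] at h
  have h1 : A * a + B * b = 1 := by
    apply mul_left_cancel₀ hg0
    linear_combination -h
  have hl : g.leadingCoeff ≠ 0 := leadingCoeff_ne_zero.2 hg0
  have hC : C g.leadingCoeff * C g.leadingCoeff⁻¹ = (1 : F[X]) := by
    rw [← C_mul, mul_inv_cancel₀ hl, C_1]
  refine ⟨g * C g.leadingCoeff⁻¹, C g.leadingCoeff * a, C g.leadingCoeff * b,
    monic_mul_leadingCoeff_inv hg0, ?_, ?_, ?_⟩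
  · linear_combination ha - g * a * hC
  · linear_combination hb - g * b * hC
  · exact ⟨A * C g.leadingCoeff⁻¹, B * C g.leadingCoeff⁻¹, by
      linear_combination h1 + (A * a + B * b) * hC⟩

variable [Fintype F]

open scoped Classical in
theorem card_multiples {h : F[X]} (hh : h ≠ 0) (d : ℕ) :
    ((polysLT F d).filter fun c => h ∣ c).card = Fintype.card F ^ (d - h.natDegree) := by
  rw [← card_polysLT]
  symm
  refine Finset.card_bij (fun y _ => h * y) ?_ ?_ ?_
  · intro y hy
    rw [Finset.mem_filter, mem_polysLT, degree_mul_lt_iff hh]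
    exact ⟨mem_polysLT.1 hy, dvd_mul_right h y⟩
  · intro y _ z _ hyz
    exact mul_left_cancel₀ hh hyz
  · intro c hc
    rw [Finset.mem_filter, mem_polysLT] at hc
    obtain ⟨hc, y, rfl⟩ := hc
    exact ⟨y, mem_polysLT.2 ((degree_mul_lt_iff hh d).1 hc), rfl⟩

/-- A sum over residues of a quantity that is at most `|gcd(c, 𝔣)| / |𝔣|` is at most the number of
divisors of `𝔣`. -/
theorem sum_le_numDiv {𝔣 : F[X]} (h𝔣 : 𝔣 ≠ 0) {w : F[X] → ℝ} {S : Finset F[X]}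
    (hS : S ⊆ polysLT F 𝔣.natDegree)
    (hw : ∀ c ∈ S, ∃ g : F[X], g.Monic ∧ g ∣ c ∧ g ∣ 𝔣 ∧
      w c ≤ (Fintype.card F : ℝ) ^ g.natDegree / (Fintype.card F : ℝ) ^ 𝔣.natDegree) :
    ∑ c ∈ S, w c ≤ numDiv 𝔣 := by
  classical
  have hQ0 : (0 : ℝ) < Fintype.card F := by exact_mod_cast Fintype.card_pos
  set Q : ℝ := (Fintype.card F : ℝ) with hQ
  set G := (finite_monic_dvd h𝔣).toFinset with hG
  have hGc : numDiv 𝔣 = G.card := by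
    rw [numDiv, ← Set.ncard_coe_finset, hG, Set.Finite.coe_toFinset]
  have hmem : ∀ g, g ∈ G ↔ g.Monic ∧ g ∣ 𝔣 := by
    intro g
    rw [hG, Set.Finite.mem_toFinset]
    rfl
  calc ∑ c ∈ S, w c
      ≤ ∑ c ∈ S, ∑ g ∈ G, if g ∣ c then Q ^ g.natDegree / Q ^ 𝔣.natDegree else 0 := by
        refine Finset.sum_le_sum fun c hc => ?_
        obtain ⟨g, hg, hgc, hgf, hle⟩ := hw c hc
        refine hle.trans ?_
        have := Finset.single_le_sum
          (f := fun g => if g ∣ c then Q ^ g.natDegree / Q ^ 𝔣.natDegree else 0)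
          (fun g _ => by positivity) ((hmem g).2 ⟨hg, hgf⟩)
        rwa [if_pos hgc] at this
    _ ≤ ∑ c ∈ polysLT F 𝔣.natDegree, ∑ g ∈ G,
          if g ∣ c then Q ^ g.natDegree / Q ^ 𝔣.natDegree else 0 := by
        refine Finset.sum_le_sum_of_subset_of_nonneg hS fun c _ _ => ?_
        exact Finset.sum_nonneg fun g _ => by positivity
    _ = ∑ g ∈ G, ∑ c ∈ polysLT F 𝔣.natDegree,
          if g ∣ c then Q ^ g.natDegree / Q ^ 𝔣.natDegree else 0 := Finset.sum_comm
    _ = ∑ g ∈ G, 1 := by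
        refine Finset.sum_congr rfl fun g hg => ?_
        obtain ⟨hg, hgf⟩ := (hmem g).1 hg
        rw [← Finset.sum_filter, Finset.sum_const, card_multiples hg.ne_zero, nsmul_eq_mul]
        push_cast
        rw [← hQ, pow_sub₀ Q hQ0.ne' (natDegree_le_of_dvd hgf h𝔣)]
        field_simp
    _ = numDiv 𝔣 := by rw [hGc]; simp

variable [Fintype E]

open scoped Classical in
/-- Every residue mod `𝔣` has exactly one representative of degree `< deg 𝔣`. -/
theorem card_fiber_eq_one {𝔣 : F[X]} (h𝔣 : 𝔣.Monic) (ρ : ResRing E 𝔣) :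
    ((polysLT E 𝔣.natDegree).filter fun x => res E 𝔣 x = ρ).card = 1 := by
  rw [Finset.card_eq_one]
  obtain ⟨v, rfl⟩ := Ideal.Quotient.mk_surjective ρ
  have hm : (up E 𝔣).Monic := h𝔣.map _
  refine ⟨v %ₘ up E 𝔣, Finset.eq_singleton_iff_unique_mem.2 ⟨?_, ?_⟩⟩
  · rw [Finset.mem_filter, mem_polysLT]
    refine ⟨?_, ?_⟩
    · have := degree_modByMonic_lt v hm
      rwa [degree_up, degree_eq_natDegree h𝔣.ne_zero] at this
    · exact res_eq_res.2 ⟨-(v /ₘ up E 𝔣), by linear_combination modByMonic_add_div v (up E 𝔣)⟩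
  · intro x hx
    rw [Finset.mem_filter, mem_polysLT] at hx
    obtain ⟨hx1, hx2⟩ := hx
    have hx3 : v = x + up E 𝔣 * -((x - v) /ₘ up E 𝔣) := by
      obtain ⟨b, hb⟩ := res_eq_res.1 hx2
      rw [hb, mul_divByMonic_cancel_left _ hm]
      linear_combination -hb
    have hx4 : x.degree < (up E 𝔣).degree := by
      rw [degree_up, degree_eq_natDegree h𝔣.ne_zero]
      exact hx1
    exact ((div_modByMonic_unique _ _ hm ⟨hx3.symm, hx4⟩).2).symm

open scoped Classical in
/-- The number of points of degree `< L` over a fixed residue `c`, averaged over the lines. -/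
theorem abs_orbit_average_sub_le (hE : Fintype.card E = Fintype.card F ^ 2) {𝔣 : F[X]}
    (h𝔣 : 𝔣.Monic) [Fintype (ResRing E 𝔣)ˣ] (L : ℕ) {c : F[X]} (hc0 : c ≠ 0)
    (hc : c.degree < 𝔣.natDegree) : ∃ g : F[X], g.Monic ∧ g ∣ c ∧ g ∣ 𝔣 ∧
    |((∑ u : (ResRing E 𝔣)ˣ,
        ((polysLT E L).filter fun x => res E 𝔣 x = res E 𝔣 (up E c) * u).card : ℕ) : ℝ)
        / Fintype.card (ResRing E 𝔣)ˣ
      - ((Fintype.card F : ℝ) ^ L / (Fintype.card F : ℝ) ^ 𝔣.natDegree) ^ 2|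
    ≤ (numDiv (up E 𝔣) : ℝ) ^ 2
      * ((Fintype.card F : ℝ) ^ L / (Fintype.card F : ℝ) ^ 𝔣.natDegree)
      * ((Fintype.card F : ℝ) ^ g.natDegree / (Fintype.card F : ℝ) ^ 𝔣.natDegree) := by
  have hQ1 : (1 : ℝ) < Fintype.card F := by exact_mod_cast Fintype.one_lt_card
  have hEQ : (Fintype.card E : ℝ) = (Fintype.card F : ℝ) ^ 2 := by exact_mod_cast hE
  set Q : ℝ := (Fintype.card F : ℝ) with hQ
  have hQ0 : 0 < Q := by linarith
  obtain ⟨g, c', N, hg, rfl, rfl, hcN⟩ := exists_monic_gcd c h𝔣.ne_zero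
  have hN0 : N ≠ 0 := right_ne_zero_of_mul h𝔣.ne_zero
  have hNu : up E N ≠ 0 := up_ne_zero hN0
  refine ⟨g, hg, dvd_mul_right _ _, dvd_mul_right _ _, ?_⟩
  have hdeg : (g * N).natDegree = g.natDegree + N.natDegree := natDegree_mul hg.ne_zero hN0
  have hn1 : 1 ≤ N.natDegree := by
    by_contra hlt
    have h1 : g.natDegree ≤ (g * c').natDegree := natDegree_le_of_dvd (dvd_mul_right g c') hc0
    rw [degree_eq_natDegree hc0] at hc
    have h2 : (g * c').natDegree < (g * N).natDegree := by exact_mod_cast hc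
    omega
  -- counting over an orbit, for an arbitrary degree bound
  have key : ∀ M : ℕ, (∑ u : (ResRing E (g * N))ˣ, ((polysLT E M).filter fun x =>
      res E (g * N) x = res E (g * N) (up E (g * c')) * u).card)
      = (Finset.univ.filter fun u : (ResRing E (g * N))ˣ =>
          res E (g * N) (up E (g * c')) * u = res E (g * N) (up E (g * c'))).card
        * coprimeCount (M - g.natDegree) (up E N) := by
    intro M
    rw [sum_card_orbit, ← ncard_orbit hg.ne_zero hcN]
    congr 1
    rw [← Set.ncard_coe_finset, Finset.coe_filter]
    simp only [mem_polysLT]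
  -- every unit contributes exactly one polynomial of degree `< deg 𝔣`
  have hU : Fintype.card (ResRing E (g * N))ˣ
      = (Finset.univ.filter fun u : (ResRing E (g * N))ˣ =>
          res E (g * N) (up E (g * c')) * u = res E (g * N) (up E (g * c'))).card
        * coprimeCount N.natDegree (up E N) := by
    have h1 := key (g * N).natDegree
    rw [hdeg, Nat.add_sub_cancel_left] at h1
    rw [← h1, ← hdeg, ← Finset.card_univ, Finset.card_eq_sum_ones]
    refine Finset.sum_congr rfl fun u _ => ?_
    exact (card_fiber_eq_one h𝔣 _).symm
  have hk : (Finset.univ.filter fun u : (ResRing E (g * N))ˣ =>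
      res E (g * N) (up E (g * c')) * u = res E (g * N) (up E (g * c'))).card ≠ 0 := by
    rw [Finset.card_ne_zero]
    exact ⟨1, by simp⟩
  rw [key L, hU]
  push_cast
  rw [mul_div_mul_left _ _ (by exact_mod_cast hk)]
  have hW : (1 : ℝ) ≤ (numDiv (up E (g * N)) : ℝ) := by
    exact_mod_cast one_le_numDiv (up_ne_zero h𝔣.ne_zero)
  have hWN : (numDiv (up E N) : ℝ) ≤ numDiv (up E (g * N)) := by
    exact_mod_cast numDiv_le_of_dvd (up_ne_zero h𝔣.ne_zero) (up_dvd_up.2 (dvd_mul_left N g))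
  rcases le_or_gt g.natDegree L with hL | hL
  · have h1 := abs_coprimeCount_div_sub_le hNu (L - g.natDegree)
    rw [natDegree_up, hEQ] at h1
    have e1 : (Q ^ L / Q ^ (g * N).natDegree) ^ 2
        = (Q ^ 2) ^ (L - g.natDegree) / (Q ^ 2) ^ N.natDegree := by
      rw [pow_sub₀ _ (by positivity) hL, hdeg]
      field_simp
      ring
    rw [e1]
    refine h1.trans ?_
    calc (numDiv (up E N) : ℝ) ^ 2 / (Q ^ 2) ^ N.natDegree
        ≤ (numDiv (up E (g * N)) : ℝ) ^ 2 / (Q ^ 2) ^ N.natDegree := by gcongr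
      _ = (numDiv (up E (g * N)) : ℝ) ^ 2 * (1 / (Q ^ 2) ^ N.natDegree) := by ring
      _ ≤ (numDiv (up E (g * N)) : ℝ) ^ 2 * (Q ^ L / Q ^ (g * N).natDegree
          * (Q ^ g.natDegree / Q ^ (g * N).natDegree)) := by
        gcongr
        rw [hdeg, div_mul_div_comm, div_le_div_iff₀ (by positivity) (by positivity)]
        have h3 : Q ^ g.natDegree ≤ Q ^ L := pow_le_pow_right₀ hQ1.le hL
        calc 1 * (Q ^ (g.natDegree + N.natDegree) * Q ^ (g.natDegree + N.natDegree))
            = Q ^ g.natDegree * (Q ^ g.natDegree * (Q ^ 2) ^ N.natDegree) := by ring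
          _ ≤ Q ^ L * (Q ^ g.natDegree * (Q ^ 2) ^ N.natDegree) := by gcongr
          _ = Q ^ L * Q ^ g.natDegree * (Q ^ 2) ^ N.natDegree := by ring
      _ = _ := by ring
  · rw [Nat.sub_eq_zero_of_le hL.le]
    have h0 : coprimeCount 0 (up E N) = 0 := by
      rw [coprimeCount, Set.ncard_eq_zero (finite_coprime _ _)]
      ext y
      constructor
      · rintro ⟨hy, hcop⟩
        have hy0 : y = 0 := by
          by_contra h
          exact absurd hy (not_lt.2 (zero_le_degree_iff.2 h))
        rw [hy0, isCoprime_zero_left] at hcop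
        have := natDegree_eq_zero_of_isUnit hcop
        rw [natDegree_up] at this
        omega
      · exact fun h => h.elim
    rw [h0, Nat.cast_zero, zero_div, zero_sub, abs_neg, abs_of_nonneg (by positivity)]
    have h2 : Q ^ L ≤ Q ^ g.natDegree := pow_le_pow_right₀ hQ1.le hL.le
    calc (Q ^ L / Q ^ (g * N).natDegree) ^ 2
        = 1 * (Q ^ L / Q ^ (g * N).natDegree) * (Q ^ L / Q ^ (g * N).natDegree) := by ring
      _ ≤ _ := by
        gcongr
        exact one_le_pow₀ hW

open scoped Classical in
theorem card_lineLat_eq_sum {𝔣 : F[X]} (h𝔣 : 𝔣.Monic) (u : (ResRing E 𝔣)ˣ) (L : ℕ) :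
    ((polysLT E L).filter (· ∈ lineLat u)).card = ∑ c ∈ polysLT F 𝔣.natDegree,
      ((polysLT E L).filter fun x => res E 𝔣 x = res E 𝔣 (up E c) * u).card := by
  rw [← Finset.card_biUnion]
  · congr 1
    ext x
    rw [Finset.mem_filter, Finset.mem_biUnion]
    constructor
    · rintro ⟨hx, c, hc⟩
      refine ⟨c %ₘ 𝔣, ?_, Finset.mem_filter.2 ⟨hx, ?_⟩⟩
      · rw [mem_polysLT, ← degree_eq_natDegree h𝔣.ne_zero]
        exact degree_modByMonic_lt c h𝔣
      · rw [hc]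
        congr 1
        refine res_eq_res.2 ⟨up E (c /ₘ 𝔣), ?_⟩
        rw [← map_sub, ← map_mul]
        congr 1
        linear_combination -modByMonic_add_div c 𝔣
    · rintro ⟨c, -, hx⟩
      rw [Finset.mem_filter] at hx
      exact ⟨hx.1, c, hx.2⟩
  · intro c hc c' hc' hne
    rw [Function.onFun, Finset.disjoint_left]
    intro x hx hx'
    rw [Finset.mem_filter] at hx hx'
    apply hne
    have h1 : res E 𝔣 (up E c) = res E 𝔣 (up E c') :=
      u.isUnit.mul_right_cancel (hx.2.symm.trans hx'.2)
    rw [res_eq_res, ← map_sub, up_dvd_up] at h1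
    rw [Finset.mem_coe, mem_polysLT, ← degree_eq_natDegree h𝔣.ne_zero] at hc hc'
    exact sub_eq_zero.1 (eq_zero_of_dvd_of_degree_lt h1
      ((degree_sub_le c c').trans_lt (max_lt hc hc')))

open scoped Classical in
/-- The average over `u` of the number of points of degree `< L` of `u A + 𝔣 B`. The terms are `1`
for the origin and `q ^ (2 L - d)` for the other points, `d = deg 𝔣`, up to an error
`O(q ^ (L - d) |𝔣| ^ ε)`. -/
theorem abs_average_sub_le (hE : Fintype.card E = Fintype.card F ^ 2) {𝔣 : F[X]}
    (h𝔣 : 𝔣.Monic) [Fintype (ResRing E 𝔣)ˣ] {L : ℕ} (hL : L ≤ 𝔣.natDegree) :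
    |((∑ u : (ResRing E 𝔣)ˣ, ((polysLT E L).filter (· ∈ lineLat u)).card : ℕ) : ℝ)
        / Fintype.card (ResRing E 𝔣)ˣ - 1
      - (Fintype.card F : ℝ) ^ (2 * L) / (Fintype.card F : ℝ) ^ 𝔣.natDegree|
    ≤ 2 * (numDiv (up E 𝔣) : ℝ) ^ 3
      * ((Fintype.card F : ℝ) ^ L / (Fintype.card F : ℝ) ^ 𝔣.natDegree) := by
  have hQ1 : (1 : ℝ) < Fintype.card F := by exact_mod_cast Fintype.one_lt_card
  have havg := fun (c : F[X]) (hc0 : c ≠ 0) (hc : c.degree < 𝔣.natDegree) =>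
    abs_orbit_average_sub_le hE h𝔣 L hc0 hc
  have hcardF : (((polysLT F 𝔣.natDegree).card : ℕ) : ℝ)
      = (Fintype.card F : ℝ) ^ 𝔣.natDegree := by
    rw [card_polysLT, Nat.cast_pow]
  set Q : ℝ := (Fintype.card F : ℝ) with hQ
  have hQ0 : 0 < Q := by linarith
  set d := 𝔣.natDegree with hd
  set U : ℝ := (Fintype.card (ResRing E 𝔣)ˣ : ℝ) with hU
  have hU0 : 0 < U := by
    rw [hU]
    exact_mod_cast Fintype.card_pos
  set W : ℝ := (numDiv (up E 𝔣) : ℝ) with hWd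
  have hW : (1 : ℝ) ≤ W := by
    rw [hWd]
    exact_mod_cast one_le_numDiv (up_ne_zero h𝔣.ne_zero)
  set t : F[X] → ℝ := fun c => ((∑ u : (ResRing E 𝔣)ˣ,
    ((polysLT E L).filter fun x => res E 𝔣 x = res E 𝔣 (up E c) * u).card : ℕ) : ℝ) / U with ht
  have h0mem : (0 : F[X]) ∈ polysLT F d := by
    rw [mem_polysLT, degree_zero]
    exact WithBot.bot_lt_coe d
  have ht0 : t 0 = 1 := by
    have h1 : ∀ u : (ResRing E 𝔣)ˣ,
        ((polysLT E L).filter fun x => res E 𝔣 x = res E 𝔣 (up E (0 : F[X])) * u).card = 1 := by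
      intro u
      rw [Finset.card_eq_one]
      refine ⟨0, Finset.eq_singleton_iff_unique_mem.2 ⟨?_, ?_⟩⟩
      · rw [Finset.mem_filter, mem_polysLT, degree_zero]
        exact ⟨WithBot.bot_lt_coe L, by simp⟩
      · intro x hx
        rw [Finset.mem_filter, mem_polysLT, map_zero, map_zero, zero_mul, res_eq_zero] at hx
        refine eq_zero_of_dvd_of_degree_lt hx.2 (hx.1.trans_le ?_)
        rw [degree_up, degree_eq_natDegree h𝔣.ne_zero]
        exact_mod_cast hL
    rw [ht]
    simp only [h1]
    rw [Finset.sum_const, Finset.card_univ, smul_eq_mul, mul_one]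
    exact div_self hU0.ne'
  have hsum : ((∑ u : (ResRing E 𝔣)ˣ, ((polysLT E L).filter (· ∈ lineLat u)).card : ℕ) : ℝ) / U
      = 1 + ∑ c ∈ (polysLT F d).erase 0, t c := by
    have h1 : (∑ u : (ResRing E 𝔣)ˣ, ((polysLT E L).filter (· ∈ lineLat u)).card)
        = ∑ c ∈ polysLT F d, ∑ u : (ResRing E 𝔣)ˣ,
          ((polysLT E L).filter fun x => res E 𝔣 x = res E 𝔣 (up E c) * u).card := by
      rw [Finset.sum_comm]
      exact Finset.sum_congr rfl fun u _ => card_lineLat_eq_sum h𝔣 u L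
    rw [h1, Nat.cast_sum, Finset.sum_div, ← Finset.add_sum_erase _ _ h0mem]
    exact congrArg (· + _) ht0
  have herr : ∑ c ∈ (polysLT F d).erase 0, |t c - (Q ^ L / Q ^ d) ^ 2|
      ≤ W ^ 3 * (Q ^ L / Q ^ d) := by
    have h1 : ∑ c ∈ (polysLT F d).erase 0, |t c - (Q ^ L / Q ^ d) ^ 2| / (W ^ 2 * (Q ^ L / Q ^ d))
        ≤ numDiv 𝔣 := by
      refine sum_le_numDiv h𝔣.ne_zero (Finset.erase_subset _ _) fun c hc => ?_
      rw [Finset.mem_erase, mem_polysLT] at hc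
      obtain ⟨g, hg, hgc, hgf, hle⟩ := havg c hc.1 hc.2
      refine ⟨g, hg, hgc, hgf, ?_⟩
      rw [div_le_iff₀ (by positivity), mul_comm (_ / _) (W ^ 2 * _)]
      exact hle
    rw [← Finset.sum_div, div_le_iff₀ (by positivity)] at h1
    refine h1.trans ?_
    have h2 : (numDiv 𝔣 : ℝ) ≤ W := by
      rw [hWd]
      exact_mod_cast numDiv_le_numDiv_up h𝔣.ne_zero
    calc (numDiv 𝔣 : ℝ) * (W ^ 2 * (Q ^ L / Q ^ d)) ≤ W * (W ^ 2 * (Q ^ L / Q ^ d)) := by gcongr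
      _ = _ := by ring
  have hcard : ∑ c ∈ (polysLT F d).erase 0, (Q ^ L / Q ^ d) ^ 2
      = Q ^ (2 * L) / Q ^ d - (Q ^ L / Q ^ d) ^ 2 := by
    rw [Finset.sum_erase_eq_sub h0mem, Finset.sum_const, nsmul_eq_mul, hcardF]
    congr 1
    field_simp
    ring
  have hsmall : (Q ^ L / Q ^ d) ^ 2 ≤ W ^ 3 * (Q ^ L / Q ^ d) := by
    have h1 : Q ^ L / Q ^ d ≤ 1 := by
      rw [div_le_one (by positivity)]
      exact pow_le_pow_right₀ hQ1.le hL
    have h2 : 0 < Q ^ L / Q ^ d := by positivity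
    rw [sq]
    exact mul_le_mul_of_nonneg_right (h1.trans (one_le_pow₀ hW)) h2.le
  rw [hsum]
  have h2 : 1 + ∑ c ∈ (polysLT F d).erase 0, t c - 1 - Q ^ (2 * L) / Q ^ d
      = ∑ c ∈ (polysLT F d).erase 0, (t c - (Q ^ L / Q ^ d) ^ 2) - (Q ^ L / Q ^ d) ^ 2 := by
    rw [Finset.sum_sub_distrib, hcard]
    ring
  rw [h2]
  refine (abs_sub _ _).trans ?_
  rw [abs_of_nonneg (by positivity : 0 ≤ (Q ^ L / Q ^ d) ^ 2)]
  have h3 := (Finset.abs_sum_le_sum_abs (fun c => t c - (Q ^ L / Q ^ d) ^ 2)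
    ((polysLT F d).erase 0)).trans herr
  linarith

end LineAverage

/-! ### The order `A + 𝔣 j A` and its lattices -/

section Quadratic

variable {F : Type*} [Field F] {a : F}

variable (a) in
/-- The quadratic extension `𝔽_q(√a)` of the constant field. -/
abbrev QuadExt : Type _ := QuadraticAlgebra F a 0

variable (a) in
/-- The square root `j` of `a`, as an element of `B = 𝔽_q(√a)[T]`. -/
def sqrtPoly [Fact (∀ r : F, r ^ 2 ≠ a + 0 * r)] : (QuadExt a)[X] := C QuadraticAlgebra.omega

variable [Fact (∀ r : F, r ^ 2 ≠ a + 0 * r)]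

theorem sqrtPoly_mul_self : sqrtPoly a * sqrtPoly a = up (QuadExt a) (C a) := by
  rw [sqrtPoly, ← C_mul, up, coe_mapRingHom, map_C]
  congr 1
  rw [QuadraticAlgebra.omega_mul_omega_eq_mk]
  rfl

theorem exists_eq_up_add (x : (QuadExt a)[X]) :
    ∃ P Q : F[X], x = up (QuadExt a) P + sqrtPoly a * up (QuadExt a) Q := by
  induction x using Polynomial.induction_on' with
  | add x y hx hy =>
    obtain ⟨P, Q, rfl⟩ := hx
    obtain ⟨P', Q', rfl⟩ := hy
    exact ⟨P + P', Q + Q', by rw [map_add, map_add]; ring⟩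
  | monomial n e =>
    refine ⟨monomial n e.re, monomial n e.im, ?_⟩
    rw [up, coe_mapRingHom, map_monomial, map_monomial, sqrtPoly, C_mul_monomial, ← map_add]
    congr 1
    ext <;> simp

theorem up_add_inj {P Q P' Q' : F[X]} (h : up (QuadExt a) P + sqrtPoly a * up (QuadExt a) Q
    = up (QuadExt a) P' + sqrtPoly a * up (QuadExt a) Q') : P = P' ∧ Q = Q' := by
  have h1 : ∀ n, algebraMap F (QuadExt a) (P.coeff n)
      + QuadraticAlgebra.omega * algebraMap F (QuadExt a) (Q.coeff n)
      = algebraMap F (QuadExt a) (P'.coeff n)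
      + QuadraticAlgebra.omega * algebraMap F (QuadExt a) (Q'.coeff n) := by
    intro n
    have := congrArg (fun x => x.coeff n) h
    simpa [up, sqrtPoly] using this
  constructor
  · ext n
    simpa using congrArg QuadraticAlgebra.re (h1 n)
  · ext n
    simpa using congrArg QuadraticAlgebra.im (h1 n)

variable (a) in
/-- The conjugation of `B` over `A`. -/
def conjPoly : (QuadExt a)[X] →+* (QuadExt a)[X] := mapRingHom (starRingEnd (QuadExt a))

theorem conjPoly_up (P : F[X]) : conjPoly a (up (QuadExt a) P) = up (QuadExt a) P := by
  rw [conjPoly, up, coe_mapRingHom, coe_mapRingHom, map_map]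
  congr 1
  ext r <;> simp [starRingEnd_apply]

theorem conjPoly_sqrtPoly : conjPoly a (sqrtPoly a) = -sqrtPoly a := by
  rw [conjPoly, sqrtPoly, coe_mapRingHom, map_C, ← C_neg]
  congr 1
  ext <;> simp [starRingEnd_apply]

theorem conjPoly_conjPoly (x : (QuadExt a)[X]) : conjPoly a (conjPoly a x) = x := by
  obtain ⟨P, Q, rfl⟩ := exists_eq_up_add x
  rw [map_add, map_mul, conjPoly_up, conjPoly_up, conjPoly_sqrtPoly, map_add, map_mul, map_neg,
    conjPoly_up, conjPoly_up, conjPoly_sqrtPoly, neg_neg]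

theorem exists_mul_conjPoly (x : (QuadExt a)[X]) :
    ∃ n : F[X], x * conjPoly a x = up (QuadExt a) n := by
  obtain ⟨P, Q, rfl⟩ := exists_eq_up_add x
  refine ⟨P ^ 2 - C a * Q ^ 2, ?_⟩
  rw [map_add, map_mul, conjPoly_up, conjPoly_up, conjPoly_sqrtPoly, map_sub, map_mul, map_pow,
    map_pow, ← sqrtPoly_mul_self]
  ring

theorem exists_prime_dvd_of_not_isCoprime {k : Type*} [Field k] {x y : k[X]} (hy : y ≠ 0)
    (h : ¬ IsCoprime x y) : ∃ P, Prime P ∧ P ∣ x ∧ P ∣ y := by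
  by_contra hc
  push Not at hc
  exact h (isCoprime_of_prime_dvd (fun h0 => hy h0.2) fun z hz hx => hc z hz hx)

/-- If `y₁, y₂` generate the unit ideal of `B`, then one of `y₁, y₂, y₁ + y₂` is prime to a given
prime `p` of `A`: above `p` there are at most two primes of `B`, and they are conjugate. -/
theorem isCoprime_or_or {y₁ y₂ : (QuadExt a)[X]} (h : IsCoprime y₁ y₂) {p : F[X]} (hp : Prime p) :
    IsCoprime y₁ (up (QuadExt a) p) ∨ IsCoprime y₂ (up (QuadExt a) p) ∨
      IsCoprime (y₁ + y₂) (up (QuadExt a) p) := by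
  by_contra hc
  push Not at hc
  obtain ⟨h1, h2, h3⟩ := hc
  have hp0 : up (QuadExt a) p ≠ 0 := up_ne_zero hp.ne_zero
  obtain ⟨P₁, hP₁, hy₁, hp₁⟩ := exists_prime_dvd_of_not_isCoprime hp0 h1
  obtain ⟨P₂, hP₂, hy₂, hp₂⟩ := exists_prime_dvd_of_not_isCoprime hp0 h2
  obtain ⟨P₃, hP₃, hy₃, hp₃⟩ := exists_prime_dvd_of_not_isCoprime hp0 h3
  have key : ∀ P : (QuadExt a)[X], Prime P → P ∣ up (QuadExt a) p → ¬ P₃ ∣ P →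
      conjPoly a P₃ ∣ P := by
    intro P hP hPp hn
    obtain ⟨n, hn2⟩ := exists_mul_conjPoly P
    have hpn : p ∣ n := by
      by_contra hpn
      have := ((Irreducible.coprime_iff_not_dvd hp.irreducible).2 hpn).map (up (QuadExt a))
      exact hP.not_isUnit (this.isUnit_of_dvd' hPp (hn2 ▸ dvd_mul_right _ _))
    have h4 : P₃ ∣ P * conjPoly a P := by
      rw [hn2]
      exact hp₃.trans (up_dvd_up.2 hpn)
    have h5 := map_dvd (conjPoly a) ((hP₃.dvd_or_dvd h4).resolve_left hn)
    rwa [conjPoly_conjPoly] at h5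
  have h4 : conjPoly a P₃ ∣ y₁ := by
    refine (key P₁ hP₁ hp₁ fun hd => ?_).trans hy₁
    have h5 : P₃ ∣ y₁ := hd.trans hy₁
    exact hP₃.not_isUnit (h.isUnit_of_dvd' h5 ((dvd_add_right h5).1 hy₃))
  have h5 : conjPoly a P₃ ∣ y₂ := by
    refine (key P₂ hP₂ hp₂ fun hd => ?_).trans hy₂
    have h5 : P₃ ∣ y₂ := hd.trans hy₂
    exact hP₃.not_isUnit (h.isUnit_of_dvd' ((dvd_add_left h5).1 hy₃) h5)
  have h6 := (h.isUnit_of_dvd' h4 h5).map (conjPoly a)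
  rw [conjPoly_conjPoly] at h6
  exact hP₃.not_isUnit h6

/-- An `A`-submodule of `B` that generates the unit ideal contains elements prime to any given
element of `A`. -/
theorem exists_mem_isCoprime {M : AddSubgroup (QuadExt a)[X]}
    (hA : ∀ (s : F[X]), ∀ x ∈ M, up (QuadExt a) s * x ∈ M) {y₁ y₂ : (QuadExt a)[X]} (h₁ : y₁ ∈ M)
    (h₂ : y₂ ∈ M) (h : IsCoprime y₁ y₂) {g : F[X]} (hg : g ≠ 0) :
    ∃ u ∈ M, IsCoprime u (up (QuadExt a) g) := by
  revert hg
  induction g using UniqueFactorizationMonoid.induction_on_prime with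
  | h₁ => exact fun h => absurd rfl h
  | h₂ g hu => exact fun _ => ⟨y₁, h₁, isCoprime_one_right.of_isCoprime_of_dvd_right
      (hu.map (up (QuadExt a))).dvd⟩
  | h₃ g p hg hp ih =>
    intro _
    obtain ⟨u, hu, hug⟩ := ih hg
    rw [map_mul]
    by_cases hd : p ∣ g
    · exact ⟨u, hu, (hug.of_isCoprime_of_dvd_right (up_dvd_up.2 hd)).mul_right hug⟩
    · have hpg : IsCoprime (up (QuadExt a) p) (up (QuadExt a) g) :=
        ((Irreducible.coprime_iff_not_dvd hp.irreducible).2 hd).map _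
      obtain ⟨w, hw, hwp⟩ : ∃ w ∈ M, IsCoprime w (up (QuadExt a) p) := by
        rcases isCoprime_or_or h hp with h3 | h3 | h3
        · exact ⟨_, h₁, h3⟩
        · exact ⟨_, h₂, h3⟩
        · exact ⟨_, M.add_mem h₁ h₂, h3⟩
      refine ⟨up (QuadExt a) g * w + up (QuadExt a) p * u, M.add_mem (hA _ _ hw) (hA _ _ hu),
        IsCoprime.mul_right ?_ ?_⟩
      · exact IsCoprime.add_mul_left_left (hpg.symm.mul_left hwp) u
      · rw [add_comm]
        exact IsCoprime.add_mul_left_left (hpg.mul_left hug) w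

/-- A primitive `A`-lattice in `B` with ring of multipliers `A + 𝔣 j A` is `u A + 𝔣 B` for some `u`
prime to `𝔣`. -/
theorem exists_mem_iff_lineLat {𝔣 : F[X]} (h𝔣 : 𝔣 ≠ 0) {M : AddSubgroup (QuadExt a)[X]}
    (hA : ∀ (s : F[X]), ∀ x ∈ M, up (QuadExt a) s * x ∈ M) {y₁ y₂ : (QuadExt a)[X]} (h₁ : y₁ ∈ M)
    (h₂ : y₂ ∈ M) (h : IsCoprime y₁ y₂)
    (hj : ∀ x ∈ M, up (QuadExt a) 𝔣 * sqrtPoly a * x ∈ M)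
    (hmin : ∀ g : F[X], (∀ x ∈ M, up (QuadExt a) g * sqrtPoly a * x ∈ M) → 𝔣 ∣ g) :
    ∃ u : (ResRing (QuadExt a) 𝔣)ˣ, ∀ x, x ∈ M ↔ x ∈ lineLat u := by
  have hB : ∀ b, up (QuadExt a) 𝔣 * b ∈ M := by
    intro b
    obtain ⟨c₁, c₂, hc⟩ := h
    obtain ⟨P₁, Q₁, hb₁⟩ := exists_eq_up_add (c₁ * b)
    obtain ⟨P₂, Q₂, hb₂⟩ := exists_eq_up_add (c₂ * b)
    have e : up (QuadExt a) 𝔣 * b = (up (QuadExt a) (𝔣 * P₁) * y₁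
        + up (QuadExt a) 𝔣 * sqrtPoly a * (up (QuadExt a) Q₁ * y₁))
        + (up (QuadExt a) (𝔣 * P₂) * y₂
        + up (QuadExt a) 𝔣 * sqrtPoly a * (up (QuadExt a) Q₂ * y₂)) := by
      rw [map_mul, map_mul]
      linear_combination (-up (QuadExt a) 𝔣 * b) * hc + up (QuadExt a) 𝔣 * y₁ * hb₁
        + up (QuadExt a) 𝔣 * y₂ * hb₂
    rw [e]
    exact M.add_mem (M.add_mem (hA _ _ h₁) (hj _ (hA _ _ h₁)))
      (M.add_mem (hA _ _ h₂) (hj _ (hA _ _ h₂)))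
  obtain ⟨u, hu, huc⟩ := exists_mem_isCoprime hA h₁ h₂ h h𝔣
  obtain ⟨v, w, hvw⟩ := id huc
  -- `{x | u x ∈ M} = A + g j A` for some `g`, and then `g j` is a multiplier of `M`
  let I : Ideal F[X] :=
    { carrier := {Q | u * (sqrtPoly a * up (QuadExt a) Q) ∈ M}
      zero_mem' := by
        change u * (sqrtPoly a * up (QuadExt a) 0) ∈ M
        rw [map_zero, mul_zero, mul_zero]
        exact M.zero_mem
      add_mem' := by
        intro P Q hP hQ
        change u * (sqrtPoly a * up (QuadExt a) (P + Q)) ∈ M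
        rw [map_add, mul_add, mul_add]
        exact M.add_mem hP hQ
      smul_mem' := by
        intro s Q hQ
        change u * (sqrtPoly a * up (QuadExt a) (s * Q)) ∈ M
        have e : u * (sqrtPoly a * up (QuadExt a) (s * Q))
            = up (QuadExt a) s * (u * (sqrtPoly a * up (QuadExt a) Q)) := by
          rw [map_mul]; ring
        rw [e]
        exact hA _ _ hQ }
  have hI : ∀ Q, Q ∈ I ↔ u * (sqrtPoly a * up (QuadExt a) Q) ∈ M := fun Q => Iff.rfl
  obtain ⟨g, hg⟩ : ∃ g, I = Ideal.span {g} := (IsPrincipalIdealRing.principal I).principal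
  have hIg : ∀ Q, u * (sqrtPoly a * up (QuadExt a) Q) ∈ M ↔ g ∣ Q := by
    intro Q
    rw [← hI, hg, Ideal.mem_span_singleton]
  have hdec : ∀ P Q : F[X], u * (up (QuadExt a) P + sqrtPoly a * up (QuadExt a) Q) ∈ M → g ∣ Q := by
    intro P Q hPQ
    rw [← hIg]
    have e : u * (sqrtPoly a * up (QuadExt a) Q)
        = u * (up (QuadExt a) P + sqrtPoly a * up (QuadExt a) Q) - up (QuadExt a) P * u := by ring
    rw [e]
    exact M.sub_mem hPQ (hA _ _ hu)
  have hvm : ∀ m ∈ M, u * (v * m) ∈ M := by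
    intro m hm
    have e : u * (v * m) = m - up (QuadExt a) 𝔣 * (w * m) := by linear_combination m * hvw
    rw [e]
    exact M.sub_mem hm (hB _)
  have hgj : ∀ m ∈ M, up (QuadExt a) g * sqrtPoly a * m ∈ M := by
    intro m hm
    obtain ⟨P, Q, hPQ⟩ := exists_eq_up_add (v * m)
    obtain ⟨R, rfl⟩ := hdec P Q (hPQ ▸ hvm m hm)
    have e : up (QuadExt a) g * sqrtPoly a * m
        = up (QuadExt a) P * (u * (sqrtPoly a * up (QuadExt a) g))
          + up (QuadExt a) (C a * g ^ 2 * R) * u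
          + up (QuadExt a) 𝔣 * (w * (up (QuadExt a) g * sqrtPoly a * m)) := by
      rw [map_mul] at hPQ
      rw [map_mul, map_mul, map_pow, ← sqrtPoly_mul_self]
      linear_combination (-up (QuadExt a) g * sqrtPoly a * m) * hvw
        + (up (QuadExt a) g * sqrtPoly a * u) * hPQ
    rw [e]
    exact M.add_mem (M.add_mem (hA _ _ ((hIg g).2 dvd_rfl)) (hA _ _ hu)) (hB _)
  have hfg : 𝔣 ∣ g := hmin g hgj
  refine ⟨(isUnit_res.2 huc).unit, fun x => ?_⟩
  rw [mem_lineLat]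
  constructor
  · intro hx
    obtain ⟨P, Q, hPQ⟩ := exists_eq_up_add (v * x)
    obtain ⟨R, rfl⟩ := hfg.trans (hdec P Q (hPQ ▸ hvm x hx))
    refine ⟨P, ?_⟩
    rw [IsUnit.unit_spec, ← map_mul, res_eq_res]
    refine ⟨w * x + u * sqrtPoly a * up (QuadExt a) R, ?_⟩
    rw [map_mul] at hPQ
    linear_combination (-x) * hvw + u * hPQ
  · rintro ⟨c, hc⟩
    rw [IsUnit.unit_spec, ← map_mul, res_eq_res] at hc
    obtain ⟨b, hb⟩ := hc
    have e : x = up (QuadExt a) c * u + up (QuadExt a) 𝔣 * b := by linear_combination hb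
    rw [e]
    exact M.add_mem (hA _ _ hu) (hB _)

/-- An `A`-lattice of rank 2 in `B` with ring of multipliers `A + 𝔣 j A` is homothetic to
`u A + 𝔣 B` for some `u` prime to `𝔣`. -/
theorem exists_mem_iff_mul_lineLat {𝔣 : F[X]} (h𝔣 : 𝔣 ≠ 0) {M : AddSubgroup (QuadExt a)[X]}
    (hA : ∀ (s : F[X]), ∀ x ∈ M, up (QuadExt a) s * x ∈ M) {x₁ x₂ : (QuadExt a)[X]} (h₁ : x₁ ∈ M)
    (h₂ : x₂ ∈ M) (hx : x₁ ≠ 0)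
    (hM : ∀ x ∈ M, ∃ s t : F[X], x = up (QuadExt a) s * x₁ + up (QuadExt a) t * x₂)
    (hj : ∀ x ∈ M, up (QuadExt a) 𝔣 * sqrtPoly a * x ∈ M)
    (hmin : ∀ g : F[X], (∀ x ∈ M, up (QuadExt a) g * sqrtPoly a * x ∈ M) → 𝔣 ∣ g) :
    ∃ β : (QuadExt a)[X], β ≠ 0 ∧ ∃ u : (ResRing (QuadExt a) 𝔣)ˣ,
      ∀ x, x ∈ M ↔ ∃ y ∈ lineLat u, x = β * y := by
  obtain ⟨β, y₁, y₂, hβ, rfl, rfl, hy⟩ : ∃ β y₁ y₂ : (QuadExt a)[X], β ≠ 0 ∧ x₁ = β * y₁ ∧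
      x₂ = β * y₂ ∧ IsCoprime y₁ y₂ := by
    obtain ⟨g, c, N, hg, h1, h2, h3⟩ := exists_monic_gcd x₂ hx
    exact ⟨g, N, c, hg.ne_zero, h2, h1, h3.symm⟩
  have hmem : ∀ x ∈ M, ∃ y, x = β * y := by
    intro x hx
    obtain ⟨s, t, rfl⟩ := hM x hx
    exact ⟨up (QuadExt a) s * y₁ + up (QuadExt a) t * y₂, by ring⟩
  have hcm : ∀ c y : (QuadExt a)[X], β * (c * y) = c * (β * y) := fun c y => by ring
  obtain ⟨u, hu⟩ := exists_mem_iff_lineLat (M := M.comap (AddMonoidHom.mulLeft β)) h𝔣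
    (fun s x hx => by
      change β * (up (QuadExt a) s * x) ∈ M
      rw [hcm]
      exact hA s _ hx) h₁ h₂ hy
    (fun x hx => by
      change β * (up (QuadExt a) 𝔣 * sqrtPoly a * x) ∈ M
      rw [hcm]
      exact hj _ hx)
    (fun g hg => hmin g fun x hx => by
      obtain ⟨y, rfl⟩ := hmem x hx
      rw [← hcm]
      exact hg y hx)
  refine ⟨β, hβ, u, fun x => ⟨fun hx => ?_, ?_⟩⟩
  · obtain ⟨y, rfl⟩ := hmem x hx
    exact ⟨y, (hu y).1 hx, rfl⟩
  · rintro ⟨y, hy, rfl⟩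
    exact (hu y).2 hy

end Quadratic

/-! ### The embedding of `𝔽_q(√a)[T]` into `ℂ_∞` -/

section Embedding

variable {F : Type*} [Field F] [Fintype F]

theorem exists_sqrt_CInf (a : F) : ∃ j : CInf F, j * j = toC F (C a) := by
  obtain ⟨x, hx⟩ := IsAlgClosed.exists_pow_nat_eq
    (algebraMap (KInf F) (KInfAlgCl F) (toK F (C a))) two_pos
  refine ⟨algebraMap (KInfAlgCl F) (CInf F) x, ?_⟩
  rw [← map_mul, ← sq, hx, ← algebraMap_toK]
  rfl

/-- A square root of the constant `a` in `ℂ_∞`. -/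
def sqrtC (a : F) : CInf F := (exists_sqrt_CInf a).choose

theorem sqrtC_mul_self (a : F) : sqrtC a * sqrtC a = toC F (C a) := (exists_sqrt_CInf a).choose_spec

variable {a : F}

variable (a) in
/-- The embedding `x + y √a ↦ x + y j` of `𝔽_q(√a)` into `ℂ_∞`. -/
def quadToC : QuadExt a →+* CInf F where
  toFun e := toC F (C e.re) + toC F (C e.im) * sqrtC a
  map_one' := by
    change toC F (C 1) + toC F (C 0) * sqrtC a = 1
    simp
  map_zero' := by
    change toC F (C 0) + toC F (C 0) * sqrtC a = 0
    simp
  map_add' x y := by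
    change toC F (C (x.re + y.re)) + toC F (C (x.im + y.im)) * sqrtC a = _
    simp only [map_add]
    ring
  map_mul' x y := by
    change toC F (C (x.re * y.re + a * x.im * y.im))
      + toC F (C (x.re * y.im + x.im * y.re + 0 * x.im * y.im)) * sqrtC a = _
    simp only [map_add, map_mul, zero_mul, add_zero]
    linear_combination (-toC F (C x.im) * toC F (C y.im)) * sqrtC_mul_self a

theorem finite_quadExt : Finite (QuadExt a) :=
  Finite.of_equiv _ (QuadraticAlgebra.equivProd a 0).symm

variable [Fact (∀ r : F, r ^ 2 ≠ a + 0 * r)]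

variable (a) in
/-- The embedding of `B = 𝔽_q(√a)[T]` into `ℂ_∞`. -/
def iota : (QuadExt a)[X] →+* CInf F := eval₂RingHom (quadToC a) (toC F X)

theorem iota_up (P : F[X]) : iota a (up (QuadExt a) P) = toC F P := by
  have h : (iota a).comp (up (QuadExt a)) = toC F := by
    refine ringHom_ext (fun r => ?_) ?_
    · simp [iota, up, quadToC]
    · simp [iota, up]
  exact congrArg (fun f => f P) h

theorem iota_sqrtPoly : iota a (sqrtPoly a) = sqrtC a := by
  simp [iota, sqrtPoly, quadToC]

theorem norm_quadToC {e : QuadExt a} (he : e ≠ 0) : ‖quadToC a e‖ = 1 := by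
  have : Finite (QuadExt a) := finite_quadExt
  have := Fintype.ofFinite (QuadExt a)
  have h1 : quadToC a e ^ (Fintype.card (QuadExt a) - 1) = 1 := by
    rw [← map_pow, FiniteField.pow_card_sub_one_eq_one e he, map_one]
  have h2 := congrArg norm h1
  rw [norm_pow, norm_one] at h2
  have h3 : Fintype.card (QuadExt a) - 1 ≠ 0 := by
    have := Fintype.one_lt_card (α := QuadExt a)
    omega
  exact (pow_eq_one_iff_of_nonneg (norm_nonneg _) h3).1 h2

theorem iota_C_mul_X_pow (e : QuadExt a) (n : ℕ) :
    iota a (C e * X ^ n) = quadToC a e * toC F X ^ n := by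
  simp [iota]

theorem norm_toC_X : ‖toC F X‖ = (q F : ℝ) := by
  rw [norm_toC X_ne_zero, natDegree_X, pow_one]

theorem norm_iota {x : (QuadExt a)[X]} (hx : x ≠ 0) : ‖iota a x‖ = (q F : ℝ) ^ x.natDegree := by
  have hQ := one_lt_q_real F
  have key : ∀ n : ℕ, ∀ x : (QuadExt a)[X], x.natDegree < n → x ≠ 0 →
      ‖iota a x‖ = (q F : ℝ) ^ x.natDegree := by
    intro n
    induction n with
    | zero => exact fun x h => absurd h (Nat.not_lt_zero _)
    | succ n ih =>
      intro x hxn hx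
      have h1 : ‖iota a (C x.leadingCoeff * X ^ x.natDegree)‖ = (q F : ℝ) ^ x.natDegree := by
        rw [iota_C_mul_X_pow, norm_mul, norm_quadToC (leadingCoeff_ne_zero.2 hx), one_mul, norm_pow,
          norm_toC_X]
      have h2 := x.eraseLead_add_C_mul_X_pow
      by_cases he : x.eraseLead = 0
      · rw [he, zero_add] at h2
        rwa [h2] at h1
      · have hdeg : x.eraseLead.natDegree < x.natDegree := by
          rcases eraseLead_natDegree_lt_or_eraseLead_eq_zero x with h | h
          · exact h
          · exact absurd h he
        have h3 := ih x.eraseLead (by omega) he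
        have h4 : ‖iota a x.eraseLead‖ < ‖iota a (C x.leadingCoeff * X ^ x.natDegree)‖ := by
          rw [h1, h3]
          exact pow_lt_pow_right₀ hQ hdeg
        conv_lhs => rw [← h2]
        rw [map_add, IsUltrametricDist.norm_add_eq_max_of_norm_ne_norm h4.ne, max_eq_right h4.le,
          h1]
  exact key _ x (Nat.lt_succ_self _) hx

theorem iota_injective : Function.Injective (iota a) := by
  rw [injective_iff_map_eq_zero]
  intro x hx
  by_contra h
  have h1 := norm_iota h
  rw [hx, norm_zero] at h1
  have := pow_pos (q_pos F) x.natDegree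
  linarith

theorem norm_iota_lt_iff {x : (QuadExt a)[X]} {L : ℕ} :
    ‖iota a x‖ < (q F : ℝ) ^ L ↔ x.degree < L := by
  by_cases hx : x = 0
  · simp only [hx, map_zero, norm_zero, degree_zero, WithBot.bot_lt_natCast, iff_true]
    exact pow_pos (q_pos F) L
  · rw [norm_iota hx, pow_lt_pow_iff_right₀ (one_lt_q_real F), degree_eq_natDegree hx]
    norm_cast

theorem sqrtC_notMem_range : sqrtC a ∉ Set.range (algebraMap (KInf F) (CInf F)) := by
  rintro ⟨y, hy⟩
  have hy2 : y * y = toK F (C a) := by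
    apply (algebraMap (KInf F) (CInf F)).injective
    rw [map_mul, hy, sqrtC_mul_self, algebraMap_toK]
  have ha : a ≠ 0 := by
    rintro rfl
    exact (Fact.out (p := ∀ r : F, r ^ 2 ≠ 0 + 0 * r)) 0 (by simp)
  have hyn : ‖y‖ = 1 := by
    have h1 := congrArg norm hy2
    rw [norm_mul, norm_toK (C_ne_zero.2 ha), natDegree_C, pow_zero] at h1
    nlinarith [norm_nonneg y]
  obtain ⟨s, hs⟩ := exists_norm_sub_toK_lt_one y
  -- the polynomial part of `y` is a square root of `a`
  have hsn : ‖toK F s‖ ≤ 1 := by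
    have e : toK F s = y + -(y - toK F s) := by ring
    rw [e]
    exact (IsUltrametricDist.norm_add_le_max _ _).trans
      (max_le hyn.le ((norm_neg _).le.trans hs.le))
  have h1 : ‖toK F (C a - s * s)‖ < 1 := by
    have e : toK F (C a - s * s) = (y - toK F s) * (y + toK F s) := by
      rw [map_sub, map_mul, ← hy2]
      ring
    rw [e, norm_mul]
    have h2 : ‖y + toK F s‖ ≤ 1 :=
      (IsUltrametricDist.norm_add_le_max _ _).trans (max_le hyn.le hsn)
    calc ‖y - toK F s‖ * ‖y + toK F s‖ ≤ ‖y - toK F s‖ * 1 := by gcongr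
      _ < 1 := by rwa [mul_one]
  have h2 : C a - s * s = 0 := by
    by_contra h
    exact absurd h1 (not_lt.2 (one_le_norm_toK h))
  have h3 := congrArg (coeff · 0) h2
  simp only [coeff_sub, coeff_C_zero, mul_coeff_zero, coeff_zero] at h3
  refine (Fact.out (p := ∀ r : F, r ^ 2 ≠ a + 0 * r)) (s.coeff 0) ?_
  linear_combination -h3

variable (a) in
/-- The square root of `a` as a point of the upper half-plane. -/
def sqrtOmega : Omega F := ⟨sqrtC a, sqrtC_notMem_range⟩

theorem iota_eq (P Q : F[X]) : iota a (up (QuadExt a) P + sqrtPoly a * up (QuadExt a) Q)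
    = toC F P + sqrtC a * toC F Q := by
  rw [map_add, map_mul, iota_up, iota_up, iota_sqrtPoly]

/-- A rank 2 `A`-submodule of `B` has a reduced basis. -/
theorem exists_reduced_generators {M : AddSubgroup (QuadExt a)[X]}
    (hA : ∀ (s : F[X]), ∀ x ∈ M, up (QuadExt a) s * x ∈ M) {h : F[X]} (h0 : h ≠ 0)
    (hM : ∀ x, up (QuadExt a) h * x ∈ M) : ∃ x₁ ∈ M, ∃ x₂ ∈ M,
      (∀ x ∈ M, ∃ s t : F[X], x = up (QuadExt a) s * x₁ + up (QuadExt a) t * x₂) ∧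
      x₁ ≠ 0 ∧ x₂ ≠ 0 ∧ x₁.natDegree ≤ x₂.natDegree ∧
      ∀ α β : KInf F, ‖algebraMap (KInf F) (CInf F) α * iota a x₁
        + algebraMap (KInf F) (CInf F) β * iota a x₂‖
        = max (‖α‖ * (q F : ℝ) ^ x₁.natDegree) (‖β‖ * (q F : ℝ) ^ x₂.natDegree) := by
  -- coordinates of an element of `B` with respect to the basis `j, 1`
  let v : F[X] → F[X] → Fin 2 → KInf F := fun P Q => ![toK F Q, toK F P]
  have hrow : ∀ P Q, rowNorm (sqrtOmega a).1 (v P Q)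
      = ‖iota a (up (QuadExt a) P + sqrtPoly a * up (QuadExt a) Q)‖ := by
    intro P Q
    rw [iota_eq, ← algebraMap_toK, ← algebraMap_toK, add_comm, mul_comm]
    rfl
  let M' : AddSubgroup (Fin 2 → KInf F) :=
    { carrier := {w | ∃ P Q, w = v P Q ∧ up (QuadExt a) P + sqrtPoly a * up (QuadExt a) Q ∈ M}
      zero_mem' := ⟨0, 0, by ext i; fin_cases i <;> simp [v], by simp⟩
      add_mem' := by
        rintro _ _ ⟨P, Q, rfl, h1⟩ ⟨P', Q', rfl, h2⟩
        refine ⟨P + P', Q + Q', by ext i; fin_cases i <;> simp [v], ?_⟩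
        have e := M.add_mem h1 h2
        rw [map_add, map_add]
        convert e using 1
        ring
      neg_mem' := by
        rintro _ ⟨P, Q, rfl, h1⟩
        refine ⟨-P, -Q, by ext i; fin_cases i <;> simp [v], ?_⟩
        have e := M.neg_mem h1
        rw [map_neg, map_neg]
        convert e using 1
        ring }
  have hmem : ∀ w, w ∈ M' ↔ ∃ P Q, w = v P Q ∧
      up (QuadExt a) P + sqrtPoly a * up (QuadExt a) Q ∈ M := fun w => Iff.rfl
  have hfin : ∀ R, {x | x ∈ M' ∧ rowNorm (sqrtOmega a).1 x ≤ R}.Finite := by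
    intro R
    refine ((finite_rowNorm_le (sqrtOmega a) R).image fun p i => toK F (p i)).subset ?_
    rintro _ ⟨⟨P, Q, rfl, -⟩, hR⟩
    have e : (fun i => toK F ((![Q, P] : Fin 2 → F[X]) i)) = v P Q := by
      ext i; fin_cases i <;> simp [v]
    exact ⟨![Q, P], by rw [Set.mem_ofPred_eq, e]; exact hR, e⟩
  have hh : toK F h ≠ 0 := (map_ne_zero_iff _ (toK_injective F)).2 h0
  obtain ⟨w₁, hw₁, w₂, hw₂, hgen, hpos, hle, hmax⟩ := exists_reduced_basis
    (isUltraNorm_rowNorm (sqrtOmega a)) M' (by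
      rintro s _ ⟨P, Q, rfl, h1⟩
      refine ⟨s * P, s * Q, by ext i; fin_cases i <;> simp [v], ?_⟩
      have e := hA s _ h1
      rw [map_mul, map_mul]
      convert e using 1
      ring) hfin (v := v h 0) (w := v 0 h)
    ⟨h, 0, rfl, by
      rw [map_zero, mul_zero, add_zero, ← mul_one (up (QuadExt a) h)]
      exact hM 1⟩
    ⟨0, h, rfl, by have := hM (sqrtPoly a); rwa [map_zero, zero_add, mul_comm]⟩
    (by
      intro α β hαβ
      have h1 := congrFun hαβ 0
      have h2 := congrFun hαβ 1
      simp only [v, Pi.add_apply, Pi.smul_apply, Matrix.cons_val_zero, Matrix.cons_val_one,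
        Pi.zero_apply, smul_eq_mul, map_zero, mul_zero, zero_add, add_zero] at h1 h2
      exact ⟨(mul_eq_zero.1 h2).resolve_right hh, (mul_eq_zero.1 h1).resolve_right hh⟩)
  obtain ⟨P₁, Q₁, rfl, hx₁⟩ := hw₁
  obtain ⟨P₂, Q₂, rfl, hx₂⟩ := hw₂
  rw [hrow] at hpos
  rw [hrow, hrow] at hle
  have hne₁ : up (QuadExt a) P₁ + sqrtPoly a * up (QuadExt a) Q₁ ≠ 0 := by
    intro h
    rw [h, map_zero, norm_zero] at hpos
    exact lt_irrefl _ hpos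
  have hne₂ : up (QuadExt a) P₂ + sqrtPoly a * up (QuadExt a) Q₂ ≠ 0 := by
    intro h
    rw [h, map_zero, norm_zero] at hle
    exact absurd hpos (not_lt.2 hle)
  refine ⟨_, hx₁, _, hx₂, ?_, hne₁, hne₂, ?_, ?_⟩
  · intro x hx
    obtain ⟨P, Q, rfl⟩ := exists_eq_up_add x
    obtain ⟨s, t, hst⟩ := hgen _ ((hmem _).2 ⟨P, Q, rfl, hx⟩)
    refine ⟨s, t, ?_⟩
    have h1 := congrFun hst 0
    have h2 := congrFun hst 1
    simp only [v, Pi.add_apply, Pi.smul_apply, Matrix.cons_val_zero, Matrix.cons_val_one,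
      smul_eq_mul, ← map_mul, ← map_add] at h1 h2
    rw [toK_injective F h1, toK_injective F h2]
    simp only [map_add, map_mul]
    ring
  · rw [norm_iota hne₁, norm_iota hne₂] at hle
    exact (pow_le_pow_iff_right₀ (one_lt_q_real F)).1 hle
  · intro α β
    have h1 := hmax α β
    rw [hrow, hrow, norm_iota hne₁, norm_iota hne₂] at h1
    rw [← h1]
    simp only [rowNorm, v, Pi.add_apply, Pi.smul_apply, Matrix.cons_val_zero, Matrix.cons_val_one,
      smul_eq_mul, map_add, map_mul, algebraMap_toK, iota_up, iota_sqrtPoly]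
    congr 1
    change _ = (_ + _) * sqrtC a + _
    ring

end Embedding

/-! ### The lattices with complex multiplication by `𝒪_D` -/

section Homothety

variable {F : Type*} [Field F] [Fintype F]

theorem exists_smul_lattice {z z' : Omega F} (h : z.toY = z'.toY) :
    ∃ c : CInf F, c ≠ 0 ∧ ∀ l, l ∈ lattice z'.1 ↔ c * l ∈ lattice z.1 := by
  obtain ⟨γ, hγ⟩ : ∃ γ : GL (Fin 2) F[X], z'.1 = moebius γ z.1 := Quotient.exact h
  have hden := denom_ne_zero γ z
  have hmul : ∀ s t : F[X], (toC F (γ 1 0) * z.1 + toC F (γ 1 1)) * (toC F s + z'.1 * toC F t)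
      = toC F (s * γ 1 1 + t * γ 0 1) + z.1 * toC F (s * γ 1 0 + t * γ 0 0) := by
    intro s t
    have h1 : z'.1 * (toC F (γ 1 0) * z.1 + toC F (γ 1 1))
        = toC F (γ 0 0) * z.1 + toC F (γ 0 1) := by
      rw [hγ, moebius, div_mul_cancel₀ _ hden]
    simp only [map_add, map_mul]
    linear_combination toC F t * h1
  refine ⟨_, hden, fun l => ⟨?_, ?_⟩⟩
  · rintro ⟨s, t, rfl⟩
    exact ⟨_, _, hmul s t⟩
  · rintro ⟨s, t, hst⟩
    have hinv : γ⁻¹.1 * γ.1 = 1 := by rw [← Units.val_mul, inv_mul_cancel, Units.val_one]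
    have e00 := congrFun (congrFun hinv 0) 0
    have e01 := congrFun (congrFun hinv 0) 1
    have e10 := congrFun (congrFun hinv 1) 0
    have e11 := congrFun (congrFun hinv 1) 1
    simp only [Matrix.mul_apply, Fin.sum_univ_two, Matrix.one_apply_eq, Matrix.one_apply_ne, ne_eq,
      zero_ne_one, one_ne_zero, not_false_eq_true] at e00 e01 e10 e11
    refine ⟨t * γ⁻¹ 0 1 + s * γ⁻¹ 1 1, t * γ⁻¹ 0 0 + s * γ⁻¹ 1 0, ?_⟩
    apply mul_left_cancel₀ hden
    rw [hst, hmul]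
    congr 2
    · linear_combination (-t) * e01 - s * e11
    · congr 1
      linear_combination (-t) * e00 - s * e10

theorem toY_eq_of_smul_lattice {z z' : Omega F} {c : CInf F} (hc : c ≠ 0)
    (h : ∀ l, l ∈ lattice z'.1 ↔ c * l ∈ lattice z.1) : z.toY = z'.toY := by
  obtain ⟨s₀, t₀, h₀⟩ := (h 1).1 ⟨1, 0, by simp⟩
  obtain ⟨s₁, t₁, h₁⟩ := (h z'.1).1 ⟨0, 1, by simp⟩
  obtain ⟨p₀, r₀, h₂⟩ := (h c⁻¹).2 (by rw [mul_inv_cancel₀ hc]; exact ⟨1, 0, by simp⟩)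
  obtain ⟨p₁, r₁, h₃⟩ := (h (c⁻¹ * z.1)).2
    (by rw [mul_inv_cancel_left₀ hc]; exact ⟨0, 1, by simp⟩)
  rw [mul_one] at h₀
  have hc1 : c * c⁻¹ = 1 := mul_inv_cancel₀ hc
  obtain ⟨e1, e2⟩ := toC_add_mul_inj z (a := 1) (b := 0) (c := p₀ * s₀ + r₀ * s₁)
    (d := p₀ * t₀ + r₀ * t₁) (by
      simp only [map_add, map_mul, map_one, map_zero]
      linear_combination -hc1 + c * h₂ + toC F p₀ * h₀ + toC F r₀ * h₁)
  obtain ⟨e3, e4⟩ := toC_add_mul_inj z (a := 0) (b := 1) (c := p₁ * s₀ + r₁ * s₁)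
    (d := p₁ * t₀ + r₁ * t₁) (by
      simp only [map_add, map_mul, map_one, map_zero]
      linear_combination (-z.1) * hc1 + c * h₃ + toC F p₁ * h₀ + toC F r₁ * h₁)
  have hM : (!![r₁, p₁; r₀, p₀] : Matrix (Fin 2) (Fin 2) F[X]) * !![t₁, s₁; t₀, s₀] = 1 := by
    have a1 : r₁ * t₁ + p₁ * t₀ = 1 := by linear_combination -e4
    have a2 : r₁ * s₁ + p₁ * s₀ = 0 := by linear_combination -e3
    have a3 : r₀ * t₁ + p₀ * t₀ = 0 := by linear_combination -e2
    have a4 : r₀ * s₁ + p₀ * s₀ = 1 := by linear_combination -e1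
    rw [Matrix.mul_fin_two, Matrix.one_fin_two, a1, a2, a3, a4]
  refine Quotient.sound ⟨⟨_, _, mul_eq_one_comm.1 hM, hM⟩, ?_⟩
  change z'.1 = (toC F t₁ * z.1 + toC F s₁) / (toC F t₀ * z.1 + toC F s₀)
  have e0 : toC F t₀ * z.1 + toC F s₀ = c := by rw [h₀]; ring
  rw [e0, eq_div_iff hc]
  linear_combination h₁

end Homothety

section LineLattice

variable {F : Type*} [Field F] {E : Type*} [Field E] [Algebra F E] {𝔣 : F[X]}

theorem up_mul_mem_lineLat {u : (ResRing E 𝔣)ˣ} (s : F[X]) {x : E[X]} (hx : x ∈ lineLat u) :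
    up E s * x ∈ lineLat u := by
  obtain ⟨c, hc⟩ := hx
  exact ⟨s * c, by rw [map_mul, hc, map_mul, map_mul, mul_assoc]⟩

theorem up_conductor_mul_mem_lineLat (u : (ResRing E 𝔣)ˣ) (b : E[X]) :
    up E 𝔣 * b ∈ lineLat u := by
  refine ⟨0, ?_⟩
  rw [map_zero, map_zero, zero_mul, res_eq_zero]
  exact dvd_mul_right _ _

theorem mem_lineLat_of_res_eq {u : (ResRing E 𝔣)ˣ} {v : E[X]} (hv : res E 𝔣 v = u) :
    v ∈ lineLat u := ⟨1, by rw [hv, map_one, map_one, one_mul]⟩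

theorem mul_mem_lineLat {u w : (ResRing E 𝔣)ˣ} {x y : E[X]} (hx : x ∈ lineLat w)
    (hy : y ∈ lineLat u) : x * y ∈ lineLat (w * u) := by
  obtain ⟨c, hc⟩ := hx
  obtain ⟨d, hd⟩ := hy
  refine ⟨c * d, ?_⟩
  rw [map_mul, hc, hd, map_mul, map_mul, Units.val_mul]
  ring

theorem mul_mem_lineLat_iff {u w : (ResRing E 𝔣)ˣ} {v y : E[X]} (hv : res E 𝔣 v = w) :
    v * y ∈ lineLat (w * u) ↔ y ∈ lineLat u := by
  refine ⟨?_, mul_mem_lineLat (mem_lineLat_of_res_eq hv)⟩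
  rintro ⟨c, hc⟩
  refine ⟨c, w.isUnit.mul_left_cancel ?_⟩
  rw [map_mul, hv, Units.val_mul] at hc
  rw [hc]
  ring

theorem mem_lineLat_one_of_mul_mem {u : (ResRing E 𝔣)ˣ} {x : E[X]}
    (h : ∀ y ∈ lineLat u, x * y ∈ lineLat u) : x ∈ lineLat (1 : (ResRing E 𝔣)ˣ) := by
  obtain ⟨v, hv⟩ := Ideal.Quotient.mk_surjective u.1
  have h1 := h v (mem_lineLat_of_res_eq hv)
  rw [mul_comm] at h1
  rw [← mul_mem_lineLat_iff hv, mul_one]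
  exact h1

end LineLattice

section ComplexMultiplication

variable {F : Type*} [Field F] [Fintype F] {a : F} [Fact (∀ r : F, r ^ 2 ≠ a + 0 * r)] {𝔣 : F[X]}

instance : Finite (QuadExt a) := finite_quadExt

theorem mem_lineLat_one_iff {y : (QuadExt a)[X]} :
    y ∈ lineLat (1 : (ResRing (QuadExt a) 𝔣)ˣ) ↔
      ∃ P Q : F[X], y = up (QuadExt a) P + sqrtPoly a * up (QuadExt a) (𝔣 * Q) := by
  constructor
  · rintro ⟨c, hc⟩
    rw [Units.val_one, mul_one, res_eq_res] at hc
    obtain ⟨b, hb⟩ := hc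
    obtain ⟨P, Q, rfl⟩ := exists_eq_up_add b
    refine ⟨c + 𝔣 * P, Q, ?_⟩
    simp only [map_add, map_mul]
    linear_combination hb
  · rintro ⟨P, Q, rfl⟩
    refine ⟨P, ?_⟩
    rw [Units.val_one, mul_one, res_eq_res, map_mul]
    exact ⟨sqrtPoly a * up (QuadExt a) Q, by ring⟩

theorem mem_order_iff {x : CInf F} : x ∈ order (C a * 𝔣 ^ 2) ↔
    ∃ y ∈ lineLat (1 : (ResRing (QuadExt a) 𝔣)ˣ), iota a y = x := by
  have hsq : (toC F 𝔣 * sqrtC a) ^ 2 = toC F (C a * 𝔣 ^ 2) := by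
    rw [map_mul, map_pow, ← sqrtC_mul_self]
    ring
  constructor
  · intro hx
    induction hx using Subring.closure_induction with
    | mem x hx =>
      rcases hx with ⟨P, rfl⟩ | hx
      · exact ⟨up (QuadExt a) P, mem_lineLat_one_iff.2 ⟨P, 0, by simp⟩, iota_up P⟩
      · have h1 : (x - toC F 𝔣 * sqrtC a) * (x + toC F 𝔣 * sqrtC a) = 0 := by
          have h2 : x ^ 2 = toC F (C a * 𝔣 ^ 2) := hx
          linear_combination h2 - hsq
        have h3 : ∀ s : F[X], iota a (sqrtPoly a * up (QuadExt a) (𝔣 * s))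
            = toC F 𝔣 * sqrtC a * toC F s := by
          intro s
          rw [map_mul, iota_sqrtPoly, iota_up, map_mul]
          ring
        rcases mul_eq_zero.1 h1 with h | h
        · refine ⟨sqrtPoly a * up (QuadExt a) (𝔣 * 1),
            mem_lineLat_one_iff.2 ⟨0, 1, by simp⟩, ?_⟩
          rw [h3, map_one, mul_one]
          linear_combination -h
        · refine ⟨sqrtPoly a * up (QuadExt a) (𝔣 * -1),
            mem_lineLat_one_iff.2 ⟨0, -1, by simp⟩, ?_⟩
          rw [h3, map_neg, map_one]
          linear_combination -h
    | zero => exact ⟨0, zero_mem _, map_zero _⟩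
    | one => exact ⟨1, mem_lineLat_of_res_eq (map_one _), map_one _⟩
    | add x y _ _ hx hy =>
      obtain ⟨x, hx, rfl⟩ := hx
      obtain ⟨y, hy, rfl⟩ := hy
      exact ⟨x + y, add_mem hx hy, map_add _ _ _⟩
    | neg x _ hx =>
      obtain ⟨x, hx, rfl⟩ := hx
      exact ⟨-x, neg_mem hx, map_neg _ _⟩
    | mul x y _ _ hx hy =>
      obtain ⟨x, hx, rfl⟩ := hx
      obtain ⟨y, hy, rfl⟩ := hy
      exact ⟨x * y, by simpa using mul_mem_lineLat hx hy, map_mul _ _ _⟩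
  · rintro ⟨y, hy, rfl⟩
    obtain ⟨P, Q, rfl⟩ := mem_lineLat_one_iff.1 hy
    have hA : ∀ P : F[X], toC F P ∈ order (C a * 𝔣 ^ 2) := fun P =>
      Subring.subset_closure (Or.inl ⟨P, rfl⟩)
    have hs : toC F 𝔣 * sqrtC a ∈ order (C a * 𝔣 ^ 2) := Subring.subset_closure (Or.inr hsq)
    rw [iota_eq, map_mul]
    have e : toC F P + sqrtC a * (toC F 𝔣 * toC F Q)
        = toC F P + toC F 𝔣 * sqrtC a * toC F Q := by ring
    rw [e]
    exact add_mem (hA P) (mul_mem hs (hA Q))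

theorem iota_mem_order_iff {y : (QuadExt a)[X]} : iota a y ∈ order (C a * 𝔣 ^ 2) ↔
    y ∈ lineLat (1 : (ResRing (QuadExt a) 𝔣)ˣ) := by
  rw [mem_order_iff]
  constructor
  · rintro ⟨y', hy', h⟩
    rwa [← iota_injective h]
  · exact fun h => ⟨y, h, rfl⟩

theorem dvd_of_iota_mul_mem_order {g : F[X]}
    (h : iota a (up (QuadExt a) g * sqrtPoly a) ∈ order (C a * 𝔣 ^ 2)) : 𝔣 ∣ g := by
  obtain ⟨P, Q, hPQ⟩ := mem_lineLat_one_iff.1 (iota_mem_order_iff.1 h)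
  refine ⟨Q, (up_add_inj (a := a) (P := 0) (P' := P) ?_).2⟩
  rw [← hPQ, map_zero, zero_add, mul_comm]

theorem iota_conductor_mem_order :
    iota a (up (QuadExt a) 𝔣 * sqrtPoly a) ∈ order (C a * 𝔣 ^ 2) :=
  iota_mem_order_iff.2 (mem_lineLat_one_iff.2 ⟨0, 1, by rw [map_zero, mul_one]; ring⟩)

/-- Between lattices of the form `u A + 𝔣 B`, multiplication by an element of `ℂ_∞` is
multiplication by an element of `B`: both lattices generate the unit ideal of `B`. -/
theorem exists_eq_iota {u u' : (ResRing (QuadExt a) 𝔣)ˣ} {c : CInf F}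
    (h : ∀ y ∈ lineLat u, ∃ y' ∈ lineLat u', c * iota a y = iota a y') : ∃ x, c = iota a x := by
  obtain ⟨v, hv⟩ := Ideal.Quotient.mk_surjective u.1
  obtain ⟨α, β, hαβ⟩ := isUnit_res.1 (hv ▸ u.isUnit : IsUnit (res (QuadExt a) 𝔣 v))
  obtain ⟨y₀, -, h0⟩ := h v (mem_lineLat_of_res_eq hv)
  obtain ⟨y₁, -, h1⟩ := h _ (up_conductor_mul_mem_lineLat u 1)
  refine ⟨α * y₀ + β * y₁, ?_⟩
  have h2 := congrArg (iota a) hαβ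
  simp only [map_add, map_mul, map_one, mul_one] at h2 h1 ⊢
  rw [← h0, ← h1]
  linear_combination (-c) * h2

/-- `Λ_z` is homothetic to `u A + 𝔣 B`. -/
def HasLine (z : CInf F) (u : (ResRing (QuadExt a) 𝔣)ˣ) : Prop :=
  ∃ c : CInf F, c ≠ 0 ∧ ∀ l, l ∈ lattice z ↔ ∃ y ∈ lineLat u, l = c * iota a y

/-- `u A + 𝔣 B` and `u' A + 𝔣 B` are homothetic; the factor is then a constant. -/
def LineSim (u u' : (ResRing (QuadExt a) 𝔣)ˣ) : Prop :=
  ∃ e : QuadExt a, e ≠ 0 ∧ ∀ y, y ∈ lineLat u ↔ C e * y ∈ lineLat u'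

theorem LineSim.mul_left {u u' : (ResRing (QuadExt a) 𝔣)ˣ} (h : LineSim u u')
    (w : (ResRing (QuadExt a) 𝔣)ˣ) : LineSim (w * u) (w * u') := by
  obtain ⟨e, he, h⟩ := h
  refine ⟨e, he, fun y => ?_⟩
  obtain ⟨v, hv⟩ := Ideal.Quotient.mk_surjective (w⁻¹ : (ResRing (QuadExt a) 𝔣)ˣ).1
  have h1 : ∀ (u : (ResRing (QuadExt a) 𝔣)ˣ) (y : (QuadExt a)[X]),
      y ∈ lineLat (w * u) ↔ v * y ∈ lineLat u := by
    intro u y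
    rw [← mul_mem_lineLat_iff (u := w * u) hv, inv_mul_cancel_left]
  rw [h1, h1, h]
  have e2 : C e * (v * y) = v * (C e * y) := by ring
  rw [e2]

theorem lineSim_of_smul {u u' : (ResRing (QuadExt a) 𝔣)ˣ} {c : CInf F} (hc : c ≠ 0)
    (h : ∀ y ∈ lineLat u, ∃ y' ∈ lineLat u', c * iota a y = iota a y')
    (h' : ∀ y' ∈ lineLat u', ∃ y ∈ lineLat u, c * iota a y = iota a y') :
    LineSim u u' := by
  obtain ⟨x, rfl⟩ := exists_eq_iota h
  obtain ⟨x', hx'⟩ := exists_eq_iota (c := (iota a x)⁻¹) (u := u') (u' := u) fun y' hy' => by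
    obtain ⟨y, hy, he⟩ := h' y' hy'
    exact ⟨y, hy, by rw [← he, inv_mul_cancel_left₀ hc]⟩
  have hu : x * x' = 1 := by
    apply iota_injective (a := a)
    rw [map_mul, ← hx', mul_inv_cancel₀ hc, map_one]
  obtain ⟨e, he, rfl⟩ := Polynomial.isUnit_iff.1 (IsUnit.of_mul_eq_one x' hu)
  refine ⟨e, he.ne_zero, fun y => ⟨fun hy => ?_, fun hy => ?_⟩⟩
  · obtain ⟨y', hy', he⟩ := h y hy
    rw [← map_mul] at he
    rwa [iota_injective he]
  · obtain ⟨y', hy', he⟩ := h' _ hy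
    rw [map_mul] at he
    rwa [← iota_injective (mul_left_cancel₀ hc he)]

theorem toY_eq_iff_lineSim {z z' : Omega F} {u u' : (ResRing (QuadExt a) 𝔣)ˣ}
    (hz : HasLine z.1 u) (hz' : HasLine z'.1 u') : z.toY = z'.toY ↔ LineSim u u' := by
  obtain ⟨c, hc, h⟩ := hz
  obtain ⟨c', hc', h'⟩ := hz'
  constructor
  · intro hY
    obtain ⟨d, hd, hl⟩ := exists_smul_lattice hY.symm
    refine lineSim_of_smul (c := c'⁻¹ * (d * c)) (by positivity) (fun y hy => ?_) fun y' hy' => ?_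
    · obtain ⟨y', hy', he⟩ := (h' _).1 ((hl _).1 ((h _).2 ⟨y, hy, rfl⟩))
      refine ⟨y', hy', ?_⟩
      rw [mul_assoc, mul_assoc, he, inv_mul_cancel_left₀ hc']
    · obtain ⟨y, hy, he⟩ := (h _).1 ((hl (d⁻¹ * (c' * iota a y'))).2 (by
        rw [mul_inv_cancel_left₀ hd]
        exact (h' _).2 ⟨y', hy', rfl⟩))
      refine ⟨y, hy, ?_⟩
      rw [mul_assoc, mul_assoc, ← he, mul_inv_cancel_left₀ hd, inv_mul_cancel_left₀ hc']
  · rintro ⟨e, he, hs⟩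
    have he' : iota a (C e) ≠ 0 := (map_ne_zero_iff _ iota_injective).2 (C_ne_zero.2 he)
    refine (toY_eq_of_smul_lattice (c := c' * (iota a (C e) * c⁻¹)) (by positivity)
      fun l => ?_).symm
    rw [h, h']
    constructor
    · rintro ⟨y, hy, rfl⟩
      refine ⟨C e * y, (hs y).1 hy, ?_⟩
      rw [map_mul]
      field_simp
    · rintro ⟨y', hy', he2⟩
      have h3 : y' = C e * (C e⁻¹ * y') := by
        rw [← mul_assoc, ← C_mul, mul_inv_cancel₀ he, C_1, one_mul]
      rw [h3] at hy' he2
      refine ⟨_, (hs _).2 hy', ?_⟩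
      rw [map_mul (iota a) (C e), mul_assoc] at he2
      have h4 := mul_left_cancel₀ hc' he2
      rw [mul_assoc] at h4
      have h5 := mul_left_cancel₀ he' h4
      rw [← h5, mul_inv_cancel_left₀ hc]

theorem multipliers_eq_order {z : CInf F} {u : (ResRing (QuadExt a) 𝔣)ˣ} (hz : HasLine z u) :
    multipliers z = (order (C a * 𝔣 ^ 2) : Set (CInf F)) := by
  obtain ⟨c, hc, h⟩ := hz
  ext m
  rw [SetLike.mem_coe, mem_order_iff]
  constructor
  · intro hm
    have h1 : ∀ y ∈ lineLat u, ∃ y' ∈ lineLat u, m * iota a y = iota a y' := by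
      intro y hy
      obtain ⟨y', hy', he⟩ := (h _).1 (hm _ ((h _).2 ⟨y, hy, rfl⟩))
      refine ⟨y', hy', mul_left_cancel₀ hc ?_⟩
      rw [← he]
      ring
    obtain ⟨x, rfl⟩ := exists_eq_iota h1
    refine ⟨x, mem_lineLat_one_of_mul_mem (u := u) fun y hy => ?_, rfl⟩
    obtain ⟨y', hy', he⟩ := h1 y hy
    rw [← map_mul] at he
    rwa [iota_injective he]
  · rintro ⟨x, hx, rfl⟩ l hl
    obtain ⟨y, hy, rfl⟩ := (h l).1 hl
    refine (h _).2 ⟨x * y, ?_, ?_⟩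
    · have := mul_mem_lineLat hx hy
      rwa [one_mul] at this
    · rw [map_mul]
      ring

theorem exists_hasLine (h𝔣 : 𝔣 ≠ 0) {z : Omega F}
    (hz : multipliers z.1 = (order (C a * 𝔣 ^ 2) : Set (CInf F))) :
    ∃ u : (ResRing (QuadExt a) 𝔣)ˣ, HasLine z.1 u := by
  have hmul : ∀ {m : CInf F}, m ∈ order (C a * 𝔣 ^ 2) ↔ ∀ l ∈ lattice z.1, m * l ∈ lattice z.1 := by
    intro m
    rw [← SetLike.mem_coe, ← hz]
    rfl
  obtain ⟨s, t, hst⟩ := hmul.1 (iota_conductor_mem_order (a := a) (𝔣 := 𝔣)) 1 ⟨1, 0, by simp⟩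
  rw [mul_one] at hst
  have hJ : iota a (up (QuadExt a) 𝔣 * sqrtPoly a - up (QuadExt a) s) = z.1 * toC F t := by
    rw [map_sub, hst, iota_up]
    ring
  have ht : t ≠ 0 := by
    rintro rfl
    rw [map_zero, mul_zero, ← map_zero (iota a)] at hJ
    have h1 := iota_injective hJ
    have h2 := (up_add_inj (a := a) (P := -s) (Q := 𝔣) (P' := 0) (Q' := 0) (by
      rw [map_neg, map_zero, mul_zero, add_zero]
      linear_combination h1)).2
    exact h𝔣 h2
  have htC := toC_ne_zero ht
  set x₂ := up (QuadExt a) 𝔣 * sqrtPoly a - up (QuadExt a) s with hx₂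
  -- `t Λ_z`, as a submodule of `B`
  let M : AddSubgroup (QuadExt a)[X] :=
    { carrier := {x | ∃ p r : F[X], x = up (QuadExt a) p * up (QuadExt a) t
        + up (QuadExt a) r * x₂}
      zero_mem' := ⟨0, 0, by simp⟩
      add_mem' := by
        rintro _ _ ⟨p, r, rfl⟩ ⟨p', r', rfl⟩
        exact ⟨p + p', r + r', by rw [map_add, map_add]; ring⟩
      neg_mem' := by
        rintro _ ⟨p, r, rfl⟩
        exact ⟨-p, -r, by rw [map_neg, map_neg]; ring⟩ }
  have hiota : ∀ p r : F[X], iota a (up (QuadExt a) p * up (QuadExt a) t + up (QuadExt a) r * x₂)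
      = toC F t * (toC F p + z.1 * toC F r) := by
    intro p r
    rw [map_add, map_mul, map_mul, hJ, iota_up, iota_up, iota_up]
    ring
  have hM : ∀ x, x ∈ M ↔ ∃ l ∈ lattice z.1, iota a x = toC F t * l := by
    intro x
    constructor
    · rintro ⟨p, r, rfl⟩
      exact ⟨_, ⟨p, r, rfl⟩, hiota p r⟩
    · rintro ⟨_, ⟨p, r, rfl⟩, hx⟩
      exact ⟨p, r, iota_injective (hx.trans (hiota p r).symm)⟩
  have hcm : ∀ m : (QuadExt a)[X], iota a m ∈ order (C a * 𝔣 ^ 2) ↔ ∀ x ∈ M, m * x ∈ M := by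
    intro m
    rw [hmul]
    constructor
    · intro h x hx
      obtain ⟨l, hl, he⟩ := (hM x).1 hx
      exact (hM _).2 ⟨_, h l hl, by rw [map_mul, he]; ring⟩
    · rintro h _ ⟨p, r, rfl⟩
      obtain ⟨l, hl, he⟩ := (hM _).1 (h _ ⟨p, r, rfl⟩)
      rw [map_mul, hiota] at he
      have e : iota a m * (toC F p + z.1 * toC F r) = l := by
        apply mul_left_cancel₀ htC
        rw [← he]
        ring
      rwa [e]
  obtain ⟨β, hβ, u, hu⟩ := exists_mem_iff_mul_lineLat (M := M) (x₁ := up (QuadExt a) t) (x₂ := x₂)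
    h𝔣 (by
      rintro s _ ⟨p, r, rfl⟩
      exact ⟨s * p, s * r, by rw [map_mul, map_mul]; ring⟩)
    ⟨1, 0, by simp⟩ ⟨0, 1, by simp⟩ (up_ne_zero ht) (fun x hx => hx)
    ((hcm _).1 iota_conductor_mem_order) fun g hg => dvd_of_iota_mul_mem_order ((hcm _).2 hg)
  have hβ' : iota a β ≠ 0 := (map_ne_zero_iff _ iota_injective).2 hβ
  refine ⟨u, (toC F t)⁻¹ * iota a β, mul_ne_zero (inv_ne_zero htC) hβ', fun l => ⟨?_, ?_⟩⟩
  · rintro ⟨p, r, rfl⟩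
    obtain ⟨y, hy, he⟩ := (hu _).1 ⟨p, r, rfl⟩
    refine ⟨y, hy, ?_⟩
    rw [mul_assoc, ← map_mul, ← he, hiota, inv_mul_cancel_left₀ htC]
  · rintro ⟨y, hy, rfl⟩
    obtain ⟨l, hl, he⟩ := (hM _).1 ((hu (β * y)).2 ⟨y, hy, rfl⟩)
    rw [mul_assoc, ← map_mul, he, inv_mul_cancel_left₀ htC]
    exact hl

end ComplexMultiplication

section Representatives

variable {F : Type*} [Field F] [Fintype F] {a : F} [Fact (∀ r : F, r ^ 2 ≠ a + 0 * r)] {𝔣 : F[X]}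

open scoped Classical in
/-- Every lattice `u A + 𝔣 B` is homothetic to some `Λ_z`, and if `m` is the smallest degree of a
non-zero element of `u A + 𝔣 B`, then `z` lies above the vertex `v_n` with `n = deg 𝔣 - 2 m`. -/
theorem exists_omega_of_line (h𝔣 : 𝔣.Monic) (u : (ResRing (QuadExt a) 𝔣)ˣ) :
    ∃ z : Omega F, HasLine z.1 u ∧ ∃ m n : ℕ, 2 * m + n = 𝔣.natDegree ∧
      IsBuildingVertex z (gLattice F n) ∧ ∀ L : ℕ, 2 * L ≤ 𝔣.natDegree + 1 →
        ((polysLT (QuadExt a) L).filter (· ∈ lineLat u)).card = q F ^ (L - m) := by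
  have := Fintype.ofFinite (QuadExt a)
  obtain ⟨x₁, hx₁, x₂, hx₂, hgen, h1, h2, hle, hmax⟩ := exists_reduced_generators
    (M := lineLat u) (fun s x hx => up_mul_mem_lineLat s hx) h𝔣.ne_zero
    (up_conductor_mul_mem_lineLat u)
  have hQ := one_lt_q_real F
  have hQ0 := q_pos F
  have hi1 : iota a x₁ ≠ 0 := (map_ne_zero_iff _ iota_injective).2 h1
  have hi2 : iota a x₂ ≠ 0 := (map_ne_zero_iff _ iota_injective).2 h2
  have hmem : ∀ s t : F[X], up (QuadExt a) s * x₁ + up (QuadExt a) t * x₂ ∈ lineLat u :=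
    fun s t => add_mem (up_mul_mem_lineLat s hx₁) (up_mul_mem_lineLat t hx₂)
  -- degrees in terms of the coordinates
  have hdeg : ∀ (s t : F[X]) (L : ℕ),
      (up (QuadExt a) s * x₁ + up (QuadExt a) t * x₂).degree < L ↔
        s.degree < (L - x₁.natDegree : ℕ) ∧ t.degree < (L - x₂.natDegree : ℕ) := by
    intro s t L
    have h3 : ∀ (s : F[X]) {x : (QuadExt a)[X]}, x ≠ 0 →
        (‖toK F s‖ * (q F : ℝ) ^ x.natDegree < (q F : ℝ) ^ L ↔
          s.degree < (L - x.natDegree : ℕ)) := by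
      intro s x hx
      rw [← norm_iota hx, ← norm_algebraMap_CInf, algebraMap_toK, ← iota_up (a := a), ← norm_mul,
        ← map_mul, norm_iota_lt_iff, mul_comm, degree_mul_lt_iff hx, degree_up]
    rw [← norm_iota_lt_iff, ← h3 s h1, ← h3 t h2, ← max_lt_iff, ← hmax]
    simp only [map_add, map_mul, iota_up, algebraMap_toK]
  have hinj : ∀ s t s' t' : F[X], up (QuadExt a) s * x₁ + up (QuadExt a) t * x₂
      = up (QuadExt a) s' * x₁ + up (QuadExt a) t' * x₂ → s = s' ∧ t = t' := by
    intro s t s' t' h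
    have h3 : up (QuadExt a) (s - s') * x₁ + up (QuadExt a) (t - t') * x₂ = 0 := by
      rw [map_sub, map_sub]
      linear_combination h
    have h4 := (hdeg (s - s') (t - t') 0).1 (by
      rw [h3, degree_zero]
      exact WithBot.bot_lt_coe 0)
    have h5 : ∀ {p : F[X]} {n : ℕ}, p.degree < (0 - n : ℕ) → p = 0 := by
      intro p n hp
      rw [Nat.zero_sub] at hp
      by_contra hp0
      exact absurd hp (not_lt.2 (zero_le_degree_iff.2 hp0))
    exact ⟨sub_eq_zero.1 (h5 h4.1), sub_eq_zero.1 (h5 h4.2)⟩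
  have hcount : ∀ L : ℕ, ((polysLT (QuadExt a) L).filter (· ∈ lineLat u)).card
      = q F ^ (L - x₁.natDegree) * q F ^ (L - x₂.natDegree) := by
    intro L
    rw [← card_polysLT, ← card_polysLT, ← Finset.card_product]
    symm
    refine Finset.card_bij (fun p _ => up (QuadExt a) p.1 * x₁ + up (QuadExt a) p.2 * x₂) ?_ ?_ ?_
    · rintro ⟨s, t⟩ hst
      rw [Finset.mem_product, mem_polysLT, mem_polysLT] at hst
      rw [Finset.mem_filter, mem_polysLT]
      exact ⟨(hdeg s t L).2 hst, hmem s t⟩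
    · rintro ⟨s, t⟩ _ ⟨s', t'⟩ _ h
      obtain ⟨rfl, rfl⟩ := hinj s t s' t' h
      rfl
    · intro x hx
      rw [Finset.mem_filter, mem_polysLT] at hx
      obtain ⟨s, t, rfl⟩ := hgen x hx.2
      refine ⟨(s, t), ?_, rfl⟩
      rw [Finset.mem_product, mem_polysLT, mem_polysLT]
      exact (hdeg s t L).1 hx.1
  -- `𝔣` and `𝔣 j` have degree `deg 𝔣` and are independent
  have hm2 : x₂.natDegree ≤ 𝔣.natDegree := by
    by_contra hlt
    have h3 : ∀ {x : (QuadExt a)[X]}, x ∈ lineLat u → x.degree < (𝔣.natDegree + 1 : ℕ) →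
        ∃ s : F[X], x = up (QuadExt a) s * x₁ := by
      intro x hx hxd
      obtain ⟨s, t, rfl⟩ := hgen x hx
      have h4 := ((hdeg s t _).1 hxd).2
      rw [Nat.sub_eq_zero_of_le (by omega)] at h4
      have ht : t = 0 := by
        by_contra ht0
        exact absurd h4 (not_lt.2 (zero_le_degree_iff.2 ht0))
      exact ⟨s, by rw [ht, map_zero, zero_mul, add_zero]⟩
    have hd1 : (up (QuadExt a) 𝔣 * 1).degree < (𝔣.natDegree + 1 : ℕ) := by
      rw [mul_one, degree_up, degree_eq_natDegree h𝔣.ne_zero]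
      exact_mod_cast Nat.lt_succ_self _
    have hd2 : (up (QuadExt a) 𝔣 * sqrtPoly a).degree < (𝔣.natDegree + 1 : ℕ) := by
      rw [degree_mul, degree_up, degree_eq_natDegree h𝔣.ne_zero]
      refine lt_of_le_of_lt (add_le_add_right degree_C_le _) ?_
      rw [add_zero]
      exact_mod_cast Nat.lt_succ_self _
    obtain ⟨s, hs⟩ := h3 (up_conductor_mul_mem_lineLat u 1) hd1
    obtain ⟨t, ht⟩ := h3 (up_conductor_mul_mem_lineLat u (sqrtPoly a)) hd2
    have h4 : up (QuadExt a) (t * 𝔣) + sqrtPoly a * up (QuadExt a) (0 : F[X])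
        = up (QuadExt a) (0 : F[X]) + sqrtPoly a * up (QuadExt a) (s * 𝔣) := by
      rw [map_zero, map_mul, map_mul]
      linear_combination up (QuadExt a) t * hs - up (QuadExt a) s * ht
    have h5 := (up_add_inj h4).2
    have hs0 : s = 0 := (mul_eq_zero.1 h5.symm).resolve_right h𝔣.ne_zero
    rw [hs0, map_zero, zero_mul, mul_one] at hs
    exact up_ne_zero h𝔣.ne_zero hs
  have hsum : x₁.natDegree + x₂.natDegree = 𝔣.natDegree := by
    have h3 := hcount 𝔣.natDegree
    rw [card_lineLat_eq_sum h𝔣] at h3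
    simp only [card_fiber_eq_one h𝔣] at h3
    rw [Finset.sum_const, smul_eq_mul, mul_one, card_polysLT, ← pow_add] at h3
    have h4 := Nat.pow_right_injective (one_lt_card_q (F := F)) h3
    omega
  refine ⟨⟨iota a x₂ / iota a x₁, ?_⟩, ?_, x₁.natDegree, x₂.natDegree - x₁.natDegree, by omega,
    ?_, ?_⟩
  · rintro ⟨α, hα⟩
    have h3 := hmax α (-1)
    rw [hα, map_neg, map_one, div_mul_cancel₀ _ hi1, neg_one_mul, add_neg_cancel, norm_zero] at h3
    have h4 : 0 < ‖(-1 : KInf F)‖ * (q F : ℝ) ^ x₂.natDegree := by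
      rw [norm_neg, norm_one, one_mul]
      positivity
    exact absurd (h4.trans_le ((le_max_right _ _).trans h3.symm.le)) (lt_irrefl _)
  · refine ⟨(iota a x₁)⁻¹, inv_ne_zero hi1, fun l => ⟨?_, ?_⟩⟩
    · rintro ⟨s, t, rfl⟩
      refine ⟨_, hmem s t, ?_⟩
      simp only [map_add, map_mul, iota_up]
      field_simp
    · rintro ⟨y, hy, rfl⟩
      obtain ⟨s, t, rfl⟩ := hgen y hy
      refine ⟨s, t, ?_⟩
      simp only [map_add, map_mul, iota_up]
      field_simp
  · refine isBuildingVertex_iff.2 ⟨1, one_pos, fun w => ?_⟩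
    have hP : (0 : ℝ) < (q F : ℝ) ^ x₁.natDegree := by positivity
    have h3 := hmax (w 1) (w 0)
    have h4 : algebraMap (KInf F) (CInf F) (w 1) * iota a x₁
        + algebraMap (KInf F) (CInf F) (w 0) * iota a x₂
        = (algebraMap (KInf F) (CInf F) (w 0) * (iota a x₂ / iota a x₁)
          + algebraMap (KInf F) (CInf F) (w 1)) * iota a x₁ := by
      field_simp
      ring
    rw [h4, norm_mul, norm_iota h1] at h3
    rw [latNorm_gLattice, one_mul]
    change _ = ‖_‖
    apply mul_right_cancel₀ hP.ne'
    rw [h3, max_mul_of_nonneg _ _ hP.le, max_comm, pow_sub₀ _ hQ0.ne' hle]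
    congr 1
    field_simp
  · intro L hL
    rw [hcount, Nat.sub_eq_zero_of_le (by omega : L ≤ x₂.natDegree), pow_zero, mul_one]

end Representatives

/-! ### The class group of `𝒪_D` -/

section ClassGroups

/-- The ring of multipliers of an invertible ideal of `R` is `R`. -/
theorem mem_of_mul_mem_ideal {K : Type*} [Field K] {R : Subring K} {I J : Ideal R} {δ : R}
    (hδ : δ ≠ 0) (hIJ : I * J = Ideal.span {δ}) {m : K} (hm : ∀ x ∈ I, ∃ y ∈ I, m * x.1 = y.1) :
    m ∈ R := by
  have h : ∀ x ∈ I * J, ∃ y ∈ I * J, m * x.1 = y.1 := by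
    intro x hx
    induction hx using Submodule.mul_induction_on' with
    | mem_mul_mem i hi j hj =>
      obtain ⟨y, hy, he⟩ := hm i hi
      refine ⟨y * j, Ideal.mul_mem_mul hy hj, ?_⟩
      rw [Subring.coe_mul, ← mul_assoc, he, Subring.coe_mul]
    | add x _ y _ hx hy =>
      obtain ⟨x', hx', hex⟩ := hx
      obtain ⟨y', hy', hey⟩ := hy
      refine ⟨x' + y', add_mem hx' hy', ?_⟩
      rw [Subring.coe_add, mul_add, hex, hey, Subring.coe_add]
  obtain ⟨y, hy, he⟩ := h δ (hIJ ▸ Ideal.mem_span_singleton_self δ)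
  rw [hIJ, Ideal.mem_span_singleton] at hy
  obtain ⟨r, rfl⟩ := hy
  have hδ' : δ.1 ≠ 0 := fun h => hδ (Subtype.ext h)
  have hmr : m = r.1 := by
    apply mul_left_cancel₀ hδ'
    rw [mul_comm, he, Subring.coe_mul]
  rw [hmr]
  exact r.2

open scoped nonZeroDivisors

theorem isUnit_coeIdeal_of_mul_eq_span {R : Type*} [CommRing R] [IsDomain R] {I J : Ideal R} {δ : R}
    (hδ : δ ≠ 0) (h : I * J = Ideal.span {δ}) :
    IsUnit (I : FractionalIdeal R⁰ (FractionRing R)) := by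
  have hδ' : algebraMap R (FractionRing R) δ ≠ 0 :=
    (map_ne_zero_iff _ (IsFractionRing.injective R (FractionRing R))).2 hδ
  refine IsUnit.of_mul_eq_one
    (J * FractionalIdeal.spanSingleton R⁰ (algebraMap R (FractionRing R) δ)⁻¹) ?_
  rw [← mul_assoc, ← FractionalIdeal.coeIdeal_mul, h, FractionalIdeal.coeIdeal_span_singleton,
    FractionalIdeal.spanSingleton_mul_spanSingleton, mul_inv_cancel₀ hδ',
    FractionalIdeal.spanSingleton_one]

theorem exists_mul_eq_span_of_isUnit {R : Type*} [CommRing R] [IsDomain R] {I : Ideal R}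
    (h : IsUnit (I : FractionalIdeal R⁰ (FractionRing R))) :
    ∃ (J : Ideal R) (δ : R), δ ≠ 0 ∧ I * J = Ideal.span {δ} := by
  obtain ⟨J, hJ⟩ := h.exists_right_inv
  refine ⟨J.num, J.den, nonZeroDivisors.coe_ne_zero _, ?_⟩
  apply FractionalIdeal.coeIdeal_injective (R := R) (K := FractionRing R)
  change ((I * J.num : Ideal R) : FractionalIdeal R⁰ (FractionRing R)) = (Ideal.span _ : Ideal R)
  rw [FractionalIdeal.coeIdeal_mul, ← FractionalIdeal.den_mul_self_eq_num',
    FractionalIdeal.coeIdeal_span_singleton, mul_left_comm, hJ, mul_one]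

/-- Every ideal class of a domain is the class of an integral invertible ideal. -/
theorem exists_ideal_mk_eq {R : Type*} [CommRing R] [IsDomain R] (x : ClassGroup R) :
    ∃ I : (FractionalIdeal R⁰ (FractionRing R))ˣ, ∃ I' : Ideal R,
      (I : FractionalIdeal R⁰ (FractionRing R)) = I' ∧ ClassGroup.mk (FractionRing R) I = x := by
  refine ClassGroup.induction (FractionRing R) (fun I => ?_) x
  have hu : IsUnit ((I : FractionalIdeal R⁰ (FractionRing R)).num :
      FractionalIdeal R⁰ (FractionRing R)) := FractionalIdeal.isUnit_num.2 I.isUnit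
  refine ⟨hu.unit, _, IsUnit.unit_spec hu, ?_⟩
  have hd : algebraMap R (FractionRing R) (I : FractionalIdeal R⁰ (FractionRing R)).den ≠ 0 :=
    (map_ne_zero_iff _ (IsFractionRing.injective R (FractionRing R))).2
      (nonZeroDivisors.coe_ne_zero _)
  symm
  rw [ClassGroup.mk_eq_mk]
  refine ⟨Units.mk0 _ hd, ?_⟩
  rw [Units.ext_iff, Units.val_mul, coe_toPrincipalIdeal, Units.val_mk0, IsUnit.unit_spec, mul_comm]
  exact FractionalIdeal.den_mul_self_eq_num' _ _ _

end ClassGroups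

section LineIdeals

variable {F : Type*} [Field F] [Fintype F] {a : F} [Fact (∀ r : F, r ^ 2 ≠ a + 0 * r)] {𝔣 : F[X]}

open scoped nonZeroDivisors

instance (D : F[X]) : IsDomain (order D) :=
  Function.Injective.isDomain (order D).subtype Subtype.val_injective

/-- The ideal `𝔣 (u A + 𝔣 B)` of `𝒪_D`. -/
def lineIdeal (u : (ResRing (QuadExt a) 𝔣)ˣ) : Ideal (order (C a * 𝔣 ^ 2)) where
  carrier := {x | ∃ y ∈ lineLat u, x.1 = iota a (up (QuadExt a) 𝔣 * y)}
  zero_mem' := ⟨0, zero_mem _, by rw [mul_zero, map_zero]; rfl⟩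
  add_mem' := by
    rintro x y ⟨x', hx', hx⟩ ⟨y', hy', hy⟩
    refine ⟨x' + y', add_mem hx' hy', ?_⟩
    rw [Subring.coe_add, hx, hy, ← map_add, mul_add]
  smul_mem' := by
    rintro r x ⟨x', hx', hx⟩
    obtain ⟨r', hr', hr⟩ := mem_order_iff.1 r.2
    refine ⟨r' * x', ?_, ?_⟩
    · have := mul_mem_lineLat hr' hx'
      rwa [one_mul] at this
    · rw [smul_eq_mul, Subring.coe_mul, hx, ← hr, ← map_mul]
      congr 1
      ring

variable (a 𝔣) in
/-- The element `𝔣 b` of `𝒪_D`, for `b` in `B`. -/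
def conductorMul (b : (QuadExt a)[X]) : order (C a * 𝔣 ^ 2) :=
  ⟨iota a (up (QuadExt a) 𝔣 * b), iota_mem_order_iff.2 (up_conductor_mul_mem_lineLat 1 b)⟩

theorem coe_conductorMul (b : (QuadExt a)[X]) :
    (conductorMul a 𝔣 b : CInf F) = iota a (up (QuadExt a) 𝔣 * b) := rfl

theorem conductorMul_ne_zero (h𝔣 : 𝔣 ≠ 0) {b : (QuadExt a)[X]} (hb : b ≠ 0) :
    conductorMul a 𝔣 b ≠ 0 := by
  intro h
  have h1 : iota a (up (QuadExt a) 𝔣 * b) = 0 := congrArg Subtype.val h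
  rw [map_eq_zero_iff _ iota_injective] at h1
  exact mul_ne_zero (up_ne_zero h𝔣) hb h1

theorem conductorMul_mem_lineIdeal {u : (ResRing (QuadExt a) 𝔣)ˣ} {y : (QuadExt a)[X]}
    (hy : y ∈ lineLat u) : conductorMul a 𝔣 y ∈ lineIdeal u := ⟨y, hy, rfl⟩

theorem mem_span_conductorMul_mul_lineIdeal {u : (ResRing (QuadExt a) 𝔣)ˣ} {c : (QuadExt a)[X]}
    {x : order (C a * 𝔣 ^ 2)} : x ∈ Ideal.span {conductorMul a 𝔣 c} * lineIdeal u ↔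
      ∃ w ∈ lineLat u, x.1 = iota a (up (QuadExt a) 𝔣 * up (QuadExt a) 𝔣 * (c * w)) := by
  have e : ∀ w : (QuadExt a)[X], iota a (up (QuadExt a) 𝔣 * c) * iota a (up (QuadExt a) 𝔣 * w)
      = iota a (up (QuadExt a) 𝔣 * up (QuadExt a) 𝔣 * (c * w)) := fun w => by
    rw [← map_mul, mul_mul_mul_comm]
  rw [Ideal.mem_span_singleton_mul]
  constructor
  · rintro ⟨t, ⟨w, hw, ht⟩, rfl⟩
    exact ⟨w, hw, by rw [Subring.coe_mul, ht, coe_conductorMul, e]⟩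
  · rintro ⟨w, hw, hx⟩
    refine ⟨conductorMul a 𝔣 w, conductorMul_mem_lineIdeal hw, Subtype.ext ?_⟩
    rw [Subring.coe_mul, coe_conductorMul, coe_conductorMul, e, hx]

/-- The ideal of the line `u A + 𝔣 B` is invertible, its inverse being given by `u⁻¹`. -/
theorem lineIdeal_mul_lineIdeal_inv (u : (ResRing (QuadExt a) 𝔣)ˣ) :
    lineIdeal u * lineIdeal u⁻¹ = Ideal.span {conductorMul a 𝔣 (up (QuadExt a) 𝔣)} := by
  apply le_antisymm
  · rw [Ideal.mul_le]
    rintro x ⟨x', hx', hx⟩ y ⟨y', hy', hy⟩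
    rw [Ideal.mem_span_singleton]
    have h := mul_mem_lineLat hx' hy'
    rw [mul_inv_cancel] at h
    refine ⟨⟨_, iota_mem_order_iff.2 h⟩, Subtype.ext ?_⟩
    rw [Subring.coe_mul, Subring.coe_mul, hx, hy, conductorMul, ← map_mul, ← map_mul]
    congr 1
    ring
  · rw [Ideal.span_le, Set.singleton_subset_iff, SetLike.mem_coe]
    obtain ⟨v, hv⟩ := Ideal.Quotient.mk_surjective u.1
    obtain ⟨w, hw⟩ := Ideal.Quotient.mk_surjective (u⁻¹).1
    obtain ⟨α, β, hαβ⟩ := isUnit_res.1 (hv ▸ u.isUnit : IsUnit (res (QuadExt a) 𝔣 v))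
    have hvw : res (QuadExt a) 𝔣 1 = res (QuadExt a) 𝔣 (v * w) := by
      rw [map_mul, hv, hw, Units.mul_inv, map_one]
    obtain ⟨b, hb⟩ := res_eq_res.1 hvw
    have hvm := conductorMul_mem_lineIdeal (mem_lineLat_of_res_eq hv)
    have hwm := conductorMul_mem_lineIdeal (mem_lineLat_of_res_eq hw)
    have hfm : ∀ (u : (ResRing (QuadExt a) 𝔣)ˣ) b,
        conductorMul a 𝔣 (up (QuadExt a) 𝔣 * b) ∈ lineIdeal u :=
      fun u b => conductorMul_mem_lineIdeal (up_conductor_mul_mem_lineLat u b)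
    -- `1 = v w + 𝔣 b` with `𝔣 b = v (𝔣 α b) + 𝔣 (𝔣 β b)`
    have e : conductorMul a 𝔣 (up (QuadExt a) 𝔣) = conductorMul a 𝔣 v * conductorMul a 𝔣 w
        + (conductorMul a 𝔣 v * conductorMul a 𝔣 (up (QuadExt a) 𝔣 * (α * b))
          + conductorMul a 𝔣 (up (QuadExt a) 𝔣 * 1)
            * conductorMul a 𝔣 (up (QuadExt a) 𝔣 * (β * b))) := by
      apply Subtype.ext
      simp only [conductorMul, Subring.coe_add, Subring.coe_mul, ← map_mul, ← map_add]
      congr 1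
      simp only [map_mul]
      linear_combination up (QuadExt a) 𝔣 ^ 2 * hb - up (QuadExt a) 𝔣 ^ 3 * b * hαβ
    rw [e]
    exact add_mem (Ideal.mul_mem_mul hvm hwm)
      (add_mem (Ideal.mul_mem_mul hvm (hfm _ _)) (Ideal.mul_mem_mul (hfm _ _) (hfm _ _)))

theorem isUnit_lineIdeal (h𝔣 : 𝔣 ≠ 0) (u : (ResRing (QuadExt a) 𝔣)ˣ) :
    IsUnit (lineIdeal u : FractionalIdeal (order (C a * 𝔣 ^ 2))⁰
      (FractionRing (order (C a * 𝔣 ^ 2)))) :=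
  isUnit_coeIdeal_of_mul_eq_span (conductorMul_ne_zero h𝔣 (up_ne_zero h𝔣))
    (lineIdeal_mul_lineIdeal_inv u)

/-- The ideal class of the line `u A + 𝔣 B`. -/
def lineClass (h𝔣 : 𝔣 ≠ 0) (u : (ResRing (QuadExt a) 𝔣)ˣ) : ClassGroup (order (C a * 𝔣 ^ 2)) :=
  ClassGroup.mk (FractionRing (order (C a * 𝔣 ^ 2))) (isUnit_lineIdeal h𝔣 u).unit

theorem lineClass_eq_iff (h𝔣 : 𝔣 ≠ 0) {u u' : (ResRing (QuadExt a) 𝔣)ˣ} :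
    lineClass h𝔣 u = lineClass h𝔣 u' ↔ LineSim u u' := by
  have hf0 : iota a (up (QuadExt a) 𝔣) ≠ 0 := (map_ne_zero_iff _ iota_injective).2 (up_ne_zero h𝔣)
  rw [lineClass, lineClass, ClassGroup.mk_eq_mk_of_coe_ideal (IsUnit.unit_spec _)
    (IsUnit.unit_spec _)]
  constructor
  · rintro ⟨x, y, hx, hy, h⟩
    have hx' : x.1 ≠ 0 := fun h => hx (Subtype.ext h)
    have hy' : y.1 ≠ 0 := fun h => hy (Subtype.ext h)
    refine lineSim_of_smul (c := y.1⁻¹ * x.1) (mul_ne_zero (inv_ne_zero hy') hx') ?_ ?_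
    · intro w hw
      have h1 : x * conductorMul a 𝔣 w ∈ Ideal.span {y} * lineIdeal u' :=
        h ▸ Ideal.mul_mem_mul (Ideal.mem_span_singleton_self x) (conductorMul_mem_lineIdeal hw)
      obtain ⟨t, ⟨w', hw', ht⟩, he⟩ := Ideal.mem_span_singleton_mul.1 h1
      have he2 := congrArg Subtype.val he
      rw [Subring.coe_mul, Subring.coe_mul, ht, coe_conductorMul, map_mul, map_mul] at he2
      refine ⟨w', hw', ?_⟩
      rw [mul_assoc, inv_mul_eq_iff_eq_mul₀ hy']
      apply mul_left_cancel₀ hf0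
      linear_combination -he2
    · intro w' hw'
      have h1 : y * conductorMul a 𝔣 w' ∈ Ideal.span {x} * lineIdeal u :=
        h ▸ Ideal.mul_mem_mul (Ideal.mem_span_singleton_self y) (conductorMul_mem_lineIdeal hw')
      obtain ⟨t, ⟨w, hw, ht⟩, he⟩ := Ideal.mem_span_singleton_mul.1 h1
      have he2 := congrArg Subtype.val he
      rw [Subring.coe_mul, Subring.coe_mul, ht, coe_conductorMul, map_mul, map_mul] at he2
      refine ⟨w, hw, ?_⟩
      rw [mul_assoc, inv_mul_eq_iff_eq_mul₀ hy']
      apply mul_left_cancel₀ hf0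
      linear_combination he2
  · rintro ⟨e, he, hs⟩
    refine ⟨conductorMul a 𝔣 (C e), conductorMul a 𝔣 1, conductorMul_ne_zero h𝔣 (C_ne_zero.2 he),
      conductorMul_ne_zero h𝔣 one_ne_zero, ?_⟩
    ext x
    rw [mem_span_conductorMul_mul_lineIdeal, mem_span_conductorMul_mul_lineIdeal]
    constructor
    · rintro ⟨w, hw, hx⟩
      exact ⟨C e * w, (hs w).1 hw, by rw [hx, one_mul]⟩
    · rintro ⟨w, hw, hx⟩
      have hw2 : C e * (C e⁻¹ * w) = w := by
        rw [← mul_assoc, ← C_mul, mul_inv_cancel₀ he, C_1, one_mul]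
      exact ⟨C e⁻¹ * w, (hs _).2 (hw2.symm ▸ hw), by rw [hx, hw2, one_mul]⟩

theorem lineClass_surjective (h𝔣 : 𝔣 ≠ 0) :
    Function.Surjective (lineClass (a := a) h𝔣) := by
  intro x
  obtain ⟨I, I', hI, rfl⟩ := exists_ideal_mk_eq x
  obtain ⟨J, δ, hδ, hIJ⟩ := exists_mul_eq_span_of_isUnit (hI ▸ I.isUnit)
  -- `I'` as a lattice in `B`
  let M : AddSubgroup (QuadExt a)[X] :=
    { carrier := {x | ∃ y ∈ I', iota a x = y.1}
      zero_mem' := ⟨0, zero_mem _, map_zero _⟩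
      add_mem' := by
        rintro x y ⟨x', hx', hx⟩ ⟨y', hy', hy⟩
        exact ⟨x' + y', add_mem hx' hy', by rw [map_add, hx, hy]; rfl⟩
      neg_mem' := by
        rintro x ⟨x', hx', hx⟩
        exact ⟨-x', neg_mem hx', by rw [map_neg, hx]; rfl⟩ }
  have hmul : ∀ {m x : (QuadExt a)[X]}, iota a m ∈ order (C a * 𝔣 ^ 2) → x ∈ M → m * x ∈ M := by
    rintro m x hm ⟨y, hy, hx⟩
    refine ⟨⟨_, hm⟩ * y, I'.mul_mem_left _ hy, ?_⟩
    rw [map_mul, hx]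
    rfl
  have hlift : ∀ y ∈ I', ∃ x ∈ M, iota a x = y.1 := by
    intro y hy
    obtain ⟨x, -, hx⟩ := mem_order_iff.1 y.2
    exact ⟨x, ⟨y, hy, hx⟩, hx⟩
  have hcm : ∀ m : (QuadExt a)[X], (∀ x ∈ M, m * x ∈ M) → iota a m ∈ order (C a * 𝔣 ^ 2) := by
    intro m hm
    refine mem_of_mul_mem_ideal hδ hIJ fun y hy => ?_
    obtain ⟨x, hx, he⟩ := hlift y hy
    obtain ⟨y', hy', he'⟩ := hm x hx
    exact ⟨y', hy', by rw [← he, ← he', map_mul]⟩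
  have hA : ∀ (s : F[X]), ∀ x ∈ M, up (QuadExt a) s * x ∈ M := fun s x hx =>
    hmul (iota_mem_order_iff.2 (mem_lineLat_one_iff.2 ⟨s, 0, by simp⟩)) hx
  obtain ⟨x₀, hx₀, hx₀0⟩ : ∃ x ∈ M, x ≠ 0 := by
    by_contra hcon
    push Not at hcon
    have h0 : I' = ⊥ := by
      rw [eq_bot_iff]
      intro y hy
      obtain ⟨x, hx, he⟩ := hlift y hy
      rw [hcon x hx, map_zero] at he
      exact (Submodule.mem_bot _).2 (Subtype.ext he.symm)
    rw [h0, Ideal.bot_mul] at hIJ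
    exact hδ (Ideal.span_singleton_eq_bot.1 hIJ.symm)
  obtain ⟨n, hn⟩ := exists_mul_conjPoly x₀
  have hn0 : n ≠ 0 := by
    rintro rfl
    rw [map_zero] at hn
    have h1 := (mul_eq_zero.1 hn).resolve_left hx₀0
    apply hx₀0
    rw [← conjPoly_conjPoly x₀, h1, map_zero]
  obtain ⟨x₁, hx₁, x₂, hx₂, hgen, h1, -⟩ := exists_reduced_generators hA (mul_ne_zero hn0 h𝔣)
    (fun b => by
      have e : up (QuadExt a) (n * 𝔣) * b = up (QuadExt a) 𝔣 * (conjPoly a x₀ * b) * x₀ := by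
        rw [map_mul, ← hn]
        ring
      rw [e]
      exact hmul (iota_mem_order_iff.2 (up_conductor_mul_mem_lineLat 1 _)) hx₀)
  obtain ⟨β, hβ, u, hu⟩ := exists_mem_iff_mul_lineLat h𝔣 hA hx₁ hx₂ h1 hgen
    (fun x hx => hmul iota_conductor_mem_order hx)
    (fun g hg => dvd_of_iota_mul_mem_order (hcm _ hg))
  refine ⟨u, ?_⟩
  rw [lineClass, ClassGroup.mk_eq_mk_of_coe_ideal (IsUnit.unit_spec _) hI]
  refine ⟨conductorMul a 𝔣 β, conductorMul a 𝔣 (up (QuadExt a) 𝔣), conductorMul_ne_zero h𝔣 hβ,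
    conductorMul_ne_zero h𝔣 (up_ne_zero h𝔣), ?_⟩
  have e : ∀ w : (QuadExt a)[X], iota a (up (QuadExt a) 𝔣 * up (QuadExt a) 𝔣 * (β * w))
      = iota a (up (QuadExt a) 𝔣 * up (QuadExt a) 𝔣) * iota a (β * w) := fun w => map_mul _ _ _
  ext x
  rw [mem_span_conductorMul_mul_lineIdeal, Ideal.mem_span_singleton_mul]
  constructor
  · rintro ⟨w, hw, hx⟩
    obtain ⟨y, hy, he⟩ := (hu _).2 ⟨w, hw, rfl⟩
    refine ⟨y, hy, Subtype.ext ?_⟩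
    rw [Subring.coe_mul, coe_conductorMul, hx, e, he]
  · rintro ⟨y, hy, rfl⟩
    obtain ⟨x, hx, he⟩ := hlift y hy
    obtain ⟨w, hw, rfl⟩ := (hu x).1 hx
    refine ⟨w, hw, ?_⟩
    rw [Subring.coe_mul, coe_conductorMul, e, he]

end LineIdeals

/-! ### Averages over the CM points -/

section Averages

theorem card_range_eq_of_fibers {U α β : Type*} {Φ : U → α} {Ψ : U → β}
    (h : ∀ u u', Φ u = Φ u' ↔ Ψ u = Ψ u') : Nat.card (Set.range Φ) = Nat.card (Set.range Ψ) := by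
  have hk : Setoid.ker Φ = Setoid.ker Ψ := Setoid.ext fun u u' => h u u'
  rw [← Nat.card_congr (Setoid.quotientKerEquivRange Φ),
    ← Nat.card_congr (Setoid.quotientKerEquivRange Ψ), hk]

/-- A map on a finite group whose fibers are permuted by left translation has fibers of the same
size, so that averages over its image are averages over the group. -/
theorem average_range_eq {U α : Type*} [Group U] [Fintype U] {Φ : U → α}
    (h : ∀ u u' w, Φ u = Φ u' → Φ (w * u) = Φ (w * u')) (g : α → ℂ) :
    (Nat.card (Set.range Φ) : ℂ)⁻¹ * ∑ᶠ x ∈ Set.range Φ, g x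
      = (Fintype.card U : ℂ)⁻¹ * ∑ u, g (Φ u) := by
  classical
  have hr : Set.range Φ = ((Finset.univ.image Φ : Finset α) : Set α) := by simp
  have hfib : ∀ x ∈ Finset.univ.image Φ,
      (Finset.univ.filter (Φ · = x)).card = (Finset.univ.filter (Φ · = Φ 1)).card := by
    intro x hx
    obtain ⟨w, -, rfl⟩ := Finset.mem_image.1 hx
    symm
    refine Finset.card_bij (fun u _ => w * u) ?_ (fun u _ v _ e => mul_left_cancel e) ?_
    · intro u hu
      rw [Finset.mem_filter] at hu ⊢
      refine ⟨Finset.mem_univ _, ?_⟩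
      rw [h u 1 w hu.2, mul_one]
    · intro u hu
      rw [Finset.mem_filter] at hu
      refine ⟨w⁻¹ * u, ?_, mul_inv_cancel_left w u⟩
      rw [Finset.mem_filter]
      refine ⟨Finset.mem_univ _, ?_⟩
      rw [h u w w⁻¹ hu.2, inv_mul_cancel]
  have hk : (Finset.univ.filter (Φ · = Φ 1)).card ≠ 0 :=
    Finset.card_ne_zero.2 ⟨1, by rw [Finset.mem_filter]; exact ⟨Finset.mem_univ _, rfl⟩⟩
  have hs0 : (Finset.univ.image Φ).card ≠ 0 :=
    Finset.card_ne_zero.2 ⟨Φ 1, Finset.mem_image_of_mem _ (Finset.mem_univ _)⟩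
  have hU : Fintype.card U
      = (Finset.univ.image Φ).card * (Finset.univ.filter (Φ · = Φ 1)).card := by
    rw [← Finset.card_univ, Finset.card_eq_sum_card_image Φ, Finset.sum_congr rfl hfib,
      Finset.sum_const, smul_eq_mul]
  have hsum : ∑ u, g (Φ u) = ((Finset.univ.filter (Φ · = Φ 1)).card : ℂ)
      * ∑ x ∈ Finset.univ.image Φ, g x := by
    rw [Finset.sum_comp, Finset.mul_sum]
    refine Finset.sum_congr rfl fun x hx => ?_
    rw [hfib x hx, nsmul_eq_mul]
  rw [hsum, hU, hr, finsum_mem_coe_finset, Nat.card_coe_set_eq, Set.ncard_coe_finset]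
  have h1 : ((Finset.univ.image Φ).card : ℂ) ≠ 0 := by exact_mod_cast hs0
  have h2 : ((Finset.univ.filter (Φ · = Φ 1)).card : ℂ) ≠ 0 := by exact_mod_cast hk
  push_cast
  field_simp

variable {F : Type*} [Field F] [Fintype F] {a : F} [Fact (∀ r : F, r ^ 2 ≠ a + 0 * r)] {𝔣 : F[X]}

open scoped Classical in
/-- The CM points are the lines `u ∈ (B / 𝔣 B)ˣ` up to similarity, each point arising from the same
number of lines; `m u` is the first minimum of the lattice `u A + 𝔣 B`, whose position in the
quotient of the tree is the vertex `v_n` with `n = deg 𝔣 - 2 m`. -/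
theorem exists_average_CM (h𝔣 : 𝔣.Monic) [Fintype (ResRing (QuadExt a) 𝔣)ˣ] :
    (CM (C a * 𝔣 ^ 2)).Finite ∧
    (∀ z : Omega F, z.toY ∈ CM (C a * 𝔣 ^ 2) → ∃ L : OLattice F, IsBuildingVertex z L) ∧
    ∃ m : (ResRing (QuadExt a) 𝔣)ˣ → ℕ, (∀ u, 2 * m u ≤ 𝔣.natDegree) ∧
      (∀ u L, 2 * L ≤ 𝔣.natDegree + 1 →
        ((polysLT (QuadExt a) L).filter (· ∈ lineLat u)).card = q F ^ (L - m u)) ∧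
      ∀ g : QVertex F → ℂ,
        (classNumber (C a * 𝔣 ^ 2) : ℂ)⁻¹ * (∑ᶠ x ∈ CM (C a * 𝔣 ^ 2), g (lambdaBar x))
          = (Fintype.card (ResRing (QuadExt a) 𝔣)ˣ : ℂ)⁻¹
            * ∑ u, g (vtx F (𝔣.natDegree - 2 * m u)) := by
  choose z hz m n hmn hv hc using exists_omega_of_line (a := a) h𝔣
  have hsim : ∀ u u', (z u).toY = (z u').toY ↔ LineSim u u' := fun u u' =>
    toY_eq_iff_lineSim (hz u) (hz u')
  have hrange : CM (C a * 𝔣 ^ 2) = Set.range fun u => (z u).toY := by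
    ext x
    rw [mem_CM_iff]
    constructor
    · rintro ⟨w, rfl, hw⟩
      obtain ⟨u, hu⟩ := exists_hasLine h𝔣.ne_zero hw
      refine ⟨u, ?_⟩
      exact (toY_eq_iff_lineSim (hz u) hu).2 ((hsim u u).1 rfl)
    · rintro ⟨u, rfl⟩
      exact ⟨z u, rfl, multipliers_eq_order (hz u)⟩
  have hcard : classNumber (C a * 𝔣 ^ 2) = Nat.card (Set.range fun u => (z u).toY) := by
    rw [card_range_eq_of_fibers (Ψ := lineClass (a := a) h𝔣.ne_zero) (fun u u' =>
      (hsim u u').trans (lineClass_eq_iff h𝔣.ne_zero).symm), (lineClass_surjective _).range_eq,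
      Nat.card_congr (Equiv.Set.univ _)]
    rfl
  refine ⟨hrange ▸ Set.finite_range _, ?_, m, fun u => by have := hmn u; omega, hc, fun g => ?_⟩
  · intro w hw
    rw [hrange] at hw
    obtain ⟨u, hu⟩ := hw
    obtain ⟨γ, hγ⟩ : ∃ γ : GL (Fin 2) F[X], w.1 = moebius γ (z u).1 := Quotient.exact hu
    exact isBuildingVertex_of_moebius hγ (hv u)
  · rw [hcard, hrange,
      average_range_eq (fun u u' w h => (hsim _ _).2 (((hsim _ _).1 h).mul_left w))]
    congr 1
    refine Finset.sum_congr rfl fun u _ => ?_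
    have hn : n u = 𝔣.natDegree - 2 * m u := by have := hmn u; omega
    rw [lambdaBar_toY (hv u), ← hn]
    rfl

end Averages

/-! ### The distribution of the first minima and the error term -/

section Distribution

variable {U : Type*} [Fintype U] [Nonempty U] {Q d : ℕ} {m : U → ℕ} {E : ℝ}

/-- If a lattice with first minimum `m` has `Q ^ (L - m)` points of degree `< L`, then the
combination `N (L + 1) - Q N L` of its counting function detects whether `m > L`. -/
theorem abs_card_firstMin_le_sub (hQ : 2 ≤ Q)
    (hS : ∀ L, 2 * L ≤ d + 1 → |((∑ u, Q ^ (L - m u) : ℕ) : ℝ) / Fintype.card U - 1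
      - (Q : ℝ) ^ (2 * L) / (Q : ℝ) ^ d| ≤ E * ((Q : ℝ) ^ L / (Q : ℝ) ^ d))
    {L : ℕ} (hL : 2 * L + 1 ≤ d) :
    |((Finset.univ.filter (m · ≤ L)).card : ℝ) / Fintype.card U
      - (Q : ℝ) * (Q : ℝ) ^ (2 * L) / (Q : ℝ) ^ d| ≤ 4 * E * ((Q : ℝ) ^ L / (Q : ℝ) ^ d) := by
  have hQ2 : (2 : ℝ) ≤ Q := by exact_mod_cast hQ
  have hU : (0 : ℝ) < Fintype.card U := by exact_mod_cast Fintype.card_pos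
  have hQd : (0 : ℝ) < (Q : ℝ) ^ d := by positivity
  have hQL : (0 : ℝ) < (Q : ℝ) ^ L := by positivity
  have h1 := hS L (by omega)
  have h2 := hS (L + 1) (by omega)
  have hrel : ((∑ u, Q ^ (L + 1 - m u) : ℕ) : ℝ) - Q * ((∑ u, Q ^ (L - m u) : ℕ) : ℝ)
      = (Q - 1) * ((Finset.univ.filter (m · ≤ L)).card - Fintype.card U) := by
    have hterm : ∀ u, (Q : ℝ) ^ (L + 1 - m u) - Q * (Q : ℝ) ^ (L - m u)
        = (Q - 1) * ((if m u ≤ L then 1 else 0) - 1) := by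
      intro u
      split_ifs with h
      · rw [Nat.succ_sub h, pow_succ]
        ring
      · rw [Nat.sub_eq_zero_of_le (by omega : L + 1 ≤ m u),
          Nat.sub_eq_zero_of_le (by omega : L ≤ m u)]
        ring
    push_cast
    rw [Finset.mul_sum, ← Finset.sum_sub_distrib, Finset.sum_congr rfl fun u _ => hterm u,
      ← Finset.mul_sum, Finset.sum_sub_distrib, Finset.sum_boole, Finset.sum_const,
      Finset.card_univ, nsmul_one]
  set S₁ := ((∑ u, Q ^ (L - m u) : ℕ) : ℝ) / Fintype.card U with hS₁
  set S₂ := ((∑ u, Q ^ (L + 1 - m u) : ℕ) : ℝ) / Fintype.card U with hS₂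
  set P := ((Finset.univ.filter (m · ≤ L)).card : ℝ) / Fintype.card U with hP
  have hrel2 : S₂ - Q * S₁ = (Q - 1) * (P - 1) := by
    rw [hS₁, hS₂, hP]
    field_simp
    linear_combination hrel
  set x := (Q : ℝ) ^ L / (Q : ℝ) ^ d with hx
  set y := (Q : ℝ) ^ (2 * L) / (Q : ℝ) ^ d with hy
  have e1 : (Q : ℝ) ^ (L + 1) / (Q : ℝ) ^ d = Q * x := by rw [hx, pow_succ]; ring
  have e2 : (Q : ℝ) ^ (2 * (L + 1)) / (Q : ℝ) ^ d = Q ^ 2 * y := by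
    rw [hy, mul_add, pow_add]; ring
  have e3 : (Q : ℝ) * (Q : ℝ) ^ (2 * L) / (Q : ℝ) ^ d = Q * y := by rw [hy]; ring
  rw [e1, e2] at h2
  rw [e3]
  have hx0 : 0 < x := by positivity
  have hE0 : 0 ≤ E * x := (abs_nonneg _).trans h1
  have h3 : (Q - 1) * (P - Q * y) = (S₂ - 1 - Q ^ 2 * y) - Q * (S₁ - 1 - y) := by
    linear_combination -hrel2
  have h4 : (Q - 1) * |P - Q * y| ≤ (Q - 1) * (4 * (E * x)) := by
    have h5 : |(Q - 1 : ℝ) * (P - Q * y)| = (Q - 1) * |P - Q * y| := by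
      rw [abs_mul, abs_of_nonneg (by linarith)]
    rw [← h5, h3]
    refine (abs_sub _ _).trans ?_
    rw [abs_mul, abs_of_nonneg (by linarith : (0 : ℝ) ≤ Q)]
    have h6 : (Q : ℝ) * |S₁ - 1 - y| ≤ Q * (E * x) :=
      mul_le_mul_of_nonneg_left h1 (by linarith)
    nlinarith
  have h7 := le_of_mul_le_mul_left h4 (by linarith)
  linarith

/-- The proportion of lattices with first minimum `L` is close to `2 μ(v_n)`, `n = d - 2 L`. -/
theorem abs_card_firstMin_eq_sub (hQ : 2 ≤ Q) (hm : ∀ u, 2 * m u ≤ d) (hE : 1 ≤ E)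
    (hS : ∀ L, 2 * L ≤ d + 1 → |((∑ u, Q ^ (L - m u) : ℕ) : ℝ) / Fintype.card U - 1
      - (Q : ℝ) ^ (2 * L) / (Q : ℝ) ^ d| ≤ E * ((Q : ℝ) ^ L / (Q : ℝ) ^ d))
    {L n : ℕ} (hL : 2 * L + n = d) :
    |((Finset.univ.filter (m · = L)).card : ℝ) / Fintype.card U - 2 * vtxMass Q n|
      ≤ 8 * E * ((Q : ℝ) ^ L / (Q : ℝ) ^ d) := by
  classical
  have hQ2 : (2 : ℝ) ≤ Q := by exact_mod_cast hQ
  have hU : (0 : ℝ) < Fintype.card U := by exact_mod_cast Fintype.card_pos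
  have hQd : (0 : ℝ) < (Q : ℝ) ^ d := by positivity
  have hsplit : ((Finset.univ.filter (m · ≤ L)).card : ℝ) / Fintype.card U
      = ((Finset.univ.filter (m · = L)).card : ℝ) / Fintype.card U
        + ((Finset.univ.filter (m · < L)).card : ℝ) / Fintype.card U := by
    rw [← add_div]
    congr 1
    norm_cast
    rw [← Finset.card_union_of_disjoint]
    · congr 1
      ext u
      simp only [Finset.mem_union, Finset.mem_filter, Finset.mem_univ, true_and]
      omega
    · rw [Finset.disjoint_filter]
      intro u _
      omega
  have hlt : |((Finset.univ.filter (m · < L)).card : ℝ) / Fintype.card U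
      - (Q : ℝ) ^ (2 * L) / (Q * (Q : ℝ) ^ d)| ≤ 4 * E * ((Q : ℝ) ^ L / (Q : ℝ) ^ d) := by
    rcases L with _ | L
    · have h0 : Finset.univ.filter (m · < 0) = ∅ := by simp
      rw [h0, Finset.card_empty, Nat.cast_zero, zero_div, zero_sub, abs_neg, mul_zero, pow_zero,
        abs_of_pos (by positivity), div_le_iff₀ (by positivity)]
      field_simp
      nlinarith
    · have h := abs_card_firstMin_le_sub hQ hS (L := L) (by omega)
      have h0 : Finset.univ.filter (m · < L + 1) = Finset.univ.filter (m · ≤ L) := by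
        ext u
        simp only [Finset.mem_filter, Finset.mem_univ, true_and, Nat.lt_succ_iff]
      have h1 : (Q : ℝ) ^ (2 * (L + 1)) / (Q * (Q : ℝ) ^ d)
          = (Q : ℝ) * (Q : ℝ) ^ (2 * L) / (Q : ℝ) ^ d := by
        rw [mul_add, pow_add]
        field_simp
      rw [h0, h1]
      refine h.trans (mul_le_mul_of_nonneg_left ?_ (by linarith))
      gcongr
      · linarith
      · omega
  have hle : |((Finset.univ.filter (m · ≤ L)).card : ℝ) / Fintype.card U
      - ((Q : ℝ) ^ (2 * L) / (Q * (Q : ℝ) ^ d) + 2 * vtxMass Q n)|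
        ≤ 4 * E * ((Q : ℝ) ^ L / (Q : ℝ) ^ d) := by
    rcases Nat.eq_zero_or_pos n with rfl | hn
    · have h0 : Finset.univ.filter (m · ≤ L) = Finset.univ :=
        Finset.filter_true_of_mem fun u _ => by have := hm u; omega
      have h1 : (Q : ℝ) ^ (2 * L) / (Q * (Q : ℝ) ^ d) + 2 * vtxMass Q 0 = 1 := by
        rw [show 2 * L = d by omega, vtxMass, if_pos rfl]
        field_simp
        ring
      rw [h0, h1, Finset.card_univ, div_self hU.ne', sub_self, abs_zero]
      positivity
    · have h := abs_card_firstMin_le_sub hQ hS (L := L) (by omega)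
      have h1 : (Q : ℝ) ^ (2 * L) / (Q * (Q : ℝ) ^ d) + 2 * vtxMass Q n
          = (Q : ℝ) * (Q : ℝ) ^ (2 * L) / (Q : ℝ) ^ d := by
        rw [vtxMass, if_neg hn.ne', ← hL, pow_add _ (2 * L) n]
        field_simp
        ring
      rwa [h1]
  rw [hsplit] at hle
  have h := (abs_sub _ _).trans (add_le_add hle hlt)
  refine le_trans (le_of_eq ?_) (h.trans (le_of_eq ?_))
  · congr 1
    ring
  · ring

/-- The average of `g (d - 2 m)` against twice the integral of `g`, where `g n = O(s ^ n)`,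
`s = √Q`, vanishes for the `n` that have not the parity of `d`. -/
theorem norm_average_sub_le (hQ : 2 ≤ Q) (hm : ∀ u, 2 * m u ≤ d) (hE : 1 ≤ E)
    (hS : ∀ L, 2 * L ≤ d + 1 → |((∑ u, Q ^ (L - m u) : ℕ) : ℝ) / Fintype.card U - 1
      - (Q : ℝ) ^ (2 * L) / (Q : ℝ) ^ d| ≤ E * ((Q : ℝ) ^ L / (Q : ℝ) ^ d))
    {g : ℕ → ℂ} {I : ℂ} (hI : HasSum (fun n => (vtxMass Q n : ℂ) * g n) I)
    {M s : ℝ} (hM : 0 ≤ M) (hs : 1 < s) (hsQ : s ^ 2 = Q) (hg : ∀ n, ‖g n‖ ≤ M * s ^ n)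
    (hpar : ∀ n, g n ≠ 0 → n ≡ d [MOD 2]) :
    ‖(Fintype.card U : ℂ)⁻¹ * ∑ u, g (d - 2 * m u) - 2 * I‖
      ≤ (8 * E * (d + 1) + 2 * Q / (s - 1)) * M / s ^ d := by
  have hs0 : 0 < s := by linarith
  have hQ1 : (1 : ℝ) < Q := by exact_mod_cast hQ
  -- the average as a sum over `n`
  obtain ⟨p, hp⟩ : ∃ p : ℕ → ℝ, ∀ n, p n =
      ((Finset.univ.filter (fun u => d - 2 * m u = n)).card : ℝ) / Fintype.card U :=
    ⟨_, fun _ => rfl⟩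
  have havg : (Fintype.card U : ℂ)⁻¹ * ∑ u, g (d - 2 * m u)
      = ∑ n ∈ Finset.range (d + 1), (p n : ℂ) * g n := by
    rw [← Finset.sum_fiberwise_of_maps_to (s := Finset.univ) (t := Finset.range (d + 1))
      (g := fun u => d - 2 * m u) (fun u _ => Finset.mem_range.2 (by omega)), Finset.mul_sum]
    refine Finset.sum_congr rfl fun n _ => ?_
    rw [Finset.sum_congr rfl (g := fun _ => g n)
      (fun u hu => by rw [(Finset.mem_filter.1 hu).2]), Finset.sum_const, nsmul_eq_mul, hp]
    push_cast
    ring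
  have hterm : ∀ n ∈ Finset.range (d + 1),
      ‖((p n : ℂ) - 2 * vtxMass Q n) * g n‖ ≤ 8 * E * M / s ^ d := by
    intro n hn
    by_cases h0 : g n = 0
    · rw [h0, mul_zero, norm_zero]
      positivity
    have hnd : n ≤ d := Nat.lt_succ_iff.1 (Finset.mem_range.1 hn)
    have h1 := hpar n h0
    obtain ⟨L, hL⟩ : ∃ L, 2 * L + n = d := ⟨(d - n) / 2, by
      have := h1
      unfold Nat.ModEq at this
      omega⟩
    have hpn : p n = ((Finset.univ.filter (m · = L)).card : ℝ) / Fintype.card U := by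
      have h2 : Finset.univ.filter (fun u => d - 2 * m u = n) = Finset.univ.filter (m · = L) :=
        Finset.filter_congr fun u _ => by have := hm u; omega
      rw [hp, h2]
    have h2 := abs_card_firstMin_eq_sub hQ hm hE hS hL
    rw [← hpn] at h2
    have h3 : ‖(p n : ℂ) - 2 * vtxMass Q n‖ = |p n - 2 * vtxMass Q n| := by
      rw [← Real.norm_eq_abs, ← Complex.norm_real]
      push_cast
      rfl
    rw [norm_mul, h3]
    refine (mul_le_mul h2 (hg n) (norm_nonneg _) (by positivity)).trans (le_of_eq ?_)
    have e1 : (Q : ℝ) ^ L * s ^ n = s ^ d := by rw [← hsQ, ← pow_mul, ← pow_add, hL]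
    have e2 : (Q : ℝ) ^ d = s ^ d * s ^ d := by rw [← hsQ, ← pow_mul, mul_comm, pow_mul, sq]
    rw [e2, ← e1]
    field_simp
  have hfin : ‖∑ n ∈ Finset.range (d + 1), ((p n : ℂ) - 2 * vtxMass Q n) * g n‖
      ≤ (d + 1) * (8 * E * M / s ^ d) := by
    refine (norm_sum_le_of_le _ hterm).trans (le_of_eq ?_)
    rw [Finset.sum_const, Finset.card_range, nsmul_eq_mul]
    push_cast
    ring
  have htail := (hasSum_nat_add_iff' (d + 1)).2 hI
  have hr : s⁻¹ < 1 := inv_lt_one_of_one_lt₀ hs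
  have hgeo : HasSum (fun i : ℕ => Q * M / s ^ (d + 1) * s⁻¹ ^ i)
      (Q * M / s ^ (d + 1) * (1 - s⁻¹)⁻¹) :=
    (hasSum_geometric_of_lt_one (by positivity) hr).mul_left _
  have htail_le : ‖I - ∑ i ∈ Finset.range (d + 1), (vtxMass Q i : ℂ) * g i‖
      ≤ Q * M / s ^ (d + 1) * (1 - s⁻¹)⁻¹ := by
    refine htail.norm_le_of_bounded hgeo fun i => ?_
    rw [norm_mul, Complex.norm_real, Real.norm_eq_abs, abs_of_pos (vtxMass_pos hQ1 _)]
    refine (mul_le_mul (vtxMass_le hQ1 _) (hg _) (norm_nonneg _) (by positivity)).trans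
      (le_of_eq ?_)
    have e2 : (Q : ℝ) ^ (i + (d + 1)) = s ^ (i + (d + 1)) * s ^ (i + (d + 1)) := by
      rw [← hsQ, ← pow_mul, mul_comm 2, pow_mul, sq]
    rw [e2, pow_add, inv_pow]
    field_simp
  have hdec : (Fintype.card U : ℂ)⁻¹ * ∑ u, g (d - 2 * m u) - 2 * I
      = ∑ n ∈ Finset.range (d + 1), ((p n : ℂ) - 2 * vtxMass Q n) * g n
        - 2 * (I - ∑ i ∈ Finset.range (d + 1), (vtxMass Q i : ℂ) * g i) := by
    rw [havg]
    simp only [sub_mul, Finset.sum_sub_distrib, mul_sub, Finset.mul_sum, mul_assoc]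
    ring
  rw [hdec]
  refine (norm_sub_le _ _).trans ?_
  rw [norm_mul, RCLike.norm_ofNat]
  refine (add_le_add hfin (mul_le_mul_of_nonneg_left htail_le zero_le_two)).trans (le_of_eq ?_)
  have hs1 : s - 1 ≠ 0 := by linarith
  have e3 : (1 - s⁻¹)⁻¹ = s / (s - 1) := by
    rw [inv_eq_one_div, div_eq_div_iff (by linarith) hs1]
    field_simp
  rw [e3, pow_succ]
  field_simp

end Distribution

section ErrorTerm

/-- The factor `W ^ 3 (d + 1)` is absorbed by `|D| ^ ε`, as `W = O(Q ^ (δ d))` with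
`δ = ε / 3`. -/
theorem exists_error_le {Q s ε C M B : ℝ} (hs : 1 < s) (hsQ : s ^ 2 = Q) (hε : 0 < ε) (hC : 0 ≤ C)
    (hM : 0 ≤ M) (hB : 0 ≤ B) : ∃ c : ℝ, 0 ≤ c ∧ ∀ (d : ℕ) (W : ℝ), 0 ≤ W →
      W ≤ C * (Q ^ 2) ^ (ε / 6 * d) →
      (8 * (2 * W ^ 3) * (d + 1) + B) * M / s ^ d ≤ c * (Q ^ (2 * d)) ^ (-(1 / 4 : ℝ) + ε) := by
  have hs0 : 0 < s := by linarith
  have hQ1 : 1 < Q := by nlinarith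
  have hQ0 : 0 < Q := by linarith
  set y := Q ^ ε with hy
  have hy1 : 1 < y := Real.one_lt_rpow hQ1 hε
  have hy0 : 0 < y - 1 := by linarith
  refine ⟨(16 * C ^ 3 * (1 + 1 / (y - 1)) + B) * M, by positivity, fun d W hW hWC => ?_⟩
  have hyd : 1 ≤ y ^ d := one_le_pow₀ hy1.le
  have hd : (d + 1 : ℝ) ≤ (1 + 1 / (y - 1)) * y ^ d := by
    have h := one_add_mul_le_pow (a := y - 1) (by linarith) d
    rw [add_sub_cancel] at h
    have h1 : (d : ℝ) ≤ 1 / (y - 1) * y ^ d := by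
      rw [div_mul_eq_mul_div, one_mul, le_div_iff₀ hy0]
      linarith
    linarith
  have hW3 : W ^ 3 ≤ C ^ 3 * y ^ d := by
    refine (pow_le_pow_left₀ hW hWC 3).trans (le_of_eq ?_)
    rw [mul_pow, ← Real.rpow_natCast (_ ^ (ε / 6 * d)) 3, ← Real.rpow_mul (by positivity),
      ← Real.rpow_natCast Q 2, ← Real.rpow_mul hQ0.le, hy, ← Real.rpow_natCast (Q ^ ε) d,
      ← Real.rpow_mul hQ0.le]
    congr 2
    push_cast
    ring
  have hrhs : (Q ^ (2 * d)) ^ (-(1 / 4 : ℝ) + ε) = y ^ d * y ^ d / s ^ d := by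
    have h1 : (Q ^ (2 * d)) ^ (-(1 / 4 : ℝ)) = (s ^ d)⁻¹ := by
      rw [← hsQ, ← pow_mul, show 2 * (2 * d) = d * 4 by ring, pow_mul, ← Real.rpow_natCast _ 4,
        ← Real.rpow_mul (by positivity)]
      norm_num
      rw [Real.rpow_neg_one]
    have h2 : (Q ^ (2 * d)) ^ ε = y ^ d * y ^ d := by
      rw [hy, ← Real.rpow_natCast Q, ← Real.rpow_mul hQ0.le, ← pow_add, ← Real.rpow_natCast (Q ^ ε),
        ← Real.rpow_mul hQ0.le]
      congr 1
      push_cast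
      ring
    rw [Real.rpow_add (by positivity), h1, h2]
    ring
  rw [hrhs, ← mul_div_assoc]
  have h1 : W ^ 3 * (d + 1) ≤ C ^ 3 * y ^ d * ((1 + 1 / (y - 1)) * y ^ d) :=
    mul_le_mul hW3 hd (by positivity) (by positivity)
  have h2 : B ≤ B * (y ^ d * y ^ d) :=
    le_mul_of_one_le_right hB (one_le_mul_of_one_le_of_one_le hyd hyd)
  have h3 : 8 * (2 * W ^ 3) * (d + 1) + B
      ≤ (16 * C ^ 3 * (1 + 1 / (y - 1)) + B) * (y ^ d * y ^ d) := by linarith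
  have h4 := mul_le_mul_of_nonneg_right h3 hM
  refine div_le_div_of_nonneg_right ?_ (by positivity)
  linarith

end ErrorTerm

/-! ### Equidistribution for one constant field extension -/

section Equidistribution

variable {F : Type*} [Field F] [Fintype F] {a : F}

theorem natDegree_C_mul_sq (ha : a ≠ 0) {𝔣 : F[X]} (h𝔣 : 𝔣.Monic) :
    (C a * 𝔣 ^ 2).natDegree = 2 * 𝔣.natDegree := by
  rw [natDegree_C_mul ha, h𝔣.natDegree_pow]

theorem card_quadExt [Fintype (QuadExt a)] : Fintype.card (QuadExt a) = Fintype.card F ^ 2 := by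
  rw [Fintype.card_congr (QuadraticAlgebra.equivProd a 0), Fintype.card_prod, sq]

/-- The bound for fixed `a`, with a constant that depends on `a`: the divisor bound is the one of
`F(√a)[T]`. -/
theorem exists_equidistribution_bound [Fact (∀ r : F, r ^ 2 ≠ a + 0 * r)] (ha : a ≠ 0) {r : ℕ}
    {f : QVertex F → ℂ} (hf : MemLp f 2 (mu F))
    (hsupp : ∀ v, f v ≠ 0 → ∃ n : ℕ, n ≡ r [MOD 2] ∧ v = vtx F n) {ε : ℝ} (hε : 0 < ε) :
    ∃ c : ℝ, 0 ≤ c ∧ ∀ 𝔣 : F[X], 𝔣.Monic → 𝔣.natDegree ≡ r [MOD 2] →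
      ‖(classNumber (C a * 𝔣 ^ 2) : ℂ)⁻¹ * (∑ᶠ x ∈ CM (C a * 𝔣 ^ 2), f (lambdaBar x))
          - 2 * ∫ v, f v ∂(mu F)‖
        ≤ c * ((q F : ℝ) ^ (C a * 𝔣 ^ 2).natDegree) ^ (-(1 / 4 : ℝ) + ε) := by
  have := Fintype.ofFinite (QuadExt a)
  obtain ⟨M, hM, hfM⟩ := exists_norm_le_of_memLp hf
  obtain ⟨C₀, hC₀, hdiv⟩ := exists_numDiv_le (k := QuadExt a)
    (div_pos hε (by norm_num : (0 : ℝ) < 6))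
  have hQ := one_lt_q_real F
  have hQ2 : 2 ≤ Fintype.card F := Fintype.one_lt_card
  have hs1 : 1 < √(q F : ℝ) := by rwa [Real.lt_sqrt zero_le_one, one_pow]
  have hsQ : √(q F : ℝ) ^ 2 = q F := Real.sq_sqrt (by positivity)
  have hs1' : 0 < √(q F : ℝ) - 1 := by linarith
  obtain ⟨c, hc, hcd⟩ := exists_error_le (B := 2 * (q F : ℝ) / (√(q F : ℝ) - 1)) hs1 hsQ hε
    (zero_le_one.trans hC₀) hM (by positivity)
  refine ⟨c, hc, fun 𝔣 h𝔣 hr => ?_⟩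
  have := finite_resRing (E := QuadExt a) h𝔣
  have := Fintype.ofFinite (ResRing (QuadExt a) 𝔣)ˣ
  obtain ⟨-, -, m, hm, hcount, havg⟩ := exists_average_CM (a := a) h𝔣
  have hW1 : (1 : ℝ) ≤ numDiv (up (QuadExt a) 𝔣) := by
    exact_mod_cast one_le_numDiv (up_ne_zero h𝔣.ne_zero)
  have hWC := hdiv (up (QuadExt a) 𝔣) (up_ne_zero h𝔣.ne_zero)
  rw [natDegree_up, card_quadExt, Nat.cast_pow] at hWC
  rw [havg, natDegree_C_mul_sq ha h𝔣]
  refine (norm_average_sub_le (E := 2 * (numDiv (up (QuadExt a) 𝔣) : ℝ) ^ 3)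
    (g := fun n => f (vtx F n)) hQ2 hm ?_ ?_ (hasSum_integral_mu hf) hM hs1 hsQ ?_ ?_).trans
    (hcd 𝔣.natDegree _ (by positivity) hWC)
  · have := one_le_pow₀ hW1 (n := 3)
    linarith
  · intro L hL
    have h := abs_average_sub_le (card_quadExt (a := a)) h𝔣 (L := L) (by omega)
    rwa [Finset.sum_congr rfl fun u _ => hcount u L hL] at h
  · intro n
    refine le_of_sq_le_sq ?_ (by positivity)
    rw [mul_pow, ← pow_mul, mul_comm n, pow_mul, hsQ]
    exact hfM n
  · intro n hn
    obtain ⟨k, hk, he⟩ := hsupp _ hn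
    rw [vtx_injective he]
    exact hk.trans hr.symm

end Equidistribution

end DrinfeldCM

end

open DrinfeldCM in
theorem theoremB (F : Type*) [Field F] [Fintype F] (hF : ringChar F ≠ 2)
    (r : ℕ) (f : QVertex F → ℂ) (hf : MemLp f 2 (mu F))
    (hsupp : ∀ v, f v ≠ 0 → ∃ n : ℕ, n ≡ r [MOD 2] ∧ v = vtx F n)
    (ε : ℝ) (hε : 0 < ε) :
    ∃ c : ℝ, ∀ (a : F) (𝔣 D : F[X]), ¬ IsSquare a → 𝔣.Monic → 𝔣.natDegree ≡ r [MOD 2] →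
      D = C a * 𝔣 ^ 2 →
      (CM D).Finite ∧
      (∀ z : Omega F, z.toY ∈ CM D → ∃ L : OLattice F, IsBuildingVertex z L) ∧
      ‖(classNumber D : ℂ)⁻¹ * (∑ᶠ x ∈ CM D, f (lambdaBar x)) - 2 * ∫ v, f v ∂(mu F)‖
        ≤ c * ((q F : ℝ) ^ D.natDegree) ^ (-(1 / 4 : ℝ) + ε) := by
  classical
  have hne : ∀ a : F, ¬ IsSquare a → a ≠ 0 := fun a ha h => ha (h ▸ IsSquare.zero)
  have hfact : ∀ a : F, ¬ IsSquare a → Fact (∀ r : F, r ^ 2 ≠ a + 0 * r) := fun a ha =>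
    ⟨fun r h => ha ⟨r, by linear_combination -h⟩⟩
  have hbound : ∀ a : F, ∃ c : ℝ, 0 ≤ c ∧ (¬ IsSquare a → ∀ 𝔣 : F[X], 𝔣.Monic →
      𝔣.natDegree ≡ r [MOD 2] →
      ‖(classNumber (C a * 𝔣 ^ 2) : ℂ)⁻¹ * (∑ᶠ x ∈ CM (C a * 𝔣 ^ 2), f (lambdaBar x))
          - 2 * ∫ v, f v ∂(mu F)‖
        ≤ c * ((q F : ℝ) ^ (C a * 𝔣 ^ 2).natDegree) ^ (-(1 / 4 : ℝ) + ε)) := by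
    intro a
    by_cases ha : IsSquare a
    · exact ⟨0, le_rfl, fun h => absurd ha h⟩
    · have := hfact a ha
      obtain ⟨c, hc, h⟩ := exists_equidistribution_bound (hne a ha) hf hsupp hε
      exact ⟨c, hc, fun _ => h⟩
  choose c hc hcb using hbound
  -- there are only finitely many `a`, and the sum of their constants serves all of them
  refine ⟨∑ a, c a, ?_⟩
  rintro a 𝔣 D ha h𝔣 hr rfl
  have := hfact a ha
  have := finite_resRing (E := QuadExt a) h𝔣
  have := Fintype.ofFinite (ResRing (QuadExt a) 𝔣)ˣ
  obtain ⟨hfin, hvert, -⟩ := exists_average_CM (a := a) h𝔣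
  refine ⟨hfin, hvert, (hcb a ha 𝔣 h𝔣 hr).trans (mul_le_mul_of_nonneg_right ?_ (by positivity))⟩
  exact Finset.single_le_sum (fun b _ => hc b) (Finset.mem_univ a)
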